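/- Let $0<\beta<1/2$, $\theta\in\{0,1\}$ (the one-sided cases), $0<K_m$ and $K_M\in\mathbb R$. Consider diffusivities $K\in L^\infty(0,1)$ with $K_m\le K\le K_M$ a.e. Notation. $H^\mu_0(0,1)$ is the completion of $C_0^\infty(0,1)$ in the norm $\|w\|_{H^\mu}=(\|w\|_{L^2(\mathbb R)}^2+\||\omega|^\mu\mathcal F w\|_{L^2(\mathbb R)}^2)^{1/2}$ with $\mathcal F$ the unitary Fourier transform, and $H^{-1}(0,1)$ is the dual of $H^1_0(0,1)$. For integer $m\ge 0$, $H^m(0,1)$ is the space of functions whose weak derivatives up to order $m$ lie in $L^2(0,1)$. Put $${}^l I^{\beta}w(x)=\tfrac1{\Gamma(\beta)}\int_0^x\frac{w(s)}{(x-s)^{1-\beta}}ds,\qquad {}^r I^{\beta}w(x)=\tfrac1{\Gamma(\beta)}\int_x^1\frac{w(s)}{(s-x)^{1-\beta}}ds,\qquad I^\beta_\theta=\theta\,{}^lI^\beta+(1-\theta)\,{}^rI^\beta .$$ For $f\in H^{-1}(0,1)$, a weak solution of $-D[K\,D I^\beta_\theta u]=f$, $u(0)=u(1)=0$, is a $u\in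 H^{1-\beta}_0(0,1)$ with $$A(u,v):=(K\,D I^\beta_\theta u,\,Dv)_{L^2(0,1)}=\langle f,v\rangle\qquad\text{for all }v\in H^1_0(0,1).$$ Let $w_l\in H^1(0,1)$ be the solution of $(K\,Dw_l,Dv)_{L^2(0,1)}=0$ for all $v\in H^1_0(0,1)$, $w_l(0)=1$, $w_l(1)=0$, and let $u_l\in H^{1-\beta}_0(0,1)$ be the solution of $$I^\beta_\theta u_l(x)-(1-\theta)\,({}^rI^\beta u_l)(0)\,(1-x)-\theta\,({}^lI^\beta u_l)(1)\,x=w_l(x)-(1-x),\qquad 0\le x\le1.$$ Theorem. For every such $K$, the following hold. 1. The functions $w_l$ and $u_l$ exist and are unique, and the nondegeneracy condition $$1+\theta\,({}^lI^\beta u_l)(1)-(1-\theta)\,({}^rI^\beta u_l)(0)\ne0$$ holds. 2. For every $f\in H^{-1}(0,1)$ a weak solution exists, and it is unique if and only if the nondegeneracy condition holds (hence it is unique). 3. $D I^\beta_\theta u\in L^2(0,1)$ for every $u\in H_0^{1-\beta}(0,1)$, and the bilinear form $A$ is bounded and weakly coercive on $H^{1-\beta}_0(0,1)\times H^1_0(0,1)$: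 there are constants $M$ and $\kappa>0$, depending only on $\beta,\theta,K_m,K_M$, such that $|A(w,v)|\le M\|w\|_{H^{1-\beta}}\|v\|_{H^1}$, $$\inf_{0\ne w\in H^{1-\beta}_0}\ \sup_{0\ne v\in H^1_0}\frac{A(w,v)}{\|w\|_{H^{1-\beta}}\|v\|_{H^1}}\ge\kappa,\qquad \sup_{w\in H^{1-\beta}_0}A(w,v)>0\quad\text{for all }0\ne v\in H^1_0 .$$ For every $f\in H^{-1}(0,1)$ there is a unique weak solution $u$, and $\|u\|_{H^{1-\beta}}\le\kappa^{-1}\|f\|_{H^{-1}}$ with the same $\kappa$. 4. Let $m\ge0$ be an integer. If moreover $K\in C^{m+1}[0,1]$ and $f\in H^m(0,1)$ (acting by $\langle f,v\rangle=\int_0^1 fv$), then the unique weak solution $u$ satisfies $I^\beta_\theta u\in H^{m+2}(0,1)$ and $$\|I^\beta_\theta u\|_{H^{m+2}(0,1)}\le C\big(\|K\|_{C^{m+1}[0,1]}+\|f\|_{H^m(0,1)}\big),$$ where $C>0$ depends only on $\beta,\theta,m,K_m,K_M$ and an upper bound for $\|K\|_{C^{m+1}[0,1]}$, and not on $f$.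 -/

import Mathlib

open MeasureTheory
open scoped FourierTransform ContDiff

namespace FracDiff

noncomputable section

/-- Lebesgue measure on the interval `(0,1)`. -/
def unitMeasure : Measure ℝ := volume.restrict (Set.Ioo (0 : ℝ) 1)

/-- `φ ∈ C_0^∞(0,1)`: smooth with compact support contained in `(0,1)`. -/
def IsTestFunction (φ : ℝ → ℝ) : Prop :=
  ContDiff ℝ ∞ φ ∧ HasCompactSupport φ ∧ tsupport φ ⊆ Set.Ioo (0 : ℝ) 1

/-! ### The spaces `H^μ_0(0,1)` and `H^{-1}(0,1)` -/

/-- The Hilbert sum `L²(ℝ;ℝ) × L²(ℝ;ℂ)` with norm `‖(a,b)‖² = ‖a‖² + ‖b‖²`. -/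
abbrev L2Pair : Type := WithLp 2 (Lp ℝ 2 (volume : Measure ℝ) × Lp ℂ 2 (volume : Measure ℝ))

/-- The pairs `(φ, |ω|^μ 𝓕φ)`, `φ ∈ C_0^∞(0,1)`. With the transform `∫ e^{-2πixξ} φ(x) dx`
the angular frequency is `ω = 2πξ`, so the norm of the pair is the norm
`(‖φ‖²_{L²} + ‖ |ω|^μ 𝓕φ ‖²_{L²})^{1/2}` of `H^μ(ℝ)` (with unitary `𝓕`). -/
def testGraph (μ : ℝ) : Set L2Pair :=
  {p | ∃ φ : ℝ → ℝ, IsTestFunction φ ∧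
    (p.fst : ℝ → ℝ) =ᵐ[volume] φ ∧
    (p.snd : ℝ → ℂ) =ᵐ[volume]
      fun ξ => (((2 * Real.pi * |ξ|) ^ μ : ℝ) : ℂ) * 𝓕 (fun x : ℝ => (φ x : ℂ)) ξ}

/-- `H^μ_0(0,1)`: the completion of `C_0^∞(0,1)` in the norm of `H^μ(ℝ)`, realised as the closure
of the isometric image `testGraph μ` (already a linear subspace) in a Hilbert space. -/
def H0Submodule (μ : ℝ) : Submodule ℝ L2Pair :=
  (Submodule.span ℝ (testGraph μ)).topologicalClosure

/-- The Hilbert space `H^μ_0(0,1)`; its norm is that of `H^μ(ℝ)`. -/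
def H0 (μ : ℝ) : Type := H0Submodule μ

instance (μ : ℝ) : NormedAddCommGroup (H0 μ) :=
  inferInstanceAs (NormedAddCommGroup (H0Submodule μ))

instance (μ : ℝ) : InnerProductSpace ℝ (H0 μ) :=
  inferInstanceAs (InnerProductSpace ℝ (H0Submodule μ))

/-- The function (an `L²` class on `ℝ`) underlying an element of `H^μ_0(0,1)`. -/
def H0.fn {μ : ℝ} (u : H0 μ) : ℝ → ℝ := (u.1.fst : Lp ℝ 2 (volume : Measure ℝ))

/-- `H^{-1}(0,1)`, the dual of `H^1_0(0,1)`, with the dual norm. -/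
abbrev HNeg1 : Type := StrongDual ℝ (H0 1)

/-! ### Weak derivatives and `H^m(0,1)` for integers `m` -/

/-- `g ∈ L²(0,1)` is the weak derivative of order `k` of `w` on `(0,1)`. -/
def IsWeakDeriv (k : ℕ) (w g : ℝ → ℝ) : Prop :=
  MemLp g 2 unitMeasure ∧ ∀ φ : ℝ → ℝ, IsTestFunction φ →
    ∫ x, w x * iteratedDeriv k φ x ∂unitMeasure = (-1) ^ k * ∫ x, g x * φ x ∂unitMeasure

/-- `w ∈ H^m(0,1)`. -/
def MemH (m : ℕ) (w : ℝ → ℝ) : Prop :=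
  MemLp w 2 unitMeasure ∧ ∀ k ≤ m, ∃ g, IsWeakDeriv k w g

open Classical in
/-- The weak derivative `D^k w` on `(0,1)` (unique almost everywhere when it exists in `L²`). -/
def weakDeriv (k : ℕ) (w : ℝ → ℝ) : ℝ → ℝ :=
  if h : ∃ g, IsWeakDeriv k w g then h.choose else 0

/-- The norm of `H^m(0,1)`. -/
def normH (m : ℕ) (w : ℝ → ℝ) : ℝ :=
  Real.sqrt (∑ k ∈ Finset.range (m + 1), ∫ x, weakDeriv k w x ^ 2 ∂unitMeasure)

/-- The norm of `C^n[0,1]`. -/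
def normC (n : ℕ) (K : ℝ → ℝ) : ℝ :=
  ∑ k ∈ Finset.range (n + 1),
    ⨆ x : Set.Icc (0 : ℝ) 1, |iteratedDerivWithin k K (Set.Icc 0 1) x|

/-! ### Fractional integrals -/

/-- The left fractional integral of order `σ` on `(0,1)`. -/
def leftInt (σ : ℝ) (w : ℝ → ℝ) (x : ℝ) : ℝ :=
  1 / Real.Gamma σ * ∫ s in (0 : ℝ)..x, w s / (x - s) ^ (1 - σ)

/-- The right fractional integral of order `σ` on `(0,1)`. -/
def rightInt (σ : ℝ) (w : ℝ → ℝ) (x : ℝ) : ℝ :=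
  1 / Real.Gamma σ * ∫ s in x..(1 : ℝ), w s / (s - x) ^ (1 - σ)

/-- The two-sided fractional integral operator `I^β_θ`. -/
def fracInt (β θ : ℝ) (w : ℝ → ℝ) (x : ℝ) : ℝ :=
  θ * leftInt β w x + (1 - θ) * rightInt β w x

/-! ### The boundary-value problem -/

/-- `K ∈ L^∞(0,1)` with `K_m ≤ K ≤ K_M` almost everywhere. -/
def IsDiffusivity (Km KM : ℝ) (K : ℝ → ℝ) : Prop :=
  AEStronglyMeasurable K unitMeasure ∧ ∀ᵐ x ∂unitMeasure, Km ≤ K x ∧ K x ≤ KM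

/-- The bilinear form `A(u,v) = (K D I^β_θ u, D v)_{L²(0,1)}`. -/
def formA (β θ : ℝ) (K : ℝ → ℝ) (u : H0 (1 - β)) (v : H0 1) : ℝ :=
  ∫ x, K x * weakDeriv 1 (fracInt β θ u.fn) x * weakDeriv 1 v.fn x ∂unitMeasure

/-- `u ∈ H^{1-β}_0(0,1)` solves the Petrov-Galerkin formulation with right-hand side `f`. -/
def IsWeakSolution (β θ : ℝ) (K : ℝ → ℝ) (f : H0 1 → ℝ) (u : H0 (1 - β)) : Prop :=
  ∀ v : H0 1, formA β θ K u v = f v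

/-- `w` is (the continuous representative of) the weak solution `w_l` in `H^1(0,1)` of
`-D(K D w) = 0`, `w(0) = 1`, `w(1) = 0`. -/
def IsWl (K w : ℝ → ℝ) : Prop :=
  ContinuousOn w (Set.Icc 0 1) ∧ MemH 1 w ∧ w 0 = 1 ∧ w 1 = 0 ∧
    ∀ v : H0 1, ∫ x, K x * weakDeriv 1 w x * weakDeriv 1 v.fn x ∂unitMeasure = 0

/-- `u_l ∈ H^{1-β}_0(0,1)` solves
`I^β_θ u_l - (1-θ) (ʳI^β u_l)(0) (1-x) - θ (ˡI^β u_l)(1) x = w_l - (1-x)` on `[0,1]`. -/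
def IsUl (β θ : ℝ) (wl : ℝ → ℝ) (ul : H0 (1 - β)) : Prop :=
  ∀ x ∈ Set.Icc (0 : ℝ) 1,
    fracInt β θ ul.fn x - (1 - θ) * rightInt β ul.fn 0 * (1 - x) - θ * leftInt β ul.fn 1 * x
      = wl x - (1 - x)

/-- The nondegeneracy condition `1 + θ (ˡI^β u_l)(1) - (1-θ) (ʳI^β u_l)(0) ≠ 0`. -/
def Nondegenerate (β θ : ℝ) (K : ℝ → ℝ) : Prop :=
  ∀ (wl : ℝ → ℝ) (ul : H0 (1 - β)), IsWl K wl → IsUl β θ wl ul →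
    1 + θ * leftInt β ul.fn 1 - (1 - θ) * rightInt β ul.fn 0 ≠ 0

end

end FracDiff

/-!
The operator `u ↦ D I^β_θ u` is an isomorphism of `H^{1-β}_0(0,1)` onto the orthogonal complement
in `L²(0,1)` of the weight `(1-s)^{-β}` (left-sided case) or `s^{-β}` (right-sided case), which is
square integrable because `β < 1/2`. The two-sided bound on its norm comes from the Fourier
transform of the exponentially damped kernel: pairing a left with a right fractional integral
produces the real part of `z^{-2β}`, which for `z` in the right half plane is at least
`cos(πβ) |z|^{-2β}`. Likewise `D` maps `H^1_0(0,1)` isomorphically onto the orthogonal complement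
of the constants.

Hence the bilinear form is multiplication by `K` between two hyperplanes of `L²(0,1)`, and
well-posedness reduces to the positivity of the integral of the weight divided by `K`. Normalised
by the integrals of `1/K` and of the weight, this integral is exactly the nondegeneracy number.
Regularity follows by integrating the equation once, `K D I^β_θ u = a - ∫₀ˣ f` with `a` a weighted
mean of the primitive of `f`, and dividing by `K`.
-/

namespace FracDiff

open Set Filter Topology

/-! ### Test functions on the unit interval -/

section TestFunctions

instance : IsProbabilityMeasure unitMeasure :=
  ⟨by simp [unitMeasure]⟩

lemma ae_unitMeasure_iff {p : ℝ → Prop} :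
    (∀ᵐ x ∂unitMeasure, p x) ↔ ∀ᵐ x, x ∈ Ioo (0 : ℝ) 1 → p x :=
  ae_restrict_iff' measurableSet_Ioo

lemma ae_unitMeasure_of_forall {p : ℝ → Prop} (h : ∀ x ∈ Ioo (0 : ℝ) 1, p x) :
    ∀ᵐ x ∂unitMeasure, p x :=
  ae_unitMeasure_iff.2 (ae_of_all _ h)

lemma integral_unitMeasure (f : ℝ → ℝ) : ∫ x, f x ∂unitMeasure = ∫ x in (0 : ℝ)..1, f x := by
  rw [unitMeasure, intervalIntegral.integral_of_le zero_le_one, integral_Ioc_eq_integral_Ioo]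

lemma intervalIntegrable_of_integrable_unitMeasure {f : ℝ → ℝ} (hf : Integrable f unitMeasure)
    {a b : ℝ} (ha : a ∈ Icc (0 : ℝ) 1) (hb : b ∈ Icc (0 : ℝ) 1) :
    IntervalIntegrable f volume a b :=
  (((integrableOn_Icc_iff_integrableOn_Ioo (by simp) (by simp)).2 hf).mono_set
    (uIcc_subset_Icc ha hb)).intervalIntegrable

namespace IsTestFunction

variable {φ ψ : ℝ → ℝ}

protected lemma continuous (h : IsTestFunction φ) : Continuous φ := h.1.continuous

protected lemma differentiable (h : IsTestFunction φ) : Differentiable ℝ φ :=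
  h.1.differentiable (by simp)

lemma eq_zero_of_notMem (h : IsTestFunction φ) {x : ℝ} (hx : x ∉ Ioo (0 : ℝ) 1) : φ x = 0 :=
  image_eq_zero_of_notMem_tsupport fun hx' => hx (h.2.2 hx')

protected lemma deriv (h : IsTestFunction φ) : IsTestFunction (deriv φ) :=
  ⟨(contDiff_infty_iff_deriv.1 h.1).2, h.2.1.deriv, tsupport_deriv_subset.trans h.2.2⟩

protected lemma iteratedDeriv (h : IsTestFunction φ) (k : ℕ) :
    IsTestFunction (iteratedDeriv k φ) := by
  induction k with
  | zero => simpa using h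
  | succ k ih => rw [iteratedDeriv_succ]; exact ih.deriv

protected lemma add (h : IsTestFunction φ) (h' : IsTestFunction ψ) : IsTestFunction (φ + ψ) :=
  ⟨h.1.add h'.1, h.2.1.add h'.2.1, (tsupport_add _ _).trans (union_subset h.2.2 h'.2.2)⟩

lemma const_smul (h : IsTestFunction φ) (c : ℝ) : IsTestFunction (c • φ) :=
  ⟨h.1.const_smul c, h.2.1.smul_left (f := fun _ => c),
    (tsupport_smul_subset_right (fun _ => c) φ).trans h.2.2⟩

protected lemma zero : IsTestFunction (0 : ℝ → ℝ) :=
  ⟨contDiff_const, HasCompactSupport.zero, by simp [tsupport]⟩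

lemma comp_one_sub (h : IsTestFunction φ) : IsTestFunction (fun x => φ (1 - x)) := by
  have e : (fun x => φ (1 - x)) = φ ∘ Homeomorph.subLeft (1 : ℝ) := rfl
  refine ⟨h.1.comp (by fun_prop), e ▸ h.2.1.comp_homeomorph _, ?_⟩
  rw [e, tsupport_comp_eq_preimage]
  intro x hx
  obtain ⟨h0, h1⟩ : 0 < 1 - x ∧ 1 - x < 1 := h.2.2 hx
  exact ⟨by linarith, by linarith⟩

lemma integral_deriv_eq (h : IsTestFunction φ) (a b : ℝ) :
    ∫ x in a..b, deriv φ x = φ b - φ a :=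
  intervalIntegral.integral_deriv_eq_sub (fun x _ => h.differentiable x)
    (h.deriv.continuous.intervalIntegrable _ _)

lemma memLp (h : IsTestFunction φ) (p : ENNReal) (μ : Measure ℝ) [IsFiniteMeasureOnCompacts μ] :
    MemLp φ p μ := h.continuous.memLp_of_hasCompactSupport h.2.1

lemma integrable (h : IsTestFunction φ) : Integrable φ :=
  h.continuous.integrable_of_hasCompactSupport h.2.1

lemma integrable_unitMeasure (h : IsTestFunction φ) : Integrable φ unitMeasure :=
  h.integrable.restrict

lemma exists_bound (h : IsTestFunction φ) : ∃ M : ℝ, ∀ x, |φ x| ≤ M :=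
  h.2.1.exists_bound_of_continuous h.continuous

lemma integrable_mul (h : IsTestFunction φ) {q : ℝ → ℝ} (hq : Integrable q unitMeasure) :
    Integrable (fun x => q x * φ x) unitMeasure := by
  obtain ⟨M, hM⟩ := h.exists_bound
  exact hq.mul_bdd (c := M) h.continuous.aestronglyMeasurable (ae_of_all _ hM)

lemma exists_tsupport_subset_Icc (h : IsTestFunction φ) :
    ∃ a b : ℝ, 0 < a ∧ b < 1 ∧ tsupport φ ⊆ Icc a b := by
  rcases (tsupport φ).eq_empty_or_nonempty with he | hne
  · exact ⟨1, 0, one_pos, zero_lt_one, by simp [he]⟩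
  · have hc : IsCompact (tsupport φ) := h.2.1
    exact ⟨sInf (tsupport φ), sSup (tsupport φ), (h.2.2 (hc.sInf_mem hne)).1,
      (h.2.2 (hc.sSup_mem hne)).2, fun x hx =>
        ⟨csInf_le hc.bddBelow hx, le_csSup hc.bddAbove hx⟩⟩

lemma support_primitive_subset (h : IsTestFunction ψ) (h0 : ∫ x, ψ x ∂unitMeasure = 0) {a b : ℝ}
    (ha : 0 < a) (hb : b < 1) (hab : tsupport ψ ⊆ Icc a b) :
    Function.support (fun x => ∫ s in (0 : ℝ)..x, ψ s) ⊆ Icc a b := by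
  have hψ : ∀ s, s ∉ Icc a b → ψ s = 0 := fun s hs =>
    image_eq_zero_of_notMem_tsupport fun hs' => hs (hab hs')
  have hzero : ∀ c d, (∀ s ∈ uIcc c d, s ∉ Icc a b) → ∫ s in c..d, ψ s = 0 := fun c d hcd => by
    rw [intervalIntegral.integral_congr fun s hs => hψ s (hcd s hs), intervalIntegral.integral_zero]
  refine Function.support_subset_iff'.2 fun x hx => ?_
  rw [mem_Icc, not_and_or, not_le, not_le] at hx
  rcases hx with hxa | hxb
  · exact hzero 0 x fun s hs hs' => (hs.2.trans_lt (max_lt ha hxa)).not_ge hs'.1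
  · rw [← intervalIntegral.integral_add_adjacent_intervals (h.continuous.intervalIntegrable 0 1)
      (h.continuous.intervalIntegrable 1 x), ← integral_unitMeasure, h0, zero_add]
    exact hzero 1 x fun s hs hs' => ((lt_min hb hxb).trans_le hs.1).not_ge hs'.2

lemma exists_deriv_eq (h : IsTestFunction ψ) (h0 : ∫ x, ψ x ∂unitMeasure = 0) :
    ∃ φ, IsTestFunction φ ∧ deriv φ = ψ := by
  have hd : ∀ x, HasDerivAt (fun x => ∫ s in (0 : ℝ)..x, ψ s) (ψ x) x :=
    fun x => h.continuous.integral_hasStrictDerivAt 0 x |>.hasDerivAt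
  have hderiv : deriv (fun x => ∫ s in (0 : ℝ)..x, ψ s) = ψ := funext fun x => (hd x).deriv
  obtain ⟨a, b, ha, hb, hab⟩ := h.exists_tsupport_subset_Icc
  have hsupp := h.support_primitive_subset h0 ha hb hab
  refine ⟨fun x => ∫ s in (0 : ℝ)..x, ψ s, ⟨?_, ?_, ?_⟩, hderiv⟩
  · rw [contDiff_infty_iff_deriv, hderiv]
    exact ⟨fun x => (hd x).differentiableAt, h.1⟩
  · exact HasCompactSupport.of_support_subset_isCompact isCompact_Icc hsupp
  · exact (closure_minimal hsupp isClosed_Icc).trans (Icc_subset_Ioo ha hb)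

lemma exists_deriv_eq_sub_smul (hφ : IsTestFunction φ) (hψ : IsTestFunction ψ)
    (hψ1 : ∫ x, ψ x ∂unitMeasure = 1) :
    ∃ χ, IsTestFunction χ ∧ deriv χ = φ - (∫ x, φ x ∂unitMeasure) • ψ := by
  have htest : IsTestFunction (φ - (∫ x, φ x ∂unitMeasure) • ψ) := by
    rw [sub_eq_add_neg, ← neg_smul]
    exact hφ.add (hψ.const_smul _)
  refine htest.exists_deriv_eq ?_
  simp only [Pi.sub_apply, Pi.smul_apply, smul_eq_mul]
  rw [integral_sub hφ.integrable_unitMeasure (hψ.integrable_unitMeasure.const_mul _),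
    integral_const_mul, hψ1, mul_one, sub_self]

end IsTestFunction

lemma exists_isTestFunction_integral_eq_one :
    ∃ φ, IsTestFunction φ ∧ ∫ x, φ x ∂unitMeasure = 1 := by
  let f : ContDiffBump (1 / 2 : ℝ) := ⟨1 / 8, 1 / 4, by norm_num, by norm_num⟩
  have hs : tsupport (f.normed volume) ⊆ Ioo (0 : ℝ) 1 := by
    rw [f.tsupport_normed_eq, Real.closedBall_eq_Icc]
    exact Icc_subset_Ioo (by norm_num [f]) (by norm_num [f])
  refine ⟨f.normed volume, ⟨f.contDiff_normed, f.hasCompactSupport_normed, hs⟩, ?_⟩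
  rw [unitMeasure, setIntegral_eq_integral_of_forall_compl_eq_zero, f.integral_normed]
  exact fun x hx => image_eq_zero_of_notMem_tsupport fun h => hx (hs h)

lemma ae_eq_zero_of_forall_integral_mul_eq_zero {q : ℝ → ℝ} (hq : Integrable q unitMeasure)
    (h : ∀ φ, IsTestFunction φ → ∫ x, q x * φ x ∂unitMeasure = 0) : q =ᵐ[unitMeasure] 0 := by
  refine ae_unitMeasure_iff.2 (isOpen_Ioo.ae_eq_zero_of_integral_contDiff_smul_eq_zero
    (IntegrableOn.locallyIntegrableOn hq) fun φ hφ hc hs => ?_)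
  have htest : IsTestFunction φ := ⟨hφ, hc, hs⟩
  rw [← h φ htest, unitMeasure, setIntegral_eq_integral_of_forall_compl_eq_zero
    fun x hx => by rw [htest.eq_zero_of_notMem hx, mul_zero]]
  simp only [smul_eq_mul, mul_comm]

/-- The lemma of du Bois-Reymond. -/
lemma ae_eq_const_of_forall_integral_mul_deriv_eq_zero {q : ℝ → ℝ} (hq : Integrable q unitMeasure)
    (h : ∀ φ, IsTestFunction φ → ∫ x, q x * deriv φ x ∂unitMeasure = 0) :
    ∃ c : ℝ, q =ᵐ[unitMeasure] fun _ => c := by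
  obtain ⟨ψ, hψ, hψ1⟩ := exists_isTestFunction_integral_eq_one
  set c := ∫ x, q x * ψ x ∂unitMeasure with hc
  suffices h0 : (fun x => q x - c) =ᵐ[unitMeasure] 0 from
    ⟨c, h0.mono fun x hx => sub_eq_zero.1 hx⟩
  refine ae_eq_zero_of_forall_integral_mul_eq_zero (hq.sub (integrable_const c)) fun φ hφ => ?_
  obtain ⟨χ, hχ, hχ'⟩ := hφ.exists_deriv_eq_sub_smul hψ hψ1
  have hqχ := h χ hχ
  simp only [hχ', Pi.sub_apply, Pi.smul_apply, smul_eq_mul, mul_sub, mul_left_comm (q _)] at hqχ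
  rw [integral_sub (hφ.integrable_mul hq) ((hψ.integrable_mul hq).const_mul _),
    integral_const_mul, ← hc] at hqχ
  simp only [sub_mul]
  rw [integral_sub (hφ.integrable_mul hq) (hφ.integrable_unitMeasure.const_mul _),
    integral_const_mul, mul_comm c, hqχ]

/-- The linear space `C_0^∞(0,1)` of test functions. -/
def testSpace : Submodule ℝ (ℝ → ℝ) where
  carrier := {φ | IsTestFunction φ}
  add_mem' h h' := h.add h'
  zero_mem' := IsTestFunction.zero
  smul_mem' c _ h := h.const_smul c

end TestFunctions

/-! ### Fractional integrals as convolutions -/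

section SquareIntegrable

variable {α : Type*} [MeasurableSpace α] {μ : Measure α} {f g : α → ℝ}

lemma inner_toLp (hf : MemLp f 2 μ) (hg : MemLp g 2 μ) :
    inner ℝ (hf.toLp f) (hg.toLp g) = ∫ x, f x * g x ∂μ := by
  rw [L2.inner_def]
  refine integral_congr_ae ?_
  filter_upwards [hf.coeFn_toLp, hg.coeFn_toLp] with x hx hx'
  simp [hx, hx', mul_comm]

lemma norm_sq_toLp {E : Type*} [NormedAddCommGroup E] {f : α → E} (hf : MemLp f 2 μ) :
    ‖hf.toLp f‖ ^ 2 = ∫ x, ‖f x‖ ^ 2 ∂μ := by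
  have hnn : 0 ≤ ∫ x, ‖f x‖ ^ 2 ∂μ := by positivity
  rw [Lp.norm_toLp, hf.eLpNorm_eq_integral_rpow_norm two_ne_zero ENNReal.ofNat_ne_top,
    ENNReal.toReal_ofReal (by positivity)]
  simp only [ENNReal.toReal_ofNat, Real.rpow_ofNat]
  rw [← one_div, ← Real.sqrt_eq_rpow, Real.sq_sqrt hnn]

lemma sq_integral_mul_le (hf : MemLp f 2 μ) (hg : MemLp g 2 μ) :
    (∫ x, f x * g x ∂μ) ^ 2 ≤ (∫ x, f x ^ 2 ∂μ) * ∫ x, g x ^ 2 ∂μ := by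
  simp only [sq, ← inner_toLp hf hg, ← inner_toLp hf hf, ← inner_toLp hg hg]
  exact real_inner_mul_inner_self_le _ _

end SquareIntegrable

section RieszKernel

/-- The convolution kernel `t_+^{σ-1} / Γ(σ)` of the fractional integrals of order `σ`. -/
noncomputable def rieszKernel (σ : ℝ) : ℝ → ℝ :=
  (Ioi 0).indicator fun t => t ^ (σ - 1) / Real.Gamma σ

variable {σ a b t : ℝ}

lemma rieszKernel_of_pos (σ : ℝ) (ht : 0 < t) : rieszKernel σ t = t ^ (σ - 1) / Real.Gamma σ :=
  indicator_of_mem (mem_Ioi.2 ht) _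

lemma rieszKernel_of_nonpos (σ : ℝ) (ht : t ≤ 0) : rieszKernel σ t = 0 :=
  indicator_of_notMem (notMem_Ioi.2 ht) _

lemma rieszKernel_one_of_pos (ht : 0 < t) : rieszKernel 1 t = 1 := by
  simp [rieszKernel_of_pos, ht]

lemma rieszKernel_nonneg (hσ : 0 < σ) (t : ℝ) : 0 ≤ rieszKernel σ t :=
  indicator_nonneg (fun _ ht => div_nonneg (Real.rpow_nonneg (le_of_lt ht) _)
    (Real.Gamma_pos_of_pos hσ).le) t

lemma rieszKernel_le (hσ : 1 ≤ σ) (ht : t ≤ 1) : rieszKernel σ t ≤ 1 / Real.Gamma σ := by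
  have := Real.Gamma_pos_of_pos (zero_lt_one.trans_le hσ)
  rcases le_or_gt t 0 with h | h
  · rw [rieszKernel_of_nonpos σ h]
    positivity
  · rw [rieszKernel_of_pos σ h]
    gcongr
    exact Real.rpow_le_one h.le ht (by linarith)

lemma rieszKernel_one_sub_sq (ha : a < 1 / 2) (t : ℝ) :
    rieszKernel (1 - a) t ^ 2 =
      Real.Gamma (1 - 2 * a) / Real.Gamma (1 - a) ^ 2 * rieszKernel (1 - 2 * a) t := by
  have hG := (Real.Gamma_pos_of_pos (show 0 < 1 - 2 * a by linarith)).ne'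
  rcases le_or_gt t 0 with h | h
  · simp [rieszKernel_of_nonpos, h]
  · rw [rieszKernel_of_pos _ h, rieszKernel_of_pos _ h, div_pow, ← Real.rpow_mul_natCast h.le,
      show (1 - a - 1) * ((2 : ℕ) : ℝ) = 1 - 2 * a - 1 by push_cast; ring]
    field_simp [hG]

@[fun_prop]
lemma measurable_rieszKernel (σ : ℝ) : Measurable (rieszKernel σ) :=
  Measurable.indicator (by fun_prop) measurableSet_Ioi

lemma integrableOn_rieszKernel (hσ : 0 < σ) : IntegrableOn (rieszKernel σ) (Iio 1) := by
  have h : IntegrableOn (fun t : ℝ => t ^ (σ - 1) / Real.Gamma σ) (Ioc 0 1) :=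
    (intervalIntegral.intervalIntegrable_rpow' (by linarith)).1.div_const _
  rw [rieszKernel, IntegrableOn, integrable_indicator_iff measurableSet_Ioi, IntegrableOn,
    Measure.restrict_restrict measurableSet_Ioi]
  exact h.mono_set fun t ht => ⟨ht.1, ht.2.le⟩

lemma integral_rpow_mul_sub_rpow (ha : 0 < a) (hb : 0 < b) (ht : 0 < t) :
    ∫ s in (0 : ℝ)..t, s ^ (a - 1) * (t - s) ^ (b - 1) =
      t ^ (a + b - 1) * (Real.Gamma a * Real.Gamma b / Real.Gamma (a + b)) := by
  have h := Complex.betaIntegral_scaled (a : ℂ) (b : ℂ) ht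
  rw [Complex.betaIntegral_eq_Gamma_mul_div _ _ (by simpa) (by simpa)] at h
  simp only [← Complex.ofReal_add, Complex.Gamma_ofReal] at h
  have hInt : ∫ s in (0 : ℝ)..t, (s : ℂ) ^ ((a : ℂ) - 1) * ((t : ℂ) - s) ^ ((b : ℂ) - 1) =
      ((∫ s in (0 : ℝ)..t, s ^ (a - 1) * (t - s) ^ (b - 1) : ℝ) : ℂ) := by
    rw [← intervalIntegral.integral_ofReal]
    refine intervalIntegral.integral_congr fun s hs => ?_
    rw [uIcc_of_le ht.le] at hs
    push_cast [Complex.ofReal_cpow hs.1, Complex.ofReal_cpow (sub_nonneg.2 hs.2)]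
    rfl
  rw [hInt, show ((a + b : ℝ) : ℂ) - 1 = ((a + b - 1 : ℝ) : ℂ) by push_cast; ring,
    ← Complex.ofReal_cpow ht.le] at h
  exact_mod_cast h

lemma integral_rieszKernel_mul (ha : 0 < a) (hb : 0 < b) (t : ℝ) :
    ∫ s, rieszKernel a s * rieszKernel b (t - s) = rieszKernel (a + b) t := by
  have hsupp : ∀ s ∉ Ioo 0 t, rieszKernel a s * rieszKernel b (t - s) = 0 := fun s hs => by
    rcases le_or_gt s 0 with h | h
    · rw [rieszKernel_of_nonpos _ h, zero_mul]
    · rw [rieszKernel_of_nonpos b (sub_nonpos.2 (not_lt.1 fun h' => hs ⟨h, h'⟩)), mul_zero]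
  rw [← setIntegral_eq_integral_of_forall_compl_eq_zero hsupp]
  rcases le_or_gt t 0 with ht | ht
  · rw [Ioo_eq_empty ht.not_gt, Measure.restrict_empty, integral_zero_measure,
      rieszKernel_of_nonpos _ ht]
  have := Real.Gamma_pos_of_pos ha
  have := Real.Gamma_pos_of_pos hb
  calc ∫ s in Ioo 0 t, rieszKernel a s * rieszKernel b (t - s)
      = ∫ s in Ioo 0 t, 1 / (Real.Gamma a * Real.Gamma b) *
          (s ^ (a - 1) * (t - s) ^ (b - 1)) := by
        refine setIntegral_congr_fun measurableSet_Ioo fun s hs => ?_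
        simp only [rieszKernel_of_pos _ hs.1, rieszKernel_of_pos _ (sub_pos.2 hs.2)]
        field_simp
    _ = rieszKernel (a + b) t := by
        rw [integral_const_mul, ← integral_Ioc_eq_integral_Ioo,
          ← intervalIntegral.integral_of_le ht.le, integral_rpow_mul_sub_rpow ha hb ht,
          rieszKernel_of_pos _ ht]
        field_simp

lemma integral_rieszKernel_sub_mul_sub (ha : 0 < a) (hb : 0 < b) {s x : ℝ}
    (hs : s ∈ Icc (0 : ℝ) 1) (hx : x ∈ Icc (0 : ℝ) 1) :
    ∫ t, rieszKernel a (x - t) * rieszKernel b (t - s) ∂unitMeasure =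
      rieszKernel (a + b) (x - s) := by
  have hsupp : ∀ t ∉ Ioo (0 : ℝ) 1, rieszKernel a (x - t) * rieszKernel b (t - s) = 0 :=
    fun t ht => by
      rcases le_or_gt t 0 with h | h
      · rw [rieszKernel_of_nonpos b (by linarith [hs.1]), mul_zero]
      · rw [rieszKernel_of_nonpos a (by linarith [hx.2, not_lt.1 fun h' => ht ⟨h, h'⟩]), zero_mul]
  rw [unitMeasure, setIntegral_eq_integral_of_forall_compl_eq_zero hsupp, add_comm,
    ← integral_rieszKernel_mul hb ha,
    ← integral_sub_right_eq_self (fun t => rieszKernel b t * rieszKernel a (x - s - t)) s]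
  simp only [sub_sub_sub_cancel_right, mul_comm]

lemma integral_rieszKernel_sub (hσ : 0 < σ) {x : ℝ} (hx : x ∈ Icc (0 : ℝ) 1) :
    ∫ t, rieszKernel σ (x - t) ∂unitMeasure = rieszKernel (σ + 1) x := by
  have h := integral_rieszKernel_sub_mul_sub hσ one_pos (left_mem_Icc.2 zero_le_one) hx
  rw [sub_zero] at h
  rw [← h]
  refine integral_congr_ae (ae_unitMeasure_of_forall fun t ht => ?_)
  simp only [sub_zero, rieszKernel_one_of_pos ht.1, mul_one]

lemma integrable_rieszKernel_sub (hσ : 0 < σ) {x : ℝ} (hx : x ≤ 1) :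
    Integrable (fun t => rieszKernel σ (x - t)) unitMeasure := by
  have h := ((integrable_indicator_iff measurableSet_Iio).2
    (integrableOn_rieszKernel hσ)).comp_sub_left x
  refine h.integrableOn.congr_fun (fun t ht => indicator_of_mem ?_ _) measurableSet_Ioo
  exact mem_Iio.2 (by linarith [ht.1])

lemma integrable_rieszKernel_sub_mul_sub (ha : 0 < a) (hb : 0 < b) {s x : ℝ}
    (hs : s ∈ Icc (0 : ℝ) 1) (hx : x ∈ Icc (0 : ℝ) 1) :
    Integrable (fun t => rieszKernel a (x - t) * rieszKernel b (t - s)) unitMeasure := by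
  rcases le_or_gt x s with h | h
  · refine (integrable_zero ℝ ℝ unitMeasure).congr (ae_of_all _ fun t => ?_)
    rcases le_total t s with h' | h'
    · simp [rieszKernel_of_nonpos b (sub_nonpos.2 h')]
    · simp [rieszKernel_of_nonpos a (sub_nonpos.2 (h.trans h'))]
  · refine not_imp_comm.1 integral_undef ?_
    rw [integral_rieszKernel_sub_mul_sub ha hb hs hx, rieszKernel_of_pos _ (sub_pos.2 h)]
    have := Real.Gamma_pos_of_pos (add_pos ha hb)
    have := sub_pos.2 h
    positivity

lemma integrable_prod_rieszKernel_mul (hσ : 0 < σ) {h : ℝ → ℝ} (hh : Integrable h unitMeasure) :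
    Integrable (fun p : ℝ × ℝ => rieszKernel σ (p.1 - p.2) * h p.2)
      (unitMeasure.prod unitMeasure) := by
  have hk := (integrable_indicator_iff measurableSet_Iio).2 (integrableOn_rieszKernel hσ)
  have hprod := hh.convolution_integrand (ContinuousLinearMap.mul ℝ ℝ) hk
  have hle : unitMeasure.prod unitMeasure ≤ (volume : Measure ℝ).prod unitMeasure :=
    Measure.prod_mono Measure.restrict_le_self le_rfl
  refine (hprod.mono_measure hle).congr ?_
  have h1 : ∀ᵐ p ∂unitMeasure.prod unitMeasure, p.1 ∈ Ioo (0 : ℝ) 1 :=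
    Measure.quasiMeasurePreserving_fst.ae (ae_unitMeasure_of_forall fun _ => id)
  have h2 : ∀ᵐ p ∂unitMeasure.prod unitMeasure, p.2 ∈ Ioo (0 : ℝ) 1 :=
    Measure.quasiMeasurePreserving_snd.ae (ae_unitMeasure_of_forall fun _ => id)
  filter_upwards [h1, h2] with p hp1 hp2
  rw [indicator_of_mem (mem_Iio.2 (by linarith [hp1.2, hp2.1])), ContinuousLinearMap.mul_apply',
    mul_comm]

end RieszKernel

section FractionalIntegrals

variable {σ x : ℝ} {w w' g h : ℝ → ℝ}

lemma leftInt_eq_setIntegral (σ : ℝ) (w : ℝ → ℝ) {b : ℝ} (hx : 0 ≤ x) (hb : x ≤ b) :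
    leftInt σ w x = ∫ s in Ioo 0 b, rieszKernel σ (x - s) * w s := by
  have hsupp : ∀ s ∈ Ioo 0 b \ Ioo 0 x, rieszKernel σ (x - s) * w s = 0 := fun s hs => by
    have : x ≤ s := not_lt.1 fun h => hs.2 ⟨hs.1.1, h⟩
    rw [rieszKernel_of_nonpos σ (sub_nonpos.2 this), zero_mul]
  rw [setIntegral_eq_of_subset_of_forall_sdiff_eq_zero measurableSet_Ioo
    (Ioo_subset_Ioo_right hb) hsupp, leftInt, intervalIntegral.integral_of_le hx,
    integral_Ioc_eq_integral_Ioo, ← integral_const_mul]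
  refine setIntegral_congr_fun measurableSet_Ioo fun s hs => ?_
  have hs' : 0 < x - s := sub_pos.2 hs.2
  simp only [rieszKernel_of_pos σ hs', ← neg_sub 1 σ, Real.rpow_neg hs'.le]
  field_simp

lemma leftInt_eq_integral (σ : ℝ) (w : ℝ → ℝ) (hx : x ∈ Icc (0 : ℝ) 1) :
    leftInt σ w x = ∫ s, rieszKernel σ (x - s) * w s ∂unitMeasure :=
  leftInt_eq_setIntegral σ w hx.1 hx.2

lemma rightInt_eq_leftInt (σ : ℝ) (w : ℝ → ℝ) (x : ℝ) :
    rightInt σ w x = leftInt σ (fun s => w (1 - s)) (1 - x) := by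
  have h := intervalIntegral.integral_comp_sub_left (a := x) (b := 1)
    (fun s => w (1 - s) / (1 - x - s) ^ (1 - σ)) 1
  simp only [sub_self, sub_sub_cancel, sub_sub_sub_cancel_left] at h
  rw [rightInt, leftInt, h]

lemma measurePreserving_one_sub :
    MeasurePreserving (fun x : ℝ => 1 - x) unitMeasure unitMeasure := by
  have h := (Measure.measurePreserving_sub_left (volume : Measure ℝ) 1).restrict_preimage
    (measurableSet_Ioo (a := (0 : ℝ)) (b := 1))
  simpa [unitMeasure] using h

lemma integral_unitMeasure_comp_one_sub (f : ℝ → ℝ) :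
    ∫ x, f (1 - x) ∂unitMeasure = ∫ x, f x ∂unitMeasure := by
  simp [integral_unitMeasure]

lemma rightInt_eq_integral (σ : ℝ) (w : ℝ → ℝ) (hx : x ∈ Icc (0 : ℝ) 1) :
    rightInt σ w x = ∫ s, rieszKernel σ (s - x) * w s ∂unitMeasure := by
  rw [rightInt_eq_leftInt, leftInt_eq_integral _ _ ⟨sub_nonneg.2 hx.2, by linarith [hx.1]⟩,
    ← integral_unitMeasure_comp_one_sub]
  simp only [sub_sub_cancel, sub_sub_sub_cancel_left]

lemma leftInt_one (w : ℝ → ℝ) (x : ℝ) : leftInt 1 w x = ∫ s in (0 : ℝ)..x, w s := by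
  simp [leftInt]

lemma leftInt_congr_ae (σ : ℝ) (h : w =ᵐ[unitMeasure] w') (hx : x ∈ Icc (0 : ℝ) 1) :
    leftInt σ w x = leftInt σ w' x := by
  rw [leftInt_eq_integral _ _ hx, leftInt_eq_integral _ _ hx]
  exact integral_congr_ae (h.mono fun s hs => by simp only [hs])

lemma integrable_leftInt (hσ : 0 < σ) (hh : Integrable h unitMeasure) :
    Integrable (leftInt σ h) unitMeasure :=
  (integrable_prod_rieszKernel_mul hσ hh).integral_prod_left.congr <|
    ae_unitMeasure_of_forall fun _ hx => (leftInt_eq_integral σ h (Ioo_subset_Icc_self hx)).symm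

lemma integrable_prod_rieszKernel_mul_mul {a b : ℝ} (ha : 0 < a) (hb : 0 < b) (hab : 1 ≤ a + b)
    (hg : Integrable g unitMeasure) (hx : x ∈ Icc (0 : ℝ) 1) :
    Integrable (fun p : ℝ × ℝ => rieszKernel a (x - p.1) * (rieszKernel b (p.1 - p.2) * g p.2))
      (unitMeasure.prod unitMeasure) := by
  have hmeas : AEStronglyMeasurable
      (fun p : ℝ × ℝ => rieszKernel a (x - p.1) * (rieszKernel b (p.1 - p.2) * g p.2))
      (unitMeasure.prod unitMeasure) :=
    (Measurable.aestronglyMeasurable (by fun_prop)).mul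
      (integrable_prod_rieszKernel_mul hb hg).aestronglyMeasurable
  rw [integrable_prod_iff' hmeas]
  refine ⟨ae_unitMeasure_of_forall fun s hs => ?_, ?_⟩
  · simp only [← mul_assoc]
    exact (integrable_rieszKernel_sub_mul_sub ha hb (Ioo_subset_Icc_self hs) hx).mul_const _
  · have hnorm : ∀ s ∈ Ioo (0 : ℝ) 1,
        rieszKernel (a + b) (x - s) * ‖g s‖ =
          ∫ t, ‖rieszKernel a (x - t) * (rieszKernel b (t - s) * g s)‖ ∂unitMeasure := by
      intro s hs
      simp only [norm_mul, Real.norm_of_nonneg (rieszKernel_nonneg ha _),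
        Real.norm_of_nonneg (rieszKernel_nonneg hb _), ← mul_assoc]
      rw [integral_mul_const,
        integral_rieszKernel_sub_mul_sub ha hb (Ioo_subset_Icc_self hs) hx]
    refine Integrable.congr ?_ (ae_unitMeasure_of_forall hnorm)
    refine hg.norm.bdd_mul (c := 1 / Real.Gamma (a + b))
      (Measurable.aestronglyMeasurable (by fun_prop)) (ae_unitMeasure_of_forall fun s hs => ?_)
    rw [Real.norm_of_nonneg (rieszKernel_nonneg (add_pos ha hb) _)]
    exact rieszKernel_le hab (by linarith [hs.1, hx.2])

lemma leftInt_leftInt {a b : ℝ} (ha : 0 < a) (hb : 0 < b) (hab : 1 ≤ a + b)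
    (hg : Integrable g unitMeasure) (hx : x ∈ Icc (0 : ℝ) 1) :
    leftInt a (leftInt b g) x = leftInt (a + b) g x :=
  calc leftInt a (leftInt b g) x
      = ∫ t, rieszKernel a (x - t) * leftInt b g t ∂unitMeasure := leftInt_eq_integral _ _ hx
    _ = ∫ t, ∫ s, rieszKernel a (x - t) * (rieszKernel b (t - s) * g s)
          ∂unitMeasure ∂unitMeasure := by
        refine integral_congr_ae (ae_unitMeasure_of_forall fun t ht => ?_)
        simp only
        rw [leftInt_eq_integral _ _ (Ioo_subset_Icc_self ht), integral_const_mul]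
    _ = ∫ s, ∫ t, rieszKernel a (x - t) * (rieszKernel b (t - s) * g s)
          ∂unitMeasure ∂unitMeasure :=
        integral_integral_swap (integrable_prod_rieszKernel_mul_mul ha hb hab hg hx)
    _ = ∫ s, rieszKernel (a + b) (x - s) * g s ∂unitMeasure := by
        refine integral_congr_ae (ae_unitMeasure_of_forall fun s hs => ?_)
        simp only [← mul_assoc]
        rw [integral_mul_const,
          integral_rieszKernel_sub_mul_sub ha hb (Ioo_subset_Icc_self hs) hx]
    _ = leftInt (a + b) g x := (leftInt_eq_integral _ _ hx).symm

lemma integral_mul_rightInt (hσ : 0 < σ) {M : ℝ} (hh : Integrable h unitMeasure)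
    (hg : AEStronglyMeasurable g unitMeasure) (hM : ∀ᵐ x ∂unitMeasure, |g x| ≤ M) :
    ∫ s, h s * rightInt σ g s ∂unitMeasure = ∫ x, leftInt σ h x * g x ∂unitMeasure :=
  calc ∫ s, h s * rightInt σ g s ∂unitMeasure
      = ∫ s, ∫ x, rieszKernel σ (x - s) * h s * g x ∂unitMeasure ∂unitMeasure := by
        refine integral_congr_ae (ae_unitMeasure_of_forall fun s hs => ?_)
        simp only
        rw [rightInt_eq_integral _ _ (Ioo_subset_Icc_self hs), ← integral_const_mul]
        simp only [mul_assoc, mul_left_comm (h s)]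
    _ = ∫ x, ∫ s, rieszKernel σ (x - s) * h s * g x ∂unitMeasure ∂unitMeasure := by
        have hInt : Integrable (fun p : ℝ × ℝ => rieszKernel σ (p.1 - p.2) * h p.2 * g p.1)
            (unitMeasure.prod unitMeasure) :=
          (integrable_prod_rieszKernel_mul hσ hh).mul_bdd (c := M) hg.comp_fst
            (Measure.quasiMeasurePreserving_fst.ae hM)
        exact (integral_integral_swap hInt).symm
    _ = ∫ x, leftInt σ h x * g x ∂unitMeasure := by
        refine integral_congr_ae (ae_unitMeasure_of_forall fun x hx => ?_)
        simp only
        rw [leftInt_eq_integral _ _ (Ioo_subset_Icc_self hx), integral_mul_const]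

lemma abs_leftInt_le (hσ : 0 < σ) {M : ℝ} (hM : ∀ s, |g s| ≤ M) (hx : x ∈ Icc (0 : ℝ) 1) :
    |leftInt σ g x| ≤ M / Real.Gamma (σ + 1) := by
  rw [leftInt_eq_integral _ _ hx]
  calc |∫ s, rieszKernel σ (x - s) * g s ∂unitMeasure|
      ≤ ∫ s, rieszKernel σ (x - s) * M ∂unitMeasure := by
        rw [← Real.norm_eq_abs]
        refine norm_integral_le_of_norm_le ((integrable_rieszKernel_sub hσ hx.2).mul_const M)
          (ae_of_all _ fun s => ?_)
        rw [norm_mul, Real.norm_of_nonneg (rieszKernel_nonneg hσ _)]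
        exact mul_le_mul_of_nonneg_left (hM s) (rieszKernel_nonneg hσ _)
    _ = rieszKernel (σ + 1) x * M := by rw [integral_mul_const, integral_rieszKernel_sub hσ hx]
    _ ≤ 1 / Real.Gamma (σ + 1) * M :=
        mul_le_mul_of_nonneg_right (rieszKernel_le (by linarith) hx.2)
          ((abs_nonneg _).trans (hM 0))
    _ = M / Real.Gamma (σ + 1) := by ring

lemma memLp_leftInt (hσ : 0 < σ) {M : ℝ} (hg : AEStronglyMeasurable g unitMeasure)
    (hM : ∀ s, |g s| ≤ M) : MemLp (leftInt σ g) 2 unitMeasure :=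
  MemLp.of_bound
    (integrable_leftInt hσ ⟨hg, .of_bounded (ae_of_all _ hM)⟩).aestronglyMeasurable _
    (ae_unitMeasure_of_forall fun _ hx => abs_leftInt_le hσ hM (Ioo_subset_Icc_self hx))

end FractionalIntegrals

/-! ### The operator `φ ↦ D I^β_θ φ` on test functions and its range -/

section OneSided

variable {β : ℝ} {φ : ℝ → ℝ}

lemma leftInt_neg (σ : ℝ) (w : ℝ → ℝ) (x : ℝ) : leftInt σ (fun s => -w s) x = -leftInt σ w x := by
  simp only [leftInt, neg_div, intervalIntegral.integral_neg, mul_neg]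

lemma rightInt_deriv (β : ℝ) (φ : ℝ → ℝ) (x : ℝ) :
    rightInt β (deriv φ) x = -leftInt β (deriv fun s => φ (1 - s)) (1 - x) := by
  simp only [rightInt_eq_leftInt, ← leftInt_neg, deriv_comp_const_sub, neg_neg]

namespace IsTestFunction

lemma leftInt_one_deriv (hφ : IsTestFunction φ) : leftInt 1 (deriv φ) = φ := by
  ext x
  rw [leftInt_one, hφ.integral_deriv_eq, hφ.eq_zero_of_notMem (x := 0) (by simp), sub_zero]

lemma leftInt_eq_integral_leftInt_deriv (hβ : 0 < β) (hφ : IsTestFunction φ) {x : ℝ}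
    (hx : x ∈ Icc (0 : ℝ) 1) : leftInt β φ x = ∫ t in (0 : ℝ)..x, leftInt β (deriv φ) t := by
  have hi := hφ.deriv.integrable_unitMeasure
  rw [← leftInt_one, leftInt_leftInt one_pos hβ (by linarith) hi hx, add_comm,
    ← leftInt_leftInt hβ one_pos (by linarith) hi hx, hφ.leftInt_one_deriv]

lemma leftInt_leftInt_deriv (hβ : 0 < β) (hβ' : β < 1) (hφ : IsTestFunction φ) {x : ℝ}
    (hx : x ∈ Icc (0 : ℝ) 1) : leftInt (1 - β) (leftInt β (deriv φ)) x = φ x := by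
  rw [leftInt_leftInt (by linarith) hβ (by linarith) hφ.deriv.integrable_unitMeasure hx,
    sub_add_cancel, hφ.leftInt_one_deriv]

lemma memLp_leftInt_deriv (hβ : 0 < β) (hφ : IsTestFunction φ) :
    MemLp (leftInt β (deriv φ)) 2 unitMeasure := by
  obtain ⟨M, hM⟩ := hφ.deriv.exists_bound
  exact memLp_leftInt hβ hφ.deriv.continuous.aestronglyMeasurable hM

lemma integral_rpow_mul_leftInt_deriv (hβ : 0 < β) (hβ' : β < 1) (hφ : IsTestFunction φ) :
    ∫ s, (1 - s) ^ (-β) * leftInt β (deriv φ) s ∂unitMeasure = 0 := by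
  have hG := Real.Gamma_pos_of_pos (show 0 < 1 - β by linarith)
  have h1 : (1 : ℝ) ∈ Icc (0 : ℝ) 1 := right_mem_Icc.2 zero_le_one
  have h := hφ.leftInt_leftInt_deriv hβ hβ' h1
  rw [hφ.eq_zero_of_notMem (by simp), leftInt_eq_integral _ _ h1] at h
  rw [← mul_zero (Real.Gamma (1 - β)), ← h, ← integral_const_mul]
  refine integral_congr_ae (ae_unitMeasure_of_forall fun s hs => ?_)
  simp only
  rw [rieszKernel_of_pos _ (sub_pos.2 hs.2), sub_sub_cancel_left]
  field_simp

lemma sq_le_leftInt_deriv (hβ : 0 < β) (hβ' : β < 1 / 2) (hφ : IsTestFunction φ) (x : ℝ) :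
    φ x ^ 2 ≤ Real.Gamma (1 - 2 * β) / Real.Gamma (1 - β) ^ 2 / Real.Gamma (2 - 2 * β) *
      ∫ s, leftInt β (deriv φ) s ^ 2 ∂unitMeasure := by
  have h0 : 0 ≤ ∫ s, leftInt β (deriv φ) s ^ 2 ∂unitMeasure := integral_nonneg fun s => sq_nonneg _
  have := Real.Gamma_pos_of_pos (show 0 < 1 - β by linarith)
  have := Real.Gamma_pos_of_pos (show 0 < 1 - 2 * β by linarith)
  have := Real.Gamma_pos_of_pos (show 0 < 2 - 2 * β by linarith)
  by_cases hx : x ∈ Ioo (0 : ℝ) 1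
  swap
  · rw [hφ.eq_zero_of_notMem hx, zero_pow two_ne_zero]
    positivity
  have hxI := Ioo_subset_Icc_self hx
  have hsq : ∀ s, rieszKernel (1 - β) (x - s) ^ 2 =
      Real.Gamma (1 - 2 * β) / Real.Gamma (1 - β) ^ 2 * rieszKernel (1 - 2 * β) (x - s) :=
    fun s => rieszKernel_one_sub_sq hβ' _
  have hk : MemLp (fun s => rieszKernel (1 - β) (x - s)) 2 unitMeasure := by
    rw [memLp_two_iff_integrable_sq (Measurable.aestronglyMeasurable (by fun_prop))]
    simp only [hsq]
    exact (integrable_rieszKernel_sub (by linarith) hx.2.le).const_mul _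
  rw [← hφ.leftInt_leftInt_deriv hβ (by linarith) hxI, leftInt_eq_integral _ _ hxI]
  refine (sq_integral_mul_le hk (hφ.memLp_leftInt_deriv hβ)).trans ?_
  refine mul_le_mul_of_nonneg_right ?_ h0
  simp only [hsq]
  rw [integral_const_mul, integral_rieszKernel_sub (by linarith) hxI,
    show 1 - 2 * β + 1 = 2 - 2 * β by ring, div_eq_mul_one_div _ (Real.Gamma (2 - 2 * β))]
  exact mul_le_mul_of_nonneg_left (rieszKernel_le (by linarith) hx.2.le) (by positivity)

end IsTestFunction

lemma ae_eq_zero_of_forall_primitive_eq_zero {q : ℝ → ℝ} (hq : Integrable q unitMeasure)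
    (h : ∀ x ∈ Icc (0 : ℝ) 1, ∫ s in (0 : ℝ)..x, q s = 0) : q =ᵐ[unitMeasure] 0 := by
  have hi : IntervalIntegrable q volume 0 1 :=
    intervalIntegrable_of_integrable_unitMeasure hq (by simp) (by simp)
  refine ae_unitMeasure_iff.2 ?_
  filter_upwards [hi.ae_hasDerivAt_integral] with x hx hx01
  have h1 := hx (by rw [uIcc_of_le zero_le_one]; exact Ioo_subset_Icc_self hx01) 0 (by simp)
  refine h1.unique ((hasDerivAt_const x (0 : ℝ)).congr_of_eventuallyEq ?_)
  filter_upwards [Ioo_mem_nhds hx01.1 hx01.2] with y hy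
  exact h y (Ioo_subset_Icc_self hy)

lemma leftInt_const (hβ : β < 1) (C : ℝ) {x : ℝ} (hx : x ∈ Icc (0 : ℝ) 1) :
    leftInt (1 - β) (fun _ => C) x = C * ∫ s in (0 : ℝ)..x, rieszKernel (1 - β) s := by
  have h0 : (0 : ℝ) ∈ Icc (0 : ℝ) 1 := left_mem_Icc.2 zero_le_one
  have h := integral_rieszKernel_sub_mul_sub one_pos (sub_pos.2 hβ) h0 hx
  simp only [sub_zero, add_comm (1 : ℝ)] at h
  rw [leftInt_eq_integral _ _ hx, integral_mul_const, integral_rieszKernel_sub (sub_pos.2 hβ) hx,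
    ← leftInt_one, leftInt_eq_integral _ _ hx, h, mul_comm]

/-- By fractional integration by parts and du Bois-Reymond, `ˡI^β h` is constant; applying
`ˡI^{1-β}` identifies the primitive of `h`. -/
lemma ae_eq_of_forall_integral_mul_rightInt_eq_zero (hβ : 0 < β) (hβ' : β < 1) {h : ℝ → ℝ}
    (hh : Integrable h unitMeasure)
    (h0 : ∀ φ, IsTestFunction φ → ∫ s, h s * rightInt β (deriv φ) s ∂unitMeasure = 0) :
    ∃ c : ℝ, h =ᵐ[unitMeasure] fun s => c * s ^ (-β) := by
  obtain ⟨C, hC⟩ := ae_eq_const_of_forall_integral_mul_deriv_eq_zero (integrable_leftInt hβ hh)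
    fun φ hφ => by
      obtain ⟨M, hM⟩ := hφ.deriv.exists_bound
      rw [← integral_mul_rightInt hβ hh hφ.deriv.continuous.aestronglyMeasurable (ae_of_all _ hM),
        h0 φ hφ]
  have hk : Integrable (rieszKernel (1 - β)) unitMeasure :=
    (integrableOn_rieszKernel (sub_pos.2 hβ')).mono_set Ioo_subset_Iio_self
  have hprim : ∀ x ∈ Icc (0 : ℝ) 1,
      ∫ s in (0 : ℝ)..x, (h s - C * rieszKernel (1 - β) s) = 0 := fun x hx => by
    rw [intervalIntegral.integral_sub (intervalIntegrable_of_integrable_unitMeasure hh (by simp) hx)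
      ((intervalIntegrable_of_integrable_unitMeasure hk (by simp) hx).const_mul _),
      intervalIntegral.integral_const_mul, ← leftInt_const hβ' C hx, ← leftInt_congr_ae _ hC hx,
      leftInt_leftInt (sub_pos.2 hβ') hβ (by linarith) hh hx, sub_add_cancel, leftInt_one, sub_self]
  refine ⟨C / Real.Gamma (1 - β), ?_⟩
  filter_upwards [ae_eq_zero_of_forall_primitive_eq_zero (hh.sub (hk.const_mul C)) hprim,
    ae_unitMeasure_of_forall fun s hs => rieszKernel_of_pos (1 - β) hs.1] with s hs hs'
  have hs0 : h s = C * rieszKernel (1 - β) s := sub_eq_zero.1 hs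
  rw [hs0, hs', sub_sub_cancel_left]
  ring

end OneSided

section TwoSided

variable {β θ : ℝ} {φ : ℝ → ℝ}

/-- The weight `(1-s)^{-β}` (for `θ = 1`) or `s^{-β}` (for `θ = 0`), which spans the orthogonal
complement of the range of `D I^β_θ` in `L²(0,1)`. -/
noncomputable def weight (β θ s : ℝ) : ℝ := (θ * (1 - s) + (1 - θ) * s) ^ (-β)

lemma weight_one (β : ℝ) : weight β 1 = fun s => (1 - s) ^ (-β) := by
  ext s
  simp [weight]

lemma weight_zero (β : ℝ) : weight β 0 = fun s => s ^ (-β) := by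
  ext s
  simp [weight]

lemma fracInt_one (β : ℝ) (w : ℝ → ℝ) : fracInt β 1 w = leftInt β w := by
  ext x
  simp [fracInt]

lemma fracInt_zero (β : ℝ) (w : ℝ → ℝ) : fracInt β 0 w = rightInt β w := by
  ext x
  simp [fracInt]

lemma one_le_weight (hβ : 0 ≤ β) (hθ : θ = 0 ∨ θ = 1) {s : ℝ} (hs : s ∈ Ioo (0 : ℝ) 1) :
    1 ≤ weight β θ s := by
  rcases hθ with rfl | rfl
  · simpa only [weight_zero] using
      Real.one_le_rpow_of_pos_of_le_one_of_nonpos hs.1 hs.2.le (neg_nonpos.2 hβ)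
  · simpa only [weight_one] using Real.one_le_rpow_of_pos_of_le_one_of_nonpos (sub_pos.2 hs.2)
      (sub_le_self 1 hs.1.le) (neg_nonpos.2 hβ)

lemma memLp_weight (hβ' : β < 1 / 2) (hθ : θ = 0 ∨ θ = 1) : MemLp (weight β θ) 2 unitMeasure := by
  have h0 : MemLp (fun s : ℝ => s ^ (-β)) 2 unitMeasure := by
    rw [memLp_two_iff_integrable_sq (Measurable.aestronglyMeasurable (by fun_prop))]
    have h : IntegrableOn (fun s : ℝ => s ^ (-β * (2 : ℕ))) (Ioo 0 1) :=
      (intervalIntegral.intervalIntegrable_rpow' (by push_cast; linarith)).1.mono_set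
        Ioo_subset_Ioc_self
    exact h.congr_fun (fun s hs => Real.rpow_mul_natCast hs.1.le _ _) measurableSet_Ioo
  rcases hθ with rfl | rfl
  · rwa [weight_zero]
  · rw [weight_one]
    exact h0.comp_measurePreserving measurePreserving_one_sub

lemma integral_sq_rightInt_deriv (β : ℝ) (φ : ℝ → ℝ) :
    ∫ x, rightInt β (deriv φ) x ^ 2 ∂unitMeasure =
      ∫ x, leftInt β (deriv fun s => φ (1 - s)) x ^ 2 ∂unitMeasure := by
  rw [← integral_unitMeasure_comp_one_sub]
  simp [rightInt_deriv]

namespace IsTestFunction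

lemma memLp_fracInt_deriv (hβ : 0 < β) (hθ : θ = 0 ∨ θ = 1) (hφ : IsTestFunction φ) :
    MemLp (fracInt β θ (deriv φ)) 2 unitMeasure := by
  rcases hθ with rfl | rfl
  · rw [fracInt_zero, funext (rightInt_deriv β φ)]
    exact ((hφ.comp_one_sub.memLp_leftInt_deriv hβ).comp_measurePreserving
      measurePreserving_one_sub).neg
  · rw [fracInt_one]
    exact hφ.memLp_leftInt_deriv hβ

lemma rightInt_eq_integral_rightInt_deriv (hβ : 0 < β) (hφ : IsTestFunction φ) {x : ℝ}
    (hx : x ∈ Icc (0 : ℝ) 1) : rightInt β φ x = -∫ t in x..1, rightInt β (deriv φ) t := by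
  have h := intervalIntegral.integral_comp_sub_left (a := x) (b := 1)
    (fun t => leftInt β (deriv fun s => φ (1 - s)) t) 1
  rw [rightInt_eq_leftInt, hφ.comp_one_sub.leftInt_eq_integral_leftInt_deriv hβ
    ⟨sub_nonneg.2 hx.2, by linarith [hx.1]⟩]
  simp only [rightInt_deriv, intervalIntegral.integral_neg, neg_neg, h, sub_self]

lemma fracInt_eq_add_integral (hβ : 0 < β) (hθ : θ = 0 ∨ θ = 1) (hφ : IsTestFunction φ) {x : ℝ}
    (hx : x ∈ Icc (0 : ℝ) 1) :
    fracInt β θ φ x = fracInt β θ φ 0 + ∫ t in (0 : ℝ)..x, fracInt β θ (deriv φ) t := by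
  have hi := (hφ.memLp_fracInt_deriv hβ hθ).integrable (by norm_num)
  have h0 : (0 : ℝ) ∈ Icc (0 : ℝ) 1 := left_mem_Icc.2 zero_le_one
  have h1 : (1 : ℝ) ∈ Icc (0 : ℝ) 1 := right_mem_Icc.2 zero_le_one
  rcases hθ with rfl | rfl
  · simp only [fracInt_zero] at hi ⊢
    have hadd := intervalIntegral.integral_add_adjacent_intervals
      (intervalIntegrable_of_integrable_unitMeasure hi h0 hx)
      (intervalIntegrable_of_integrable_unitMeasure hi hx h1)
    rw [hφ.rightInt_eq_integral_rightInt_deriv hβ hx,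
      hφ.rightInt_eq_integral_rightInt_deriv hβ h0, ← hadd]
    ring
  · simp only [fracInt_one]
    rw [hφ.leftInt_eq_integral_leftInt_deriv hβ hx, hφ.leftInt_eq_integral_leftInt_deriv hβ h0,
      intervalIntegral.integral_same, zero_add]

lemma integral_weight_mul_fracInt_deriv (hβ : 0 < β) (hβ' : β < 1) (hθ : θ = 0 ∨ θ = 1)
    (hφ : IsTestFunction φ) :
    ∫ s, weight β θ s * fracInt β θ (deriv φ) s ∂unitMeasure = 0 := by
  rcases hθ with rfl | rfl
  · rw [fracInt_zero, ← integral_unitMeasure_comp_one_sub]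
    simpa [rightInt_deriv, weight_zero, integral_neg] using
      hφ.comp_one_sub.integral_rpow_mul_leftInt_deriv hβ hβ'
  · rw [fracInt_one, weight_one]
    exact hφ.integral_rpow_mul_leftInt_deriv hβ hβ'

lemma sq_le_fracInt_deriv (hβ : 0 < β) (hβ' : β < 1 / 2) (hθ : θ = 0 ∨ θ = 1)
    (hφ : IsTestFunction φ) (x : ℝ) :
    φ x ^ 2 ≤ Real.Gamma (1 - 2 * β) / Real.Gamma (1 - β) ^ 2 / Real.Gamma (2 - 2 * β) *
      ∫ s, fracInt β θ (deriv φ) s ^ 2 ∂unitMeasure := by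
  rcases hθ with rfl | rfl
  · rw [fracInt_zero, integral_sq_rightInt_deriv]
    simpa using hφ.comp_one_sub.sq_le_leftInt_deriv hβ hβ' (1 - x)
  · rw [fracInt_one]
    exact hφ.sq_le_leftInt_deriv hβ hβ' x

end IsTestFunction

lemma ae_eq_of_forall_integral_mul_fracInt_eq_zero (hβ : 0 < β) (hβ' : β < 1)
    (hθ : θ = 0 ∨ θ = 1) {h : ℝ → ℝ} (hh : Integrable h unitMeasure)
    (h0 : ∀ φ, IsTestFunction φ → ∫ s, h s * fracInt β θ (deriv φ) s ∂unitMeasure = 0) :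
    ∃ c : ℝ, h =ᵐ[unitMeasure] fun s => c * weight β θ s := by
  rcases hθ with rfl | rfl
  · simp only [fracInt_zero] at h0
    rw [weight_zero]
    exact ae_eq_of_forall_integral_mul_rightInt_eq_zero hβ hβ' hh h0
  · have hh' : Integrable (fun s => h (1 - s)) unitMeasure :=
      (measurePreserving_one_sub.integrable_comp hh.aestronglyMeasurable).2 hh
    obtain ⟨c, hc⟩ := ae_eq_of_forall_integral_mul_rightInt_eq_zero hβ hβ' hh' fun φ hφ => by
      have := h0 _ hφ.comp_one_sub
      rw [fracInt_one, ← integral_unitMeasure_comp_one_sub] at this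
      simpa [rightInt_deriv, integral_neg] using this
    refine ⟨c, ?_⟩
    filter_upwards [measurePreserving_one_sub.quasiMeasurePreserving.ae_eq_comp hc] with s hs
    simpa [weight_one] using hs

end TwoSided

/-! ### Fourier estimate of the fractional derivative -/

section DampedKernel

open Complex ProbabilityTheory

variable {β r ε : ℝ}

lemma integral_rieszKernel_mul_exp (hβ : 0 < β) (hr : 0 < r) :
    ∫ t, rieszKernel β t * Real.exp (-(r * t)) = r ^ (-β) := by
  have := Real.Gamma_pos_of_pos hβ
  calc ∫ t, rieszKernel β t * Real.exp (-(r * t))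
      = ∫ t in Ioi 0, 1 / Real.Gamma β * (t ^ (β - 1) * Real.exp (-(r * t))) := by
        rw [← integral_indicator measurableSet_Ioi]
        congr with t
        by_cases ht : t ∈ Ioi (0 : ℝ)
        · rw [rieszKernel_of_pos _ ht, indicator_of_mem ht]
          ring
        · rw [rieszKernel_of_nonpos _ (not_lt.1 ht), indicator_of_notMem ht, zero_mul]
    _ = r ^ (-β) := by
        rw [integral_const_mul, Real.integral_rpow_mul_exp_neg_mul_Ioi hβ hr, one_div r,
          Real.inv_rpow hr.le, Real.rpow_neg hr.le]
        field_simp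

lemma integrable_rieszKernel_mul_exp (hβ : 0 < β) (hr : 0 < r) :
    Integrable fun t => rieszKernel β t * Real.exp (-(r * t)) :=
  .of_integral_ne_zero (by rw [integral_rieszKernel_mul_exp hβ hr]; positivity)

/-- The measure with density `t_+^{β-1} / Γ(β)`. -/
noncomputable def rieszMeasure (β : ℝ) : Measure ℝ :=
  volume.withDensity fun t => ENNReal.ofReal (rieszKernel β t)

lemma integral_rieszMeasure {E : Type*} [NormedAddCommGroup E] [NormedSpace ℝ E] (hβ : 0 < β)
    (f : ℝ → E) : ∫ t, f t ∂rieszMeasure β = ∫ t, rieszKernel β t • f t := by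
  rw [rieszMeasure, integral_withDensity_eq_integral_toReal_smul (by fun_prop) (by simp)]
  simp only [ENNReal.toReal_ofReal (rieszKernel_nonneg hβ _)]

lemma integrable_rieszMeasure_iff {f : ℝ → ℝ} (hβ : 0 < β) :
    Integrable f (rieszMeasure β) ↔ Integrable fun t => rieszKernel β t * f t := by
  rw [rieszMeasure, integrable_withDensity_iff_integrable_smul' (by fun_prop) (by simp)]
  simp only [ENNReal.toReal_ofReal (rieszKernel_nonneg hβ _), smul_eq_mul]

lemma complexMGF_neg_rieszMeasure (hβ : 0 < β) (z : ℂ) :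
    complexMGF (fun t => -t) (rieszMeasure β) z = ∫ t, (rieszKernel β t : ℂ) * cexp (-(z * t)) := by
  simp [complexMGF, integral_rieszMeasure hβ]

lemma analyticOnNhd_complexMGF_neg_rieszMeasure (hβ : 0 < β) :
    AnalyticOnNhd ℂ (complexMGF (fun t => -t) (rieszMeasure β)) {z | 0 < z.re} := by
  refine analyticOnNhd_complexMGF.mono fun z hz => ?_
  refine interior_maximal (fun r hr => ?_) isOpen_Ioi hz
  refine (integrable_rieszMeasure_iff hβ).2 ?_
  simpa only [mul_neg] using integrable_rieszKernel_mul_exp hβ hr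

/-- Both sides are analytic in the right half plane and agree on the positive reals. -/
lemma integral_rieszKernel_mul_cexp (hβ : 0 < β) {z : ℂ} (hz : 0 < z.re) :
    ∫ t, (rieszKernel β t : ℂ) * cexp (-(z * t)) = z ^ (-(β : ℂ)) := by
  have hpow : AnalyticOnNhd ℂ (fun w : ℂ => w ^ (-(β : ℂ))) {z | 0 < z.re} :=
    DifferentiableOn.analyticOnNhd
      (fun w hw => (differentiableWithinAt_id.cpow (differentiableWithinAt_const _) (Or.inl hw)))
      (isOpen_lt continuous_const continuous_re)
  have hreal : ∀ r : ℝ, 0 < r →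
      complexMGF (fun t => -t) (rieszMeasure β) r = (r : ℂ) ^ (-(β : ℂ)) := fun r hr => by
    have h := integral_rieszKernel_mul_exp hβ hr
    rw [complexMGF_ofReal, mgf, integral_rieszMeasure hβ, ← ofReal_neg β, ← ofReal_cpow hr.le, ← h]
    simp only [smul_eq_mul, mul_neg]
  have hfreq : ∃ᶠ w in 𝓝[≠] (1 : ℂ),
      complexMGF (fun t => -t) (rieszMeasure β) w = w ^ (-(β : ℂ)) := by
    have ht : Tendsto ((↑) : ℝ → ℂ) (𝓝[≠] 1) (𝓝[≠] 1) := by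
      rw [← ofReal_one]
      exact (continuous_ofReal.tendsto 1).inf (by simp)
    refine ht.frequently (Eventually.frequently ?_)
    filter_upwards [nhdsWithin_le_nhds (Ioi_mem_nhds (zero_lt_one' ℝ))] with r hr
    exact hreal r hr
  rw [← complexMGF_neg_rieszMeasure hβ]
  exact (analyticOnNhd_complexMGF_neg_rieszMeasure hβ).eqOn_of_preconnected_of_frequently_eq hpow
    (convex_halfSpace_re_gt 0).isPreconnected (by simp) hfreq hz

/-- The exponentially damped Riesz kernel, which unlike the Riesz kernel is integrable. -/
noncomputable def dampedKernel (β ε t : ℝ) : ℝ := rieszKernel β t * Real.exp (-(ε * t))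

lemma integrable_dampedKernel (hβ : 0 < β) (hε : 0 < ε) : Integrable (dampedKernel β ε) :=
  integrable_rieszKernel_mul_exp hβ hε

lemma dampedKernel_of_nonpos {t : ℝ} (ht : t ≤ 0) : dampedKernel β ε t = 0 := by
  rw [dampedKernel, rieszKernel_of_nonpos _ ht, zero_mul]

lemma fourier_dampedKernel (hβ : 0 < β) (hε : 0 < ε) (ξ : ℝ) :
    𝓕 (fun t => (dampedKernel β ε t : ℂ)) ξ = (ε + 2 * Real.pi * ξ * I : ℂ) ^ (-(β : ℂ)) := by
  rw [Real.fourier_eq', ← integral_rieszKernel_mul_cexp hβ (by simp [hε])]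
  congr with t
  rw [show -((ε + 2 * Real.pi * ξ * I : ℂ) * t) =
    ((-2 * Real.pi * (ξ * t) : ℝ) : ℂ) * I + (-(ε * t)) by push_cast; ring, Complex.exp_add]
  simp only [dampedKernel, RCLike.inner_apply, conj_trivial, smul_eq_mul]
  push_cast
  ring_nf

lemma norm_fourier_dampedKernel (hβ : 0 < β) (hε : 0 < ε) (ξ : ℝ) :
    ‖𝓕 (fun t => (dampedKernel β ε t : ℂ)) ξ‖ = ‖(ε + 2 * Real.pi * ξ * I : ℂ)‖ ^ (-β) := by
  rw [fourier_dampedKernel hβ hε, ← ofReal_neg, norm_cpow_real]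

/-- Since `|arg z| < π / 2`, the argument of `z ^ (-2β)` stays below `πβ < π / 2`. -/
lemma cos_mul_norm_cpow_sq_le (hβ : 0 < β) (hβ' : β < 1 / 2) {z : ℂ} (hz : 0 < z.re) :
    Real.cos (Real.pi * β) * ‖z ^ (-(β : ℂ))‖ ^ 2 ≤ ((z ^ (-(β : ℂ))) ^ 2).re := by
  have hz0 : z ≠ 0 := by
    rintro rfl
    simp at hz
  have harg : |2 * β * z.arg| ≤ Real.pi * β := by
    have := abs_arg_lt_pi_div_two_iff.2 (Or.inl hz)
    rw [abs_mul, abs_of_pos (by positivity : 0 < 2 * β)]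
    nlinarith
  have hre : (((2 : ℕ) : ℂ) * (log z * -(β : ℂ))).re = (2 : ℕ) * (log z * -(β : ℂ)).re := by
    simp
  have him : (((2 : ℕ) : ℂ) * (log z * -(β : ℂ))).im = -(2 * β * z.arg) := by
    simp [log_im]
    ring
  rw [cpow_def_of_ne_zero hz0, ← Complex.exp_nat_mul, norm_exp, ← Real.exp_nat_mul, exp_re,
    him, hre, mul_comm, Real.cos_neg, ← Real.cos_abs (2 * β * z.arg)]
  gcongr
  exact Real.cos_le_cos_of_nonneg_of_le_pi (abs_nonneg _) (by nlinarith [Real.pi_pos]) harg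

end DampedKernel

section FourierOfTestFunctions

open Complex

/-- The square of the homogeneous Sobolev seminorm of order `μ`; as in `testGraph`, the angular
frequency is `2πξ`. -/
noncomputable def seminormSq (μ : ℝ) (φ : ℝ → ℝ) : ℝ :=
  ∫ ξ, ((2 * Real.pi * |ξ|) ^ μ * ‖𝓕 (fun x => (φ x : ℂ)) ξ‖) ^ 2

lemma norm_fourier_comp_one_sub (φ : ℝ → ℝ) (ξ : ℝ) :
    ‖𝓕 (fun x => (φ (1 - x) : ℂ)) ξ‖ = ‖𝓕 (fun x => (φ x : ℂ)) (-ξ)‖ := by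
  have : 𝓕 (fun x => (φ (1 - x) : ℂ)) ξ =
      cexp (((-2 * Real.pi * ξ : ℝ) : ℂ) * I) * 𝓕 (fun x => (φ x : ℂ)) (-ξ) := by
    rw [Real.fourier_eq', Real.fourier_eq', ← integral_const_mul, ← integral_sub_left_eq_self _ _ 1]
    congr with x
    simp only [sub_sub_cancel, smul_eq_mul, RCLike.inner_apply, conj_trivial, ← mul_assoc,
      ← Complex.exp_add]
    congr 2
    push_cast
    ring
  rw [this, norm_mul, norm_exp_ofReal_mul_I, one_mul]

lemma seminormSq_comp_one_sub (μ : ℝ) (φ : ℝ → ℝ) :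
    seminormSq μ (fun x => φ (1 - x)) = seminormSq μ φ := by
  rw [seminormSq, seminormSq, ← integral_neg_eq_self]
  simp only [norm_fourier_comp_one_sub, abs_neg, neg_neg]

namespace IsTestFunction

variable {φ : ℝ → ℝ}

lemma contDiff_ofReal (hφ : IsTestFunction φ) : ContDiff ℝ ∞ (fun x => (φ x : ℂ)) :=
  ofRealCLM.contDiff.comp hφ.1

lemma hasCompactSupport_ofReal (hφ : IsTestFunction φ) : HasCompactSupport fun x => (φ x : ℂ) :=
  hφ.2.1.comp_left ofReal_zero

lemma exists_schwartzMap_coe_eq (hφ : IsTestFunction φ) :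
    ∃ f : SchwartzMap ℝ ℂ, ⇑f = fun x => (φ x : ℂ) :=
  ⟨hφ.hasCompactSupport_ofReal.toSchwartzMap hφ.contDiff_ofReal, rfl⟩

lemma continuous_fourier (hφ : IsTestFunction φ) : Continuous (𝓕 fun x => (φ x : ℂ)) := by
  obtain ⟨f, hf⟩ := hφ.exists_schwartzMap_coe_eq
  rw [← hf, ← SchwartzMap.fourier_coe]
  exact (𝓕 f).continuous

lemma integrable_fourier (hφ : IsTestFunction φ) : Integrable (𝓕 fun x => (φ x : ℂ)) := by
  obtain ⟨f, hf⟩ := hφ.exists_schwartzMap_coe_eq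
  rw [← hf, ← SchwartzMap.fourier_coe]
  exact (𝓕 f).integrable

lemma integrable_norm_fourier_sq (hφ : IsTestFunction φ) :
    Integrable fun ξ => ‖𝓕 (fun x => (φ x : ℂ)) ξ‖ ^ 2 := by
  obtain ⟨f, hf⟩ := hφ.exists_schwartzMap_coe_eq
  rw [← hf, ← SchwartzMap.fourier_coe,
    ← memLp_two_iff_integrable_sq_norm (𝓕 f).continuous.aestronglyMeasurable]
  exact (𝓕 f).memLp 2

lemma integral_norm_fourier_sq (hφ : IsTestFunction φ) :
    ∫ ξ, ‖𝓕 (fun x => (φ x : ℂ)) ξ‖ ^ 2 = ∫ x, φ x ^ 2 := by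
  obtain ⟨f, hf⟩ := hφ.exists_schwartzMap_coe_eq
  rw [← hf, ← SchwartzMap.fourier_coe, SchwartzMap.integral_norm_sq_fourier, hf]
  simp

lemma norm_fourier_deriv (hφ : IsTestFunction φ) (ξ : ℝ) :
    ‖𝓕 (fun x => ((deriv φ x : ℝ) : ℂ)) ξ‖ = 2 * Real.pi * |ξ| * ‖𝓕 (fun x => (φ x : ℂ)) ξ‖ := by
  have hd : deriv (fun x => (φ x : ℂ)) = fun x => ((deriv φ x : ℝ) : ℂ) :=
    funext fun x => (hφ.differentiable x).hasDerivAt.ofReal_comp.deriv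
  rw [← hd, Real.fourier_deriv hφ.integrable.ofReal (hφ.contDiff_ofReal.differentiable (by simp))
    (hd ▸ hφ.deriv.integrable.ofReal)]
  simp [abs_of_pos Real.pi_pos]

lemma integrable_rpow_mul_fourier_sq (hφ : IsTestFunction φ) {μ : ℝ} (hμ : 0 ≤ μ) (hμ1 : μ ≤ 1) :
    Integrable fun ξ => ((2 * Real.pi * |ξ|) ^ μ * ‖𝓕 (fun x => (φ x : ℂ)) ξ‖) ^ 2 := by
  have := hφ.continuous_fourier
  have hpow : ∀ {a : ℝ}, 0 ≤ a → a ^ μ ≤ 1 + a := fun {a} ha => by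
    rcases le_total a 1 with h | h
    · linarith [Real.rpow_le_one ha h hμ]
    · linarith [(Real.rpow_le_rpow_of_exponent_le h hμ1).trans_eq (Real.rpow_one a)]
  refine ((hφ.integrable_norm_fourier_sq.const_mul 2).add
    (hφ.deriv.integrable_norm_fourier_sq.const_mul 2)).mono'
    (Measurable.aestronglyMeasurable (by fun_prop)) (ae_of_all _ fun ξ => ?_)
  set F := ‖𝓕 (fun x => (φ x : ℂ)) ξ‖
  have ha : 0 ≤ 2 * Real.pi * |ξ| := by positivity
  rw [Real.norm_of_nonneg (sq_nonneg _), Pi.add_apply, hφ.norm_fourier_deriv]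
  calc ((2 * Real.pi * |ξ|) ^ μ * F) ^ 2 ≤ ((1 + 2 * Real.pi * |ξ|) * F) ^ 2 := by
        gcongr
        exact hpow ha
    _ ≤ 2 * F ^ 2 + 2 * (2 * Real.pi * |ξ| * F) ^ 2 := by
        nlinarith [sq_nonneg (F - 2 * Real.pi * |ξ| * F)]

lemma rpow_mul_norm_fourier_eq_deriv (hφ : IsTestFunction φ) {μ : ℝ} (hμ : μ ≠ 0) (ξ : ℝ) :
    (2 * Real.pi * |ξ|) ^ μ * ‖𝓕 (fun x => (φ x : ℂ)) ξ‖ =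
      (2 * Real.pi * |ξ|) ^ (μ - 1) * ‖𝓕 (fun x => ((deriv φ x : ℝ) : ℂ)) ξ‖ := by
  rw [hφ.norm_fourier_deriv]
  rcases eq_or_ne ξ 0 with rfl | h
  · simp [Real.zero_rpow hμ]
  · rw [← mul_assoc (_ ^ (μ - 1)), ← Real.rpow_add_one (by positivity), sub_add_cancel]

end IsTestFunction

end FourierOfTestFunctions

section Convolution

open Complex
open scoped Convolution ComplexConjugate

lemma integral_conj_fourier_mul_fourier {f g : ℝ → ℂ} (hf : Integrable f) (hg : Integrable g)
    (hgc : Continuous g) (hG : Integrable (𝓕 g)) :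
    ∫ ξ, conj (𝓕 f ξ) * 𝓕 g ξ = ∫ x, conj (f x) * g x := by
  have h := VectorFourier.integral_sesq_fourierIntegral_eq_neg_flip (innerSL ℂ (E := ℂ))
    (L := innerₗ ℝ) Real.continuous_fourierChar (by exact continuous_inner) hf hG
    (μ := volume) (ν := volume)
  have hinv : ∀ x, VectorFourier.fourierIntegral Real.fourierChar volume (-(innerₗ ℝ).flip) (𝓕 g) x
      = g x := fun x => by
    rw [← congrFun (hgc.fourierInv_fourier_eq hg hG) x]
    simp [Real.fourierInv_eq, VectorFourier.fourierIntegral]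
  simp only [innerSL_apply_apply, RCLike.inner_apply, hinv] at h
  simpa only [mul_comm] using! h

lemma fourier_ofReal_comp_neg (k : ℝ → ℝ) (ξ : ℝ) :
    𝓕 (fun t => (k (-t) : ℂ)) ξ = conj (𝓕 (fun t => (k t : ℂ)) ξ) := by
  rw [Real.fourier_eq', Real.fourier_eq', ← integral_conj, ← integral_neg_eq_self]
  congr with t
  simp [← Complex.exp_conj, map_ofNat]

lemma ofReal_convolution (k φ : ℝ → ℝ) :
    (fun x => ((k ⋆ φ) x : ℂ)) =
      (fun x => (k x : ℂ)) ⋆[ContinuousLinearMap.lsmul ℂ ℂ] fun x => (φ x : ℂ) := by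
  ext x
  simp only [convolution_lsmul, smul_eq_mul, ← ofReal_mul, integral_complex_ofReal]

lemma continuous_fourier_of_integrable {f : ℝ → ℂ} (hf : Integrable f) : Continuous (𝓕 f) :=
  VectorFourier.fourierIntegral_continuous Real.continuous_fourierChar
    (by exact continuous_inner) hf

lemma norm_fourier_le_integral_norm (f : ℝ → ℂ) (ξ : ℝ) : ‖𝓕 f ξ‖ ≤ ∫ x, ‖f x‖ :=
  VectorFourier.norm_fourierIntegral_le_integral_norm _ _ _ _ _

variable {k l φ : ℝ → ℝ} {c : ℝ}

lemma fourier_convolution (hk : Integrable k) (hφ : IsTestFunction φ) (ξ : ℝ) :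
    𝓕 (fun x => ((k ⋆ φ) x : ℂ)) ξ = 𝓕 (fun x => (k x : ℂ)) ξ * 𝓕 (fun x => (φ x : ℂ)) ξ := by
  rw [ofReal_convolution]
  exact Real.fourier_smul_convolution_eq hk.ofReal hφ.integrable.ofReal ξ

lemma integrable_fourier_convolution (hk : Integrable k) (hφ : IsTestFunction φ) :
    Integrable (𝓕 fun x => ((k ⋆ φ) x : ℂ)) := by
  rw [funext (fourier_convolution hk hφ)]
  exact hφ.integrable_fourier.bdd_mul
    (continuous_fourier_of_integrable hk.ofReal).aestronglyMeasurable
    (ae_of_all _ (norm_fourier_le_integral_norm _))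

lemma continuous_convolution (hk : Integrable k) (hφ : IsTestFunction φ) : Continuous (k ⋆ φ) := by
  obtain ⟨M, hM⟩ := hφ.exists_bound
  exact BddAbove.continuous_convolution_right_of_integrable _
    ⟨M, forall_mem_range.2 hM⟩ hk hφ.continuous

lemma memLp_convolution (hk : Integrable k) (hφ : IsTestFunction φ) :
    MemLp (k ⋆ φ) 2 volume := by
  obtain ⟨M, hM⟩ := hφ.exists_bound
  have hInt : Integrable (k ⋆ φ) := hk.integrable_convolution _ hφ.integrable
  have hbound : ∀ x, ‖(k ⋆ φ) x‖ ≤ ∫ t, ‖k t‖ * M := fun x => by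
    refine norm_integral_le_of_norm_le (hk.norm.mul_const M) (ae_of_all _ fun t => ?_)
    simp only [ContinuousLinearMap.lsmul_apply, smul_eq_mul, norm_mul]
    gcongr
    exact hM _
  rw [memLp_two_iff_integrable_sq hInt.aestronglyMeasurable]
  simp only [sq]
  exact hInt.bdd_mul hInt.aestronglyMeasurable (ae_of_all _ hbound)

lemma integral_convolution_mul_convolution (hk : Integrable k) (hl : Integrable l)
    (hφ : IsTestFunction φ) :
    ∫ x, (k ⋆ φ) x * (l ⋆ φ) x =
      ∫ ξ, (conj (𝓕 (fun t => (k t : ℂ)) ξ) * 𝓕 (fun t => (l t : ℂ)) ξ).re *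
        ‖𝓕 (fun x => (φ x : ℂ)) ξ‖ ^ 2 := by
  have hkφ : Integrable fun x => ((k ⋆ φ) x : ℂ) :=
    (hk.integrable_convolution (.lsmul ℝ ℝ) hφ.integrable).ofReal
  have hlφ : Integrable fun x => ((l ⋆ φ) x : ℂ) :=
    (hl.integrable_convolution (.lsmul ℝ ℝ) hφ.integrable).ofReal
  have hInt : Integrable fun ξ => conj (𝓕 (fun x => ((k ⋆ φ) x : ℂ)) ξ) *
      𝓕 (fun x => ((l ⋆ φ) x : ℂ)) ξ :=
    (integrable_fourier_convolution hl hφ).bdd_mul (continuous_conj.comp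
      (continuous_fourier_of_integrable hkφ)).aestronglyMeasurable
      (ae_of_all _ fun ξ => (RCLike.norm_conj _).trans_le (norm_fourier_le_integral_norm _ ξ))
  calc ∫ x, (k ⋆ φ) x * (l ⋆ φ) x
      = (∫ x, conj (((k ⋆ φ) x : ℂ)) * ((l ⋆ φ) x : ℂ)).re := by
        simp only [conj_ofReal, ← ofReal_mul, integral_complex_ofReal, ofReal_re]
    _ = (∫ ξ, conj (𝓕 (fun x => ((k ⋆ φ) x : ℂ)) ξ) * 𝓕 (fun x => ((l ⋆ φ) x : ℂ)) ξ).re := by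
        rw [integral_conj_fourier_mul_fourier hkφ hlφ
          (continuous_ofReal.comp (continuous_convolution hl hφ))
          (integrable_fourier_convolution hl hφ)]
    _ = ∫ ξ, (conj (𝓕 (fun x => ((k ⋆ φ) x : ℂ)) ξ) * 𝓕 (fun x => ((l ⋆ φ) x : ℂ)) ξ).re :=
        (reCLM.integral_comp_comm hInt).symm
    _ = _ := by
        congr with ξ
        rw [fourier_convolution hk hφ, fourier_convolution hl hφ, map_mul, mul_mul_mul_comm,
          conj_mul', ← ofReal_pow, re_mul_ofReal]

lemma integral_sq_convolution (hk : Integrable k) (hφ : IsTestFunction φ) :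
    ∫ x, (k ⋆ φ) x ^ 2 =
      ∫ ξ, (‖𝓕 (fun t => (k t : ℂ)) ξ‖ * ‖𝓕 (fun x => (φ x : ℂ)) ξ‖) ^ 2 := by
  simp only [sq ((k ⋆ φ) _), integral_convolution_mul_convolution hk hk hφ, conj_mul', ← ofReal_pow,
    ofReal_re, mul_pow]

lemma setIntegral_sq_convolution_le (hk : Integrable k) (hφ : IsTestFunction φ) :
    ∫ x, (k ⋆ φ) x ^ 2 ∂unitMeasure ≤
      ∫ ξ, (‖𝓕 (fun t => (k t : ℂ)) ξ‖ * ‖𝓕 (fun x => (φ x : ℂ)) ξ‖) ^ 2 := by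
  rw [← integral_sq_convolution hk hφ]
  exact setIntegral_le_integral (memLp_convolution hk hφ).integrable_sq
    (ae_of_all _ fun x => sq_nonneg _)

lemma convolution_eq_zero_of_nonpos (hk : ∀ t ≤ 0, k t = 0) (hφ : IsTestFunction φ) {x : ℝ}
    (hx : x ≤ 0) : (k ⋆ φ) x = 0 := by
  rw [convolution_lsmul_swap]
  refine integral_eq_zero_of_ae (ae_of_all _ fun t => ?_)
  rcases le_or_gt t 0 with ht | ht
  · simp [hφ.eq_zero_of_notMem (fun h => h.1.not_ge ht)]
  · simp [hk (x - t) (by linarith)]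

lemma convolution_comp_neg_eq_zero_of_one_le (hk : ∀ t ≤ 0, k t = 0) (hφ : IsTestFunction φ)
    {x : ℝ} (hx : 1 ≤ x) : ((fun t => k (-t)) ⋆ φ) x = 0 := by
  rw [convolution_lsmul_swap]
  refine integral_eq_zero_of_ae (ae_of_all _ fun t => ?_)
  rcases le_or_gt 1 t with ht | ht
  · simp [hφ.eq_zero_of_notMem (fun h => h.2.not_ge ht)]
  · simp [hk (t - x) (by linarith)]

/-- The convolution with a causal kernel vanishes to the left of `(0,1)`, the one with the reflected
kernel to the right of it, so that their product lives on `(0,1)`. -/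
lemma mul_integral_le_integral_convolution_mul (hk : Integrable k) (hk0 : ∀ t ≤ 0, k t = 0)
    (hφ : IsTestFunction φ)
    (hc : ∀ ξ, c * ‖𝓕 (fun t => (k t : ℂ)) ξ‖ ^ 2 ≤ (𝓕 (fun t => (k t : ℂ)) ξ ^ 2).re) :
    c * ∫ ξ, (‖𝓕 (fun t => (k t : ℂ)) ξ‖ * ‖𝓕 (fun x => (φ x : ℂ)) ξ‖) ^ 2 ≤
      ∫ x, ((fun t => k (-t)) ⋆ φ) x * (k ⋆ φ) x ∂unitMeasure := by
  have hFk := continuous_fourier_of_integrable (f := fun t => (k t : ℂ)) hk.ofReal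
  have hb := norm_fourier_le_integral_norm fun t => (k t : ℂ)
  have hsupp : ∀ x ∉ Ioo (0 : ℝ) 1, ((fun t => k (-t)) ⋆ φ) x * (k ⋆ φ) x = 0 := fun x hx => by
    rcases le_or_gt x 0 with h | h
    · rw [convolution_eq_zero_of_nonpos hk0 hφ h, mul_zero]
    · rw [convolution_comp_neg_eq_zero_of_one_le hk0 hφ (not_lt.1 fun h' => hx ⟨h, h'⟩), zero_mul]
  rw [unitMeasure, setIntegral_eq_integral_of_forall_compl_eq_zero hsupp,
    integral_convolution_mul_convolution hk.comp_neg hk hφ, ← integral_const_mul]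
  simp only [fourier_ofReal_comp_neg, conj_conj, ← sq, mul_pow, ← mul_assoc]
  refine integral_mono ?_ ?_ fun ξ => mul_le_mul_of_nonneg_right (hc ξ) (sq_nonneg _)
  · refine hφ.integrable_norm_fourier_sq.bdd_mul (c := |c| * (∫ t, ‖(k t : ℂ)‖) ^ 2)
      (by fun_prop) (ae_of_all _ fun ξ => ?_)
    rw [norm_mul, norm_pow, norm_norm, Real.norm_eq_abs]
    gcongr
    exact hb ξ
  · refine hφ.integrable_norm_fourier_sq.bdd_mul (c := (∫ t, ‖(k t : ℂ)‖) ^ 2)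
      (by fun_prop) (ae_of_all _ fun ξ => (abs_re_le_norm _).trans ?_)
    rw [norm_pow]
    gcongr
    exact hb ξ

lemma sq_mul_integral_le_setIntegral_sq_convolution (hk : Integrable k) (hk0 : ∀ t ≤ 0, k t = 0)
    (hφ : IsTestFunction φ) (hc0 : 0 ≤ c)
    (hc : ∀ ξ, c * ‖𝓕 (fun t => (k t : ℂ)) ξ‖ ^ 2 ≤ (𝓕 (fun t => (k t : ℂ)) ξ ^ 2).re) :
    c ^ 2 * ∫ ξ, (‖𝓕 (fun t => (k t : ℂ)) ξ‖ * ‖𝓕 (fun x => (φ x : ℂ)) ξ‖) ^ 2 ≤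
      ∫ x, (k ⋆ φ) x ^ 2 ∂unitMeasure := by
  have hcross := mul_integral_le_integral_convolution_mul hk hk0 hφ hc
  have hreflect := setIntegral_sq_convolution_le hk.comp_neg hφ
  simp only [fourier_ofReal_comp_neg, RCLike.norm_conj] at hreflect
  set N := ∫ ξ, (‖𝓕 (fun t => (k t : ℂ)) ξ‖ * ‖𝓕 (fun x => (φ x : ℂ)) ξ‖) ^ 2
  have hN : 0 ≤ N := integral_nonneg fun ξ => sq_nonneg _
  have hX : 0 ≤ ∫ x, (k ⋆ φ) x ^ 2 ∂unitMeasure := integral_nonneg fun x => sq_nonneg _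
  have hCS : (c * N) ^ 2 ≤ N * ∫ x, (k ⋆ φ) x ^ 2 ∂unitMeasure :=
    calc (c * N) ^ 2 ≤ (∫ x, ((fun t => k (-t)) ⋆ φ) x * (k ⋆ φ) x ∂unitMeasure) ^ 2 := by gcongr
      _ ≤ (∫ x, ((fun t => k (-t)) ⋆ φ) x ^ 2 ∂unitMeasure) *
            ∫ x, (k ⋆ φ) x ^ 2 ∂unitMeasure :=
          sq_integral_mul_le ((memLp_convolution hk.comp_neg hφ).restrict _)
            ((memLp_convolution hk hφ).restrict _)
      _ ≤ _ := by gcongr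
  rcases hN.eq_or_lt with h0 | h0
  · rwa [← h0, mul_zero]
  · exact le_of_mul_le_mul_left (by linarith) h0

end Convolution

section DampedLimit

open scoped Convolution

variable {β ε θ : ℝ} {φ : ℝ → ℝ}

lemma abs_dampedKernel_le (hβ : 0 < β) (hε : 0 ≤ ε) (t : ℝ) :
    |dampedKernel β ε t| ≤ rieszKernel β t := by
  rcases le_or_gt t 0 with ht | ht
  · simp [dampedKernel_of_nonpos ht, rieszKernel_of_nonpos β ht]
  · have hexp : Real.exp (-(ε * t)) ≤ 1 := Real.exp_le_one_iff.2 (by nlinarith)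
    rw [dampedKernel, abs_mul, Real.abs_exp, abs_of_nonneg (rieszKernel_nonneg hβ t)]
    exact mul_le_of_le_one_right (rieszKernel_nonneg hβ t) hexp

lemma dampedKernel_convolution_eq_integral (hφ : IsTestFunction φ) (x : ℝ) :
    (dampedKernel β ε ⋆ φ) x = ∫ s, dampedKernel β ε (x - s) * φ s ∂unitMeasure := by
  rw [convolution_lsmul_swap]
  exact (setIntegral_eq_integral_of_forall_compl_eq_zero fun s hs => by
    rw [hφ.eq_zero_of_notMem hs, smul_zero]).symm

lemma norm_dampedKernel_sub_mul_le (hβ : 0 < β) (hε : 0 ≤ ε) (φ : ℝ → ℝ) (x s : ℝ) :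
    ‖dampedKernel β ε (x - s) * φ s‖ ≤ rieszKernel β (x - s) * |φ s| := by
  rw [norm_mul]
  exact mul_le_mul_of_nonneg_right (abs_dampedKernel_le hβ hε _) (abs_nonneg _)

lemma integrable_rieszKernel_sub_mul_abs (hβ : 0 < β) (hφ : IsTestFunction φ) {x : ℝ}
    (hx : x ≤ 1) : Integrable (fun s => rieszKernel β (x - s) * |φ s|) unitMeasure := by
  obtain ⟨M, hM⟩ := hφ.exists_bound
  exact (integrable_rieszKernel_sub hβ hx).mul_bdd (c := M)
    hφ.continuous.abs.aestronglyMeasurable (ae_of_all _ fun s => by simpa using hM s)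

lemma abs_dampedKernel_convolution_le (hβ : 0 < β) (hε : 0 ≤ ε) (hφ : IsTestFunction φ) {M : ℝ}
    (hM : ∀ s, |φ s| ≤ M) {x : ℝ} (hx : x ∈ Icc (0 : ℝ) 1) :
    |(dampedKernel β ε ⋆ φ) x| ≤ M / Real.Gamma (β + 1) := by
  have habs := abs_leftInt_le (g := fun s => |φ s|) hβ (fun s => (abs_abs _).trans_le (hM s)) hx
  rw [leftInt_eq_integral _ _ hx] at habs
  rw [dampedKernel_convolution_eq_integral hφ, ← Real.norm_eq_abs]
  exact (norm_integral_le_of_norm_le (integrable_rieszKernel_sub_mul_abs hβ hφ hx.2)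
    (ae_of_all _ (norm_dampedKernel_sub_mul_le hβ hε φ x))).trans ((le_abs_self _).trans habs)

lemma tendsto_dampedKernel_convolution (hβ : 0 < β) (hφ : IsTestFunction φ) {x : ℝ}
    (hx : x ∈ Icc (0 : ℝ) 1) :
    Tendsto (fun ε => (dampedKernel β ε ⋆ φ) x) (𝓝[>] 0) (𝓝 (leftInt β φ x)) := by
  simp only [dampedKernel_convolution_eq_integral hφ, leftInt_eq_integral β φ hx]
  refine tendsto_integral_filter_of_dominated_convergence (fun s => rieszKernel β (x - s) * |φ s|)
    (Eventually.of_forall fun ε => ?_) ?_ (integrable_rieszKernel_sub_mul_abs hβ hφ hx.2)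
    (ae_of_all _ fun s => ?_)
  · have := hφ.continuous
    unfold dampedKernel
    exact Measurable.aestronglyMeasurable (by fun_prop)
  · filter_upwards [self_mem_nhdsWithin] with ε hε
    exact ae_of_all _ (norm_dampedKernel_sub_mul_le hβ hε.le φ x)
  · unfold dampedKernel
    exact (Continuous.tendsto' (by fun_prop) _ _ (by simp)).mono_left nhdsWithin_le_nhds

lemma tendsto_setIntegral_sq_dampedKernel_convolution (hβ : 0 < β) (hφ : IsTestFunction φ) :
    Tendsto (fun ε => ∫ x, (dampedKernel β ε ⋆ φ) x ^ 2 ∂unitMeasure) (𝓝[>] 0)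
      (𝓝 (∫ x, leftInt β φ x ^ 2 ∂unitMeasure)) := by
  obtain ⟨M, hM⟩ := hφ.exists_bound
  refine tendsto_integral_filter_of_dominated_convergence
    (fun _ => (M / Real.Gamma (β + 1)) ^ 2) ?_ ?_ (integrable_const _)
    (ae_unitMeasure_of_forall fun x hx =>
      (tendsto_dampedKernel_convolution hβ hφ (Ioo_subset_Icc_self hx)).pow 2)
  · filter_upwards [self_mem_nhdsWithin] with ε hε
    exact ((continuous_convolution (integrable_dampedKernel hβ hε) hφ).pow 2).aestronglyMeasurable
  · filter_upwards [self_mem_nhdsWithin] with ε hε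
    refine ae_unitMeasure_of_forall fun x hx => ?_
    rw [norm_pow]
    gcongr
    exact abs_dampedKernel_convolution_le hβ hε.le hφ hM (Ioo_subset_Icc_self hx)

lemma tendsto_norm_fourier_dampedKernel (hβ : 0 < β) {ξ : ℝ} (hξ : ξ ≠ 0) :
    Tendsto (fun ε => ‖𝓕 (fun t => (dampedKernel β ε t : ℂ)) ξ‖) (𝓝[>] 0)
      (𝓝 ((2 * Real.pi * |ξ|) ^ (-β))) := by
  have hnorm : Tendsto (fun ε : ℝ => ‖(ε + 2 * Real.pi * ξ * Complex.I : ℂ)‖) (𝓝[>] 0)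
      (𝓝 (2 * Real.pi * |ξ|)) :=
    (Continuous.tendsto' (by fun_prop) _ _ (by simp [abs_of_pos Real.pi_pos])).mono_left
      nhdsWithin_le_nhds
  refine (hnorm.rpow_const (Or.inl (by positivity))).congr' ?_
  filter_upwards [self_mem_nhdsWithin] with ε hε
  rw [norm_fourier_dampedKernel hβ hε]

lemma norm_fourier_dampedKernel_le (hβ : 0 < β) (hε : 0 < ε) {ξ : ℝ} (hξ : ξ ≠ 0) :
    ‖𝓕 (fun t => (dampedKernel β ε t : ℂ)) ξ‖ ≤ (2 * Real.pi * |ξ|) ^ (-β) := by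
  rw [norm_fourier_dampedKernel hβ hε]
  refine Real.rpow_le_rpow_of_nonpos (by positivity) ?_ (by linarith)
  simpa [abs_mul, abs_of_pos Real.pi_pos] using
    Complex.abs_im_le_norm (ε + 2 * Real.pi * ξ * Complex.I : ℂ)

lemma tendsto_integral_fourier_dampedKernel (hβ : 0 < β) (hβ' : β < 1) (hφ : IsTestFunction φ) :
    Tendsto (fun ε => ∫ ξ, (‖𝓕 (fun t => (dampedKernel β ε t : ℂ)) ξ‖ *
        ‖𝓕 (fun x => ((deriv φ x : ℝ) : ℂ)) ξ‖) ^ 2) (𝓝[>] 0) (𝓝 (seminormSq (1 - β) φ)) := by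
  have hInt := hφ.integrable_rpow_mul_fourier_sq (μ := 1 - β) (by linarith) (by linarith)
  have hzero : ∀ᵐ ξ : ℝ, ξ ≠ 0 := by simp [ae_iff, measure_singleton]
  have hcongr := hφ.rpow_mul_norm_fourier_eq_deriv (μ := 1 - β) (by linarith)
  simp only [seminormSq, hcongr, sub_sub_cancel_left] at hInt ⊢
  refine tendsto_integral_filter_of_dominated_convergence _ ?_ ?_ hInt ?_
  · filter_upwards [self_mem_nhdsWithin] with ε hε
    exact (((continuous_fourier_of_integrable (integrable_dampedKernel hβ hε).ofReal).norm.mul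
      hφ.deriv.continuous_fourier.norm).pow 2).aestronglyMeasurable
  · filter_upwards [self_mem_nhdsWithin] with ε hε
    filter_upwards [hzero] with ξ hξ
    rw [Real.norm_of_nonneg (sq_nonneg _)]
    gcongr
    exact norm_fourier_dampedKernel_le hβ hε hξ
  · filter_upwards [hzero] with ξ hξ
    exact ((tendsto_norm_fourier_dampedKernel hβ hξ).mul_const _).pow 2

lemma IsTestFunction.leftInt_deriv_bounds (hβ : 0 < β) (hβ' : β < 1 / 2) (hφ : IsTestFunction φ) :
    Real.cos (Real.pi * β) ^ 2 * seminormSq (1 - β) φ ≤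
        ∫ x, leftInt β (deriv φ) x ^ 2 ∂unitMeasure ∧
      ∫ x, leftInt β (deriv φ) x ^ 2 ∂unitMeasure ≤ seminormSq (1 - β) φ := by
  have hleft := tendsto_setIntegral_sq_dampedKernel_convolution hβ hφ.deriv
  have hright := tendsto_integral_fourier_dampedKernel hβ (by linarith) hφ
  have hcos : 0 ≤ Real.cos (Real.pi * β) :=
    Real.cos_nonneg_of_mem_Icc ⟨by nlinarith [Real.pi_pos], by nlinarith [Real.pi_pos]⟩
  constructor
  · refine le_of_tendsto_of_tendsto (hright.const_mul _) hleft ?_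
    filter_upwards [self_mem_nhdsWithin] with ε hε
    refine sq_mul_integral_le_setIntegral_sq_convolution (integrable_dampedKernel hβ hε)
      (fun _ => dampedKernel_of_nonpos) hφ.deriv hcos fun ξ => ?_
    rw [fourier_dampedKernel hβ hε]
    exact cos_mul_norm_cpow_sq_le hβ hβ' (by simpa using hε)
  · refine le_of_tendsto_of_tendsto hleft hright ?_
    filter_upwards [self_mem_nhdsWithin] with ε hε
    exact setIntegral_sq_convolution_le (integrable_dampedKernel hβ hε) hφ.deriv

lemma IsTestFunction.fracInt_deriv_bounds (hβ : 0 < β) (hβ' : β < 1 / 2) (hθ : θ = 0 ∨ θ = 1)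
    (hφ : IsTestFunction φ) :
    Real.cos (Real.pi * β) ^ 2 * seminormSq (1 - β) φ ≤
        ∫ x, fracInt β θ (deriv φ) x ^ 2 ∂unitMeasure ∧
      ∫ x, fracInt β θ (deriv φ) x ^ 2 ∂unitMeasure ≤ seminormSq (1 - β) φ := by
  rcases hθ with rfl | rfl
  · have h := hφ.comp_one_sub.leftInt_deriv_bounds hβ hβ'
    rwa [seminormSq_comp_one_sub, ← integral_sq_rightInt_deriv, ← fracInt_zero] at h
  · rw [fracInt_one]
    exact hφ.leftInt_deriv_bounds hβ hβ'

end DampedLimit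

/-! ### The spaces `H^μ_0(0,1)` -/

section FractionalSobolevSpaces

instance (μ : ℝ) : CompleteSpace (H0 μ) :=
  (Submodule.isClosed_topologicalClosure (Submodule.span ℝ (testGraph μ))).completeSpace_coe

namespace IsTestFunction

variable {μ : ℝ} {φ ψ : ℝ → ℝ}

lemma memLp_symbol_mul_fourier (h : IsTestFunction φ) (hμ : μ ∈ Icc (0 : ℝ) 1) :
    MemLp (fun ξ => (((2 * Real.pi * |ξ|) ^ μ : ℝ) : ℂ) * 𝓕 (fun x : ℝ => (φ x : ℂ)) ξ) 2
      volume := by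
  have hm : Measurable fun ξ => (((2 * Real.pi * |ξ|) ^ μ : ℝ) : ℂ) *
      𝓕 (fun x : ℝ => (φ x : ℂ)) ξ := by
    have := h.continuous_fourier
    fun_prop
  rw [memLp_two_iff_integrable_sq_norm hm.aestronglyMeasurable]
  refine (h.integrable_rpow_mul_fourier_sq hμ.1 hμ.2).congr (ae_of_all _ fun ξ => ?_)
  simp only
  rw [norm_mul, Complex.norm_real, Real.norm_of_nonneg (by positivity)]

lemma fourier_add (h : IsTestFunction φ) (h' : IsTestFunction ψ) (ξ : ℝ) :
    𝓕 (fun x => ((φ + ψ) x : ℂ)) ξ = 𝓕 (fun x => (φ x : ℂ)) ξ + 𝓕 (fun x => (ψ x : ℂ)) ξ := by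
  have h1 : Integrable (fun x => (φ x : ℂ)) := h.integrable.ofReal
  have h2 : Integrable (fun x => (ψ x : ℂ)) := h'.integrable.ofReal
  rw [Real.fourier_eq, Real.fourier_eq, Real.fourier_eq, ← integral_add
    ((Real.fourierIntegral_convergent_iff ξ).2 h1) ((Real.fourierIntegral_convergent_iff ξ).2 h2)]
  simp

end IsTestFunction

lemma fourier_ofReal_smul (c : ℝ) (φ : ℝ → ℝ) (ξ : ℝ) :
    𝓕 (fun x => ((c • φ) x : ℂ)) ξ = c * 𝓕 (fun x => (φ x : ℂ)) ξ := by
  simp only [Real.fourier_eq', ← integral_const_mul, Pi.smul_apply, smul_eq_mul, Complex.ofReal_mul,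
    mul_left_comm]

lemma isTestFunction_coe (φ : testSpace) : IsTestFunction (φ : ℝ → ℝ) := φ.2

variable {μ : ℝ}

/-- The pair `(φ, |ω|^μ 𝓕φ)` that represents the test function `φ` in `H^μ_0(0,1)`. -/
noncomputable def testPair (hμ : μ ∈ Icc (0 : ℝ) 1) (φ : testSpace) : L2Pair :=
  WithLp.toLp 2 (((isTestFunction_coe φ).memLp 2 volume).toLp φ,
    ((isTestFunction_coe φ).memLp_symbol_mul_fourier hμ).toLp
      fun ξ => (((2 * Real.pi * |ξ|) ^ μ : ℝ) : ℂ) * 𝓕 (fun x : ℝ => ((φ : ℝ → ℝ) x : ℂ)) ξ)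

lemma testPair_add (hμ : μ ∈ Icc (0 : ℝ) 1) (φ ψ : testSpace) :
    testPair hμ (φ + ψ) = testPair hμ φ + testPair hμ ψ := by
  simp only [testPair]
  rw [← WithLp.toLp_add, Prod.mk_add_mk, ← MemLp.toLp_add, ← MemLp.toLp_add]
  congr 2
  refine MemLp.toLp_congr _ _ (ae_of_all _ fun ξ => ?_)
  simp only [Submodule.coe_add, Pi.add_apply]
  rw [← mul_add, ← (isTestFunction_coe φ).fourier_add ψ.2]
  rfl

lemma testPair_smul (hμ : μ ∈ Icc (0 : ℝ) 1) (c : ℝ) (φ : testSpace) :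
    testPair hμ (c • φ) = c • testPair hμ φ := by
  simp only [testPair]
  rw [← WithLp.toLp_smul, Prod.smul_mk, ← MemLp.toLp_const_smul, ← MemLp.toLp_const_smul]
  congr 2
  refine MemLp.toLp_congr _ _ (ae_of_all _ fun ξ => ?_)
  simp only [Submodule.coe_smul]
  rw [fourier_ofReal_smul, Pi.smul_apply, Complex.real_smul]
  ring

lemma testPair_mem_testGraph (hμ : μ ∈ Icc (0 : ℝ) 1) (φ : testSpace) :
    testPair hμ φ ∈ testGraph μ :=
  ⟨φ, isTestFunction_coe φ, ((isTestFunction_coe φ).memLp 2 volume).coeFn_toLp,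
    ((isTestFunction_coe φ).memLp_symbol_mul_fourier hμ).coeFn_toLp⟩

lemma exists_testPair_eq (hμ : μ ∈ Icc (0 : ℝ) 1) {p : L2Pair} (hp : p ∈ testGraph μ) :
    ∃ φ, testPair hμ φ = p := by
  obtain ⟨φ, hφ, h1, h2⟩ := hp
  refine ⟨⟨φ, hφ⟩, (WithLp.equiv 2 _).injective (Prod.ext (Lp.ext ?_) (Lp.ext ?_))⟩
  · exact (hφ.memLp 2 volume).coeFn_toLp.trans h1.symm
  · exact (hφ.memLp_symbol_mul_fourier hμ).coeFn_toLp.trans h2.symm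

/-- The embedding of the test functions into their completion `H^μ_0(0,1)`. -/
noncomputable def testEmbed (hμ : μ ∈ Icc (0 : ℝ) 1) : testSpace →ₗ[ℝ] H0 μ where
  toFun φ := ⟨testPair hμ φ, Submodule.le_topologicalClosure _
    (Submodule.subset_span (testPair_mem_testGraph hμ φ))⟩
  map_add' φ ψ := Subtype.ext (testPair_add hμ φ ψ)
  map_smul' c φ := Subtype.ext (testPair_smul hμ c φ)

lemma testEmbed_fn (hμ : μ ∈ Icc (0 : ℝ) 1) (φ : testSpace) :
    (testEmbed hμ φ).fn =ᵐ[volume] φ :=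
  ((isTestFunction_coe φ).memLp 2 volume).coeFn_toLp

lemma norm_sq_testEmbed (hμ : μ ∈ Icc (0 : ℝ) 1) (φ : testSpace) :
    ‖testEmbed hμ φ‖ ^ 2 = (∫ x, (φ : ℝ → ℝ) x ^ 2) + seminormSq μ φ := by
  have hfst : ‖(testPair hμ φ).fst‖ ^ 2 = _ := norm_sq_toLp ((isTestFunction_coe φ).memLp 2 volume)
  have hsnd : ‖(testPair hμ φ).snd‖ ^ 2 = _ :=
    norm_sq_toLp ((isTestFunction_coe φ).memLp_symbol_mul_fourier hμ)
  have hsymbol (ξ : ℝ) : ‖(((2 * Real.pi * |ξ|) ^ μ : ℝ) : ℂ)‖ = (2 * Real.pi * |ξ|) ^ μ := by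
    rw [Complex.norm_real, Real.norm_of_nonneg (by positivity)]
  change ‖testPair hμ φ‖ ^ 2 = _
  rw [WithLp.prod_norm_sq_eq_of_L2, hfst, hsnd]
  simp only [seminormSq, norm_mul, hsymbol, Real.norm_eq_abs, sq_abs]

lemma denseRange_testEmbed (hμ : μ ∈ Icc (0 : ℝ) 1) : DenseRange (testEmbed hμ) := by
  have hspan : Submodule.span ℝ (testGraph μ) ≤
      (LinearMap.range (testEmbed hμ)).map (H0Submodule μ).subtype := by
    refine Submodule.span_le.2 fun p hp => ?_
    obtain ⟨φ, rfl⟩ := exists_testPair_eq hμ hp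
    exact ⟨_, ⟨φ, rfl⟩, rfl⟩
  exact fun u => closure_subtype.2 (closure_mono hspan u.2)

/-- The map `u ↦ u` from `H^μ_0(0,1)` to `L²(ℝ)`. -/
noncomputable def fnL (μ : ℝ) : H0 μ →L[ℝ] Lp ℝ 2 (volume : Measure ℝ) :=
  (WithLp.fstL 2 ℝ _ _).comp (H0Submodule μ).subtypeL

lemma coe_fnL (u : H0 μ) : (fnL μ u : ℝ → ℝ) = u.fn := rfl

lemma exists_dual_eq_integral_mul (μ : ℝ) {f : ℝ → ℝ} (hf : MemLp f 2 unitMeasure) :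
    ∃ ℓ : StrongDual ℝ (H0 μ), ∀ v : H0 μ, ℓ v = ∫ x, f x * v.fn x ∂unitMeasure := by
  have hf' : MemLp ((Ioo (0 : ℝ) 1).indicator f) 2 volume :=
    (memLp_indicator_iff_restrict measurableSet_Ioo).2 hf
  refine ⟨(innerSL ℝ (hf'.toLp _)).comp (fnL μ), fun v => ?_⟩
  rw [ContinuousLinearMap.comp_apply, innerSL_apply_apply, L2.inner_def, unitMeasure,
    ← integral_indicator measurableSet_Ioo]
  refine integral_congr_ae ?_
  filter_upwards [hf'.coeFn_toLp] with x hx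
  rw [hx, coe_fnL]
  by_cases h : x ∈ Ioo (0 : ℝ) 1 <;> simp [h, mul_comm]

end FractionalSobolevSpaces

section Extension

variable {X H E : Type*} [AddCommGroup X] [Module ℝ X] [NormedAddCommGroup H] [NormedSpace ℝ H]
  [NormedAddCommGroup E] [NormedSpace ℝ E] [CompleteSpace E] {e : X →ₗ[ℝ] H} {d : X →ₗ[ℝ] E}
  {c C : ℝ}

lemma mul_norm_le_norm_extendOfNorm (he : DenseRange e) (hC : ∀ x, ‖d x‖ ≤ C * ‖e x‖)
    (hc : ∀ x, c * ‖e x‖ ≤ ‖d x‖) (w : H) : c * ‖w‖ ≤ ‖d.extendOfNorm e w‖ := by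
  refine he.induction_on w (isClosed_le (by fun_prop) (by fun_prop)) fun x => ?_
  rw [LinearMap.extendOfNorm_eq he ⟨C, hC⟩]
  exact hc x

lemma range_extendOfNorm [CompleteSpace H] (he : DenseRange e) (hc : 0 < c)
    (hC : ∀ x, ‖d x‖ ≤ C * ‖e x‖) (hc' : ∀ x, c * ‖e x‖ ≤ ‖d x‖) :
    (d.extendOfNorm e).range = (LinearMap.range d).topologicalClosure := by
  have heq (x : X) : d.extendOfNorm e (e x) = d x := LinearMap.extendOfNorm_eq he ⟨C, hC⟩ x
  apply le_antisymm
  · rintro - ⟨w, rfl⟩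
    refine he.induction_on (p := fun w => d.extendOfNorm e w ∈ closure (LinearMap.range d : Set E))
      w (isClosed_closure.preimage (d.extendOfNorm e).continuous) fun x => ?_
    exact heq x ▸ subset_closure ⟨x, rfl⟩
  · have hanti : AntilipschitzWith (Real.toNNReal c⁻¹) (d.extendOfNorm e) := by
      refine AddMonoidHomClass.antilipschitz_of_bound _ fun w => ?_
      rw [Real.coe_toNNReal _ (inv_nonneg.2 hc.le), inv_mul_eq_div, le_div_iff₀ hc, mul_comm]
      exact mul_norm_le_norm_extendOfNorm he hC hc' w
    refine Submodule.topologicalClosure_minimal _ ?_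
      (hanti.isClosed_range (d.extendOfNorm e).uniformContinuous)
    rintro - ⟨x, rfl⟩
    exact ⟨e x, heq x⟩

end Extension

/-! ### Weak derivatives -/

section WeakDerivatives

lemma integrable_of_memLp_two {f : ℝ → ℝ} (hf : MemLp f 2 unitMeasure) :
    Integrable f unitMeasure :=
  hf.integrable one_le_two

lemma memLp_two_of_continuousOn {f : ℝ → ℝ} (hf : ContinuousOn f (Icc 0 1)) :
    MemLp f 2 unitMeasure := by
  obtain ⟨C, hC⟩ := isCompact_Icc.exists_bound_of_continuousOn hf
  exact MemLp.of_bound ((hf.mono Ioo_subset_Icc_self).aestronglyMeasurable measurableSet_Ioo) C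
    (ae_unitMeasure_of_forall fun x hx => hC x (Ioo_subset_Icc_self hx))

lemma eqOn_Icc_of_ae_eq {f g : ℝ → ℝ} (hf : ContinuousOn f (Icc 0 1))
    (hg : ContinuousOn g (Icc 0 1)) (h : f =ᵐ[unitMeasure] g) : EqOn f g (Icc 0 1) := by
  have hIoo : EqOn f g (Ioo 0 1) :=
    Measure.eqOn_open_of_ae_eq h isOpen_Ioo (hf.mono Ioo_subset_Icc_self)
      (hg.mono Ioo_subset_Icc_self)
  refine hIoo.of_subset_closure hf hg Ioo_subset_Icc_self ?_
  rw [closure_Ioo zero_ne_one]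

variable {w g g' φ : ℝ → ℝ} {k : ℕ} {c : ℝ}

lemma IsWeakDeriv.ae_eq (h : IsWeakDeriv k w g) (h' : IsWeakDeriv k w g') :
    g =ᵐ[unitMeasure] g' := by
  have hg := integrable_of_memLp_two h.1
  have hg' := integrable_of_memLp_two h'.1
  refine (ae_eq_zero_of_forall_integral_mul_eq_zero (hg.sub hg') fun φ hφ => ?_).mono
    fun x hx => sub_eq_zero.1 hx
  have heq : (-1 : ℝ) ^ k * ∫ x, g x * φ x ∂unitMeasure =
      (-1) ^ k * ∫ x, g' x * φ x ∂unitMeasure := (h.2 φ hφ).symm.trans (h'.2 φ hφ)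
  simp only [Pi.sub_apply, sub_mul]
  rw [integral_sub (hφ.integrable_mul hg) (hφ.integrable_mul hg'), sub_eq_zero]
  exact mul_left_cancel₀ (pow_ne_zero k (by norm_num)) heq

lemma IsWeakDeriv.weakDeriv (h : IsWeakDeriv k w g) : IsWeakDeriv k w (weakDeriv k w) := by
  have hex : ∃ g, IsWeakDeriv k w g := ⟨g, h⟩
  rw [FracDiff.weakDeriv, dif_pos hex]
  exact hex.choose_spec

lemma IsWeakDeriv.weakDeriv_ae_eq (h : IsWeakDeriv k w g) :
    FracDiff.weakDeriv k w =ᵐ[unitMeasure] g :=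
  h.weakDeriv.ae_eq h

lemma isWeakDeriv_zero (h : MemLp w 2 unitMeasure) : IsWeakDeriv 0 w w :=
  ⟨h, fun φ _ => by simp⟩

lemma isWeakDeriv_one_iff : IsWeakDeriv 1 w g ↔ MemLp g 2 unitMeasure ∧
    ∀ φ, IsTestFunction φ →
      ∫ x, w x * deriv φ x ∂unitMeasure = -∫ x, g x * φ x ∂unitMeasure := by
  simp [IsWeakDeriv, iteratedDeriv_one]

lemma absolutelyContinuousOnInterval_primitive (hg : Integrable g unitMeasure) :
    AbsolutelyContinuousOnInterval (fun x => ∫ s in (0 : ℝ)..x, g s) 0 1 :=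
  (intervalIntegrable_of_integrable_unitMeasure hg (by simp)
    (by simp)).absolutelyContinuousOnInterval_intervalIntegral (by simp)

lemma continuousOn_primitive (hg : Integrable g unitMeasure) :
    ContinuousOn (fun x => ∫ s in (0 : ℝ)..x, g s) (Icc 0 1) := by
  simpa only [uIcc_of_le zero_le_one] using
    (absolutelyContinuousOnInterval_primitive hg).continuousOn

lemma ae_hasDerivAt_primitive (hg : Integrable g unitMeasure) :
    ∀ᵐ x ∂unitMeasure, HasDerivAt (fun x => ∫ s in (0 : ℝ)..x, g s) (g x) x := by
  have hi : IntervalIntegrable g volume 0 1 :=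
    intervalIntegrable_of_integrable_unitMeasure hg (by simp) (by simp)
  refine ae_unitMeasure_iff.2 ?_
  filter_upwards [hi.ae_hasDerivAt_integral] with x hx hx01
  exact hx (by rw [uIcc_of_le zero_le_one]; exact Ioo_subset_Icc_self hx01) 0 (by simp)

lemma IsTestFunction.absolutelyContinuousOnInterval (hφ : IsTestFunction φ) :
    AbsolutelyContinuousOnInterval φ 0 1 := by
  have hprimitive : (fun x => ∫ s in (0 : ℝ)..x, deriv φ s) = φ := by
    ext x
    rw [hφ.integral_deriv_eq, hφ.eq_zero_of_notMem (x := 0) (by simp), sub_zero]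
  exact hprimitive ▸ absolutelyContinuousOnInterval_primitive hφ.deriv.integrable_unitMeasure

lemma integral_primitive_mul_deriv (hg : Integrable g unitMeasure) (hφ : IsTestFunction φ) :
    ∫ x, (∫ s in (0 : ℝ)..x, g s) * deriv φ x ∂unitMeasure = -∫ x, g x * φ x ∂unitMeasure := by
  have hparts := (absolutelyContinuousOnInterval_primitive hg).integral_mul_deriv_eq_deriv_mul
    hφ.absolutelyContinuousOnInterval
  rw [hφ.eq_zero_of_notMem (x := 0) (by simp), hφ.eq_zero_of_notMem (x := 1) (by simp), mul_zero,
    mul_zero, sub_zero, zero_sub, ← integral_unitMeasure, ← integral_unitMeasure] at hparts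
  rw [hparts]
  congr 1
  refine integral_congr_ae ?_
  filter_upwards [ae_hasDerivAt_primitive hg] with x hx
  rw [hx.deriv]

lemma isWeakDeriv_one_of_eq_primitive (hg : MemLp g 2 unitMeasure)
    (h : ∀ᵐ x ∂unitMeasure, w x = c + ∫ s in (0 : ℝ)..x, g s) : IsWeakDeriv 1 w g := by
  refine isWeakDeriv_one_iff.2 ⟨hg, fun φ hφ => ?_⟩
  have hg1 := integrable_of_memLp_two hg
  have hprim : Integrable (fun x => (∫ s in (0 : ℝ)..x, g s) * deriv φ x) unitMeasure :=
    hφ.deriv.integrable_mul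
      (integrable_of_memLp_two (memLp_two_of_continuousOn (continuousOn_primitive hg1)))
  calc ∫ x, w x * deriv φ x ∂unitMeasure
      = ∫ x, (c * deriv φ x + (∫ s in (0 : ℝ)..x, g s) * deriv φ x) ∂unitMeasure :=
        integral_congr_ae <| h.mono fun x hx => by simp only [hx, add_mul]
    _ = c * (φ 1 - φ 0) - ∫ x, g x * φ x ∂unitMeasure := by
        rw [integral_add (hφ.deriv.integrable_unitMeasure.const_mul c) hprim, integral_const_mul,
          integral_unitMeasure (deriv φ), hφ.integral_deriv_eq, integral_primitive_mul_deriv hg1 hφ]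
        ring
    _ = -∫ x, g x * φ x ∂unitMeasure := by
        rw [hφ.eq_zero_of_notMem (x := 0) (by simp), hφ.eq_zero_of_notMem (x := 1) (by simp)]
        ring

lemma IsWeakDeriv.exists_eq_primitive (h : IsWeakDeriv 1 w g) (hw : Integrable w unitMeasure) :
    ∃ c, ∀ᵐ x ∂unitMeasure, w x = c + ∫ s in (0 : ℝ)..x, g s := by
  have hg := integrable_of_memLp_two h.1
  have hi : Integrable (fun x => ∫ s in (0 : ℝ)..x, g s) unitMeasure :=
    integrable_of_memLp_two (memLp_two_of_continuousOn (continuousOn_primitive hg))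
  obtain ⟨c, hc⟩ := ae_eq_const_of_forall_integral_mul_deriv_eq_zero (hw.sub hi) fun φ hφ => by
    simp only [Pi.sub_apply, sub_mul]
    rw [integral_sub (hφ.deriv.integrable_mul hw) (hφ.deriv.integrable_mul hi),
      integral_primitive_mul_deriv hg hφ, (isWeakDeriv_one_iff.1 h).2 φ hφ, sub_self]
  exact ⟨c, hc.mono fun x hx => sub_eq_iff_eq_add.1 hx⟩

end WeakDerivatives

/-! ### The operators `D I^β_θ` on `H^{1-β}_0(0,1)` and `D` on `H^1_0(0,1)` -/

section TestOperators

variable {β θ σ x : ℝ} {f g φ ψ : ℝ → ℝ}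

lemma leftInt_add (hx : x ∈ Icc (0 : ℝ) 1)
    (hf : Integrable (fun s => rieszKernel σ (x - s) * f s) unitMeasure)
    (hg : Integrable (fun s => rieszKernel σ (x - s) * g s) unitMeasure) :
    leftInt σ (f + g) x = leftInt σ f x + leftInt σ g x := by
  simp only [leftInt_eq_integral _ _ hx, Pi.add_apply, mul_add, integral_add hf hg]

lemma leftInt_smul (σ c : ℝ) (f : ℝ → ℝ) (x : ℝ) : leftInt σ (c • f) x = c * leftInt σ f x := by
  simp only [leftInt, Pi.smul_apply, smul_eq_mul, mul_div_assoc,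
    intervalIntegral.integral_const_mul]
  ring

lemma fracInt_smul (β θ c : ℝ) (f : ℝ → ℝ) (x : ℝ) :
    fracInt β θ (c • f) x = c * fracInt β θ f x := by
  have hright : leftInt β (fun s => (c • f) (1 - s)) (1 - x) =
      c * leftInt β (fun s => f (1 - s)) (1 - x) := leftInt_smul β c _ _
  simp only [fracInt, rightInt_eq_leftInt, leftInt_smul, hright]
  ring

lemma IsTestFunction.leftInt_add (hσ : 0 < σ) (hφ : IsTestFunction φ) (hψ : IsTestFunction ψ)
    (hx : x ∈ Icc (0 : ℝ) 1) : leftInt σ (φ + ψ) x = leftInt σ φ x + leftInt σ ψ x :=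
  FracDiff.leftInt_add hx (hφ.integrable_mul (integrable_rieszKernel_sub hσ hx.2))
    (hψ.integrable_mul (integrable_rieszKernel_sub hσ hx.2))

lemma IsTestFunction.fracInt_add (hβ : 0 < β) (θ : ℝ) (hφ : IsTestFunction φ)
    (hψ : IsTestFunction ψ) (hx : x ∈ Icc (0 : ℝ) 1) :
    fracInt β θ (φ + ψ) x = fracInt β θ φ x + fracInt β θ ψ x := by
  have hright : leftInt β (fun s => (φ + ψ) (1 - s)) (1 - x) =
      leftInt β (fun s => φ (1 - s)) (1 - x) + leftInt β (fun s => ψ (1 - s)) (1 - x) :=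
    hφ.comp_one_sub.leftInt_add hβ hψ.comp_one_sub ⟨sub_nonneg.2 hx.2, by linarith [hx.1]⟩
  simp only [fracInt, rightInt_eq_leftInt, hφ.leftInt_add hβ hψ hx, hright]
  ring

/-- The real Hilbert space `L²(0,1)`. -/
abbrev UnitL2 : Type := Lp ℝ 2 unitMeasure

lemma deriv_testSpace_add (φ ψ : testSpace) :
    deriv ((φ + ψ : testSpace) : ℝ → ℝ) = deriv (φ : ℝ → ℝ) + deriv (ψ : ℝ → ℝ) :=
  funext fun x => deriv_add ((isTestFunction_coe φ).differentiable x)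
    ((isTestFunction_coe ψ).differentiable x)

lemma deriv_testSpace_smul (c : ℝ) (φ : testSpace) :
    deriv ((c • φ : testSpace) : ℝ → ℝ) = c • deriv (φ : ℝ → ℝ) :=
  funext fun x => deriv_const_smul c ((isTestFunction_coe φ).differentiable x)

/-- The operator `φ ↦ I^β_θ Dφ` from test functions to `L²(0,1)`; it agrees with `φ ↦ D I^β_θ φ`
because test functions vanish at the endpoints. -/
noncomputable def testFracDeriv (hβ : 0 < β) (hθ : θ = 0 ∨ θ = 1) : testSpace →ₗ[ℝ] UnitL2 where
  toFun φ := ((isTestFunction_coe φ).memLp_fracInt_deriv hβ hθ).toLp (fracInt β θ (deriv φ))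
  map_add' φ ψ := by
    rw [← MemLp.toLp_add]
    refine MemLp.toLp_congr _ _ (ae_unitMeasure_of_forall fun x hx => ?_)
    rw [deriv_testSpace_add, (isTestFunction_coe φ).deriv.fracInt_add hβ θ
      (isTestFunction_coe ψ).deriv (Ioo_subset_Icc_self hx)]
    rfl
  map_smul' c φ := by
    rw [RingHom.id_apply, ← MemLp.toLp_const_smul]
    refine MemLp.toLp_congr _ _ (ae_of_all _ fun x => ?_)
    rw [deriv_testSpace_smul, fracInt_smul]
    rfl

/-- The derivative as an operator from test functions to `L²(0,1)`. -/
noncomputable def testDeriv : testSpace →ₗ[ℝ] UnitL2 where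
  toFun φ := ((isTestFunction_coe φ).deriv.memLp 2 unitMeasure).toLp (deriv φ)
  map_add' φ ψ := by
    rw [← MemLp.toLp_add]
    exact MemLp.toLp_congr _ _ (ae_of_all _ fun x => congrFun (deriv_testSpace_add φ ψ) x)
  map_smul' c φ := by
    rw [RingHom.id_apply, ← MemLp.toLp_const_smul]
    exact MemLp.toLp_congr _ _ (ae_of_all _ fun x => congrFun (deriv_testSpace_smul c φ) x)

lemma norm_sq_testFracDeriv (hβ : 0 < β) (hθ : θ = 0 ∨ θ = 1) (φ : testSpace) :
    ‖testFracDeriv hβ hθ φ‖ ^ 2 = ∫ x, fracInt β θ (deriv φ) x ^ 2 ∂unitMeasure :=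
  (norm_sq_toLp ((isTestFunction_coe φ).memLp_fracInt_deriv hβ hθ)).trans (by simp)

lemma norm_sq_testDeriv (φ : testSpace) :
    ‖testDeriv φ‖ ^ 2 = ∫ x, deriv (φ : ℝ → ℝ) x ^ 2 ∂unitMeasure :=
  (norm_sq_toLp ((isTestFunction_coe φ).deriv.memLp 2 unitMeasure)).trans (by simp)

lemma IsTestFunction.integral_unitMeasure_sq (hφ : IsTestFunction φ) :
    ∫ x, φ x ^ 2 ∂unitMeasure = ∫ x, φ x ^ 2 :=
  setIntegral_eq_integral_of_forall_compl_eq_zero fun x hx => by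
    rw [hφ.eq_zero_of_notMem hx, sq, mul_zero]

lemma IsTestFunction.integral_sq_le {C : ℝ} (hφ : IsTestFunction φ) (h : ∀ x, φ x ^ 2 ≤ C) :
    ∫ x, φ x ^ 2 ≤ C := by
  rw [← hφ.integral_unitMeasure_sq]
  refine (integral_mono_of_nonneg (ae_of_all _ fun x => sq_nonneg _) (integrable_const C)
    (ae_of_all _ h)).trans ?_
  simp

lemma IsTestFunction.sq_le_integral_deriv_sq (hφ : IsTestFunction φ) (x : ℝ) :
    φ x ^ 2 ≤ ∫ s, deriv φ s ^ 2 ∂unitMeasure := by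
  by_cases hx : x ∈ Ioo (0 : ℝ) 1
  swap
  · rw [hφ.eq_zero_of_notMem hx, sq, mul_zero]
    exact integral_nonneg fun s => sq_nonneg _
  have habs : |φ x| ≤ ∫ s, |deriv φ s| * 1 ∂unitMeasure := by
    simp only [mul_one]
    calc |φ x| = |∫ s in (0 : ℝ)..x, deriv φ s| := by
          rw [hφ.integral_deriv_eq, hφ.eq_zero_of_notMem (x := 0) (by simp), sub_zero]
      _ ≤ ∫ s in (0 : ℝ)..x, |deriv φ s| :=
          intervalIntegral.abs_integral_le_integral_abs hx.1.le
      _ ≤ ∫ s, |deriv φ s| ∂unitMeasure := by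
          rw [intervalIntegral.integral_of_le hx.1.le, integral_Ioc_eq_integral_Ioo]
          exact setIntegral_mono_set hφ.deriv.integrable_unitMeasure.abs
            (ae_of_all _ fun s => abs_nonneg _) (Ioo_subset_Ioo_right hx.2.le).eventuallyLE
  calc φ x ^ 2 ≤ (∫ s, |deriv φ s| * 1 ∂unitMeasure) ^ 2 := by
        rw [← sq_abs]
        gcongr
    _ ≤ (∫ s, |deriv φ s| ^ 2 ∂unitMeasure) * ∫ _, (1 : ℝ) ^ 2 ∂unitMeasure :=
        sq_integral_mul_le (hφ.deriv.memLp 2 unitMeasure).abs (memLp_const 1)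
    _ = ∫ s, deriv φ s ^ 2 ∂unitMeasure := by simp

lemma seminormSq_one_eq (φ : testSpace) : seminormSq 1 φ = ‖testDeriv φ‖ ^ 2 := by
  have h := (isTestFunction_coe φ).deriv
  rw [norm_sq_testDeriv, h.integral_unitMeasure_sq, ← h.integral_norm_fourier_sq]
  simp only [seminormSq, (isTestFunction_coe φ).norm_fourier_deriv, Real.rpow_one]

lemma seminormSq_le_norm_sq_testEmbed {μ : ℝ} (hμ : μ ∈ Icc (0 : ℝ) 1) (φ : testSpace) :
    seminormSq μ φ ≤ ‖testEmbed hμ φ‖ ^ 2 := by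
  rw [norm_sq_testEmbed]
  exact le_add_of_nonneg_left (integral_nonneg fun x => sq_nonneg _)

lemma one_sub_mem_Icc (hβ : 0 < β) (hβ' : β < 1 / 2) : 1 - β ∈ Icc (0 : ℝ) 1 :=
  ⟨by linarith, by linarith⟩

lemma norm_testFracDeriv_le (hβ : 0 < β) (hβ' : β < 1 / 2) (hθ : θ = 0 ∨ θ = 1) (φ : testSpace) :
    ‖testFracDeriv hβ hθ φ‖ ≤ 1 * ‖testEmbed (one_sub_mem_Icc hβ hβ') φ‖ := by
  rw [one_mul, ← sq_le_sq₀ (norm_nonneg _) (norm_nonneg _), norm_sq_testFracDeriv]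
  exact ((isTestFunction_coe φ).fracInt_deriv_bounds hβ hβ' hθ).2.trans
    (seminormSq_le_norm_sq_testEmbed _ φ)

lemma exists_mul_norm_le_norm_testFracDeriv (hβ : 0 < β) (hβ' : β < 1 / 2) (hθ : θ = 0 ∨ θ = 1) :
    ∃ c > 0, ∀ φ : testSpace,
      c * ‖testEmbed (one_sub_mem_Icc hβ hβ') φ‖ ≤ ‖testFracDeriv hβ hθ φ‖ := by
  set C := Real.Gamma (1 - 2 * β) / Real.Gamma (1 - β) ^ 2 / Real.Gamma (2 - 2 * β)
  have hC : 0 < C := by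
    have := Real.Gamma_pos_of_pos (show 0 < 1 - β by linarith)
    have := Real.Gamma_pos_of_pos (show 0 < 1 - 2 * β by linarith)
    have := Real.Gamma_pos_of_pos (show 0 < 2 - 2 * β by linarith)
    positivity
  have hcos : 0 < Real.cos (Real.pi * β) :=
    Real.cos_pos_of_mem_Ioo ⟨by nlinarith [Real.pi_pos], by nlinarith [Real.pi_pos]⟩
  have hpos : 0 < C + (Real.cos (Real.pi * β) ^ 2)⁻¹ := by positivity
  refine ⟨(√(C + (Real.cos (Real.pi * β) ^ 2)⁻¹))⁻¹, by positivity, fun φ => ?_⟩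
  rw [← sq_le_sq₀ (by positivity) (norm_nonneg _), mul_pow, inv_pow, Real.sq_sqrt hpos.le,
    inv_mul_le_iff₀ hpos, norm_sq_testEmbed, norm_sq_testFracDeriv, add_mul]
  refine add_le_add ((isTestFunction_coe φ).integral_sq_le
    ((isTestFunction_coe φ).sq_le_fracInt_deriv hβ hβ' hθ)) ?_
  rw [le_inv_mul_iff₀ (by positivity)]
  exact ((isTestFunction_coe φ).fracInt_deriv_bounds hβ hβ' hθ).1

lemma one_mem_Icc : (1 : ℝ) ∈ Icc (0 : ℝ) 1 := right_mem_Icc.2 zero_le_one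

lemma norm_testDeriv_le (φ : testSpace) : ‖testDeriv φ‖ ≤ 1 * ‖testEmbed one_mem_Icc φ‖ := by
  rw [one_mul, ← sq_le_sq₀ (norm_nonneg _) (norm_nonneg _), ← seminormSq_one_eq]
  exact seminormSq_le_norm_sq_testEmbed _ φ

lemma half_mul_norm_le_norm_testDeriv (φ : testSpace) :
    1 / 2 * ‖testEmbed one_mem_Icc φ‖ ≤ ‖testDeriv φ‖ := by
  rw [← sq_le_sq₀ (by positivity) (norm_nonneg _), mul_pow, norm_sq_testEmbed, seminormSq_one_eq]
  have hL2 : ∫ x, (φ : ℝ → ℝ) x ^ 2 ≤ ‖testDeriv φ‖ ^ 2 := by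
    rw [norm_sq_testDeriv]
    exact (isTestFunction_coe φ).integral_sq_le (isTestFunction_coe φ).sq_le_integral_deriv_sq
  nlinarith [sq_nonneg ‖testDeriv φ‖]

end TestOperators

section Ranges

variable {β θ : ℝ}

lemma inner_toLp_left {f : ℝ → ℝ} (hf : MemLp f 2 unitMeasure) (g : UnitL2) :
    inner ℝ (hf.toLp f) g = ∫ x, f x * g x ∂unitMeasure := by
  simpa only [Lp.toLp_coeFn] using inner_toLp hf (Lp.memLp g)

lemma mem_span_singleton_toLp {f : ℝ → ℝ} (hf : MemLp f 2 unitMeasure) {g : UnitL2} :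
    g ∈ Submodule.span ℝ {hf.toLp f} ↔ ∃ c : ℝ, g =ᵐ[unitMeasure] fun x => c * f x := by
  rw [Submodule.mem_span_singleton]
  refine exists_congr fun c => ?_
  rw [← MemLp.toLp_const_smul, eq_comm, Lp.ext_iff]
  exact ⟨fun h => h.trans (MemLp.coeFn_toLp _), fun h => h.trans (MemLp.coeFn_toLp _).symm⟩

/-- The class in `L²(0,1)` of the weight that spans the complement of the range of `D I^β_θ`. -/
noncomputable def weightL2 (hβ' : β < 1 / 2) (hθ : θ = 0 ∨ θ = 1) : UnitL2 :=
  (memLp_weight hβ' hθ).toLp (weight β θ)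

/-- The constant function `1` as an element of `L²(0,1)`; it spans the complement of the range of
the derivative on `H^1_0(0,1)`. -/
noncomputable def oneL2 : UnitL2 := (memLp_const 1).toLp fun _ => 1

lemma range_testFracDeriv_orthogonal (hβ : 0 < β) (hβ' : β < 1 / 2) (hθ : θ = 0 ∨ θ = 1) :
    (LinearMap.range (testFracDeriv hβ hθ))ᗮ = Submodule.span ℝ {weightL2 hβ' hθ} := by
  apply le_antisymm
  · intro h hh
    refine (mem_span_singleton_toLp _).2 (ae_eq_of_forall_integral_mul_fracInt_eq_zero hβ
      (by linarith) hθ (integrable_of_memLp_two (Lp.memLp h)) fun φ hφ => ?_)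
    have hinner := inner_toLp_left (hφ.memLp_fracInt_deriv hβ hθ) h
    simp only [mul_comm (h _)]
    exact hinner.symm.trans (hh _ ⟨⟨φ, hφ⟩, rfl⟩)
  · rw [Submodule.span_singleton_le_iff_mem, Submodule.mem_orthogonal']
    rintro - ⟨φ, rfl⟩
    exact (inner_toLp _ ((isTestFunction_coe φ).memLp_fracInt_deriv hβ hθ)).trans
      ((isTestFunction_coe φ).integral_weight_mul_fracInt_deriv hβ (by linarith) hθ)

lemma range_testDeriv_orthogonal :
    (LinearMap.range testDeriv)ᗮ = Submodule.span ℝ {oneL2} := by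
  apply le_antisymm
  · intro h hh
    refine (mem_span_singleton_toLp _).2 ?_
    simp only [mul_one]
    refine ae_eq_const_of_forall_integral_mul_deriv_eq_zero
      (integrable_of_memLp_two (Lp.memLp h)) fun φ hφ => ?_
    have hinner := inner_toLp_left (hφ.deriv.memLp 2 unitMeasure) h
    simp only [mul_comm (h _)]
    exact hinner.symm.trans (hh _ ⟨⟨φ, hφ⟩, rfl⟩)
  · rw [Submodule.span_singleton_le_iff_mem, Submodule.mem_orthogonal']
    rintro - ⟨φ, rfl⟩
    have hφ := isTestFunction_coe φ
    refine (inner_toLp _ (hφ.deriv.memLp 2 unitMeasure)).trans ?_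
    simp only [one_mul]
    rw [integral_unitMeasure, hφ.integral_deriv_eq, hφ.eq_zero_of_notMem (x := 0) (by simp),
      hφ.eq_zero_of_notMem (x := 1) (by simp), sub_self]

/-- The bounded operator `D I^β_θ` from `H^{1-β}_0(0,1)` to `L²(0,1)`. -/
noncomputable def fracDeriv (hβ : 0 < β) (hβ' : β < 1 / 2) (hθ : θ = 0 ∨ θ = 1) :
    H0 (1 - β) →L[ℝ] UnitL2 :=
  (testFracDeriv hβ hθ).extendOfNorm (testEmbed (one_sub_mem_Icc hβ hβ'))

/-- The bounded operator `D` from `H^1_0(0,1)` to `L²(0,1)`. -/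
noncomputable def derivL2 : H0 1 →L[ℝ] UnitL2 := testDeriv.extendOfNorm (testEmbed one_mem_Icc)

lemma fracDeriv_testEmbed (hβ : 0 < β) (hβ' : β < 1 / 2) (hθ : θ = 0 ∨ θ = 1) (φ : testSpace) :
    fracDeriv hβ hβ' hθ (testEmbed (one_sub_mem_Icc hβ hβ') φ) = testFracDeriv hβ hθ φ :=
  LinearMap.extendOfNorm_eq (denseRange_testEmbed _) ⟨1, norm_testFracDeriv_le hβ hβ' hθ⟩ φ

lemma derivL2_testEmbed (φ : testSpace) : derivL2 (testEmbed one_mem_Icc φ) = testDeriv φ :=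
  LinearMap.extendOfNorm_eq (denseRange_testEmbed _) ⟨1, norm_testDeriv_le⟩ φ

lemma norm_fracDeriv_le (hβ : 0 < β) (hβ' : β < 1 / 2) (hθ : θ = 0 ∨ θ = 1) :
    ‖fracDeriv hβ hβ' hθ‖ ≤ 1 :=
  ContinuousLinearMap.opNorm_le_bound _ zero_le_one <| LinearMap.norm_extendOfNorm_apply_le
    (denseRange_testEmbed _) 1 (norm_testFracDeriv_le hβ hβ' hθ)

lemma norm_derivL2_le : ‖derivL2‖ ≤ 1 :=
  ContinuousLinearMap.opNorm_le_bound _ zero_le_one <| LinearMap.norm_extendOfNorm_apply_le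
    (denseRange_testEmbed _) 1 norm_testDeriv_le

lemma exists_mul_norm_le_norm_fracDeriv (hβ : 0 < β) (hβ' : β < 1 / 2) (hθ : θ = 0 ∨ θ = 1) :
    ∃ c > 0, ∀ w, c * ‖w‖ ≤ ‖fracDeriv hβ hβ' hθ w‖ := by
  obtain ⟨c, hc0, hc⟩ := exists_mul_norm_le_norm_testFracDeriv hβ hβ' hθ
  exact ⟨c, hc0, mul_norm_le_norm_extendOfNorm (denseRange_testEmbed _)
    (norm_testFracDeriv_le hβ hβ' hθ) hc⟩

lemma half_mul_norm_le_norm_derivL2 (v : H0 1) : 1 / 2 * ‖v‖ ≤ ‖derivL2 v‖ :=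
  mul_norm_le_norm_extendOfNorm (denseRange_testEmbed _) norm_testDeriv_le
    half_mul_norm_le_norm_testDeriv v

lemma range_fracDeriv (hβ : 0 < β) (hβ' : β < 1 / 2) (hθ : θ = 0 ∨ θ = 1) :
    (fracDeriv hβ hβ' hθ).range = (Submodule.span ℝ {weightL2 hβ' hθ})ᗮ := by
  obtain ⟨c, hc0, hc⟩ := exists_mul_norm_le_norm_testFracDeriv hβ hβ' hθ
  rw [fracDeriv, range_extendOfNorm (denseRange_testEmbed _) hc0
    (norm_testFracDeriv_le hβ hβ' hθ) hc, ← Submodule.orthogonal_orthogonal_eq_closure,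
    range_testFracDeriv_orthogonal hβ hβ' hθ]

lemma range_derivL2 : derivL2.range = (Submodule.span ℝ {oneL2})ᗮ := by
  rw [derivL2, range_extendOfNorm (denseRange_testEmbed _) one_half_pos norm_testDeriv_le
    half_mul_norm_le_norm_testDeriv, ← Submodule.orthogonal_orthogonal_eq_closure,
    range_testDeriv_orthogonal]

end Ranges

section Representation

variable {β θ σ x M : ℝ} {f : ℕ → ℝ → ℝ} {w : ℝ → ℝ}

lemma primitive_congr_ae {f g : ℝ → ℝ} (h : f =ᵐ[unitMeasure] g) (hx : x ∈ Icc (0 : ℝ) 1) :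
    ∫ s in (0 : ℝ)..x, f s = ∫ s in (0 : ℝ)..x, g s := by
  rw [← leftInt_one, ← leftInt_one, leftInt_congr_ae 1 h hx]

lemma continuous_primitive_apply (hx : x ∈ Icc (0 : ℝ) 1) :
    Continuous fun g : UnitL2 => ∫ s in (0 : ℝ)..x, g s := by
  have hs : MeasurableSet (Ioo (0 : ℝ) x) := measurableSet_Ioo
  have hinner (g : UnitL2) : ∫ s in (0 : ℝ)..x, g s =
      inner ℝ (indicatorConstLp 2 hs (measure_ne_top unitMeasure _) (1 : ℝ)) g := by
    have hr : unitMeasure.restrict (Ioo 0 x) = volume.restrict (Ioo 0 x) := by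
      rw [unitMeasure, Measure.restrict_restrict hs,
        inter_eq_self_of_subset_left (Ioo_subset_Ioo_right hx.2)]
    rw [L2.inner_indicatorConstLp_one, hr, intervalIntegral.integral_of_le hx.1,
      integral_Ioc_eq_integral_Ioo]
  simp only [hinner]
  fun_prop

lemma tendsto_leftInt (hσ : 0 < σ) (hf : ∀ n, AEStronglyMeasurable (f n) unitMeasure)
    (hM : ∀ n s, |f n s| ≤ M) (h : ∀ᵐ s ∂unitMeasure, Tendsto (fun n => f n s) atTop (𝓝 (w s)))
    (hx : x ∈ Icc (0 : ℝ) 1) :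
    Tendsto (fun n => leftInt σ (f n) x) atTop (𝓝 (leftInt σ w x)) := by
  have hk := integrable_rieszKernel_sub hσ hx.2
  simp only [leftInt_eq_integral _ _ hx]
  refine tendsto_integral_of_dominated_convergence (fun s => rieszKernel σ (x - s) * M)
    (fun n => hk.aestronglyMeasurable.mul (hf n)) (hk.mul_const M)
    (fun n => ae_of_all _ fun s => ?_) (h.mono fun s hs => hs.const_mul _)
  rw [norm_mul, Real.norm_of_nonneg (rieszKernel_nonneg hσ _)]
  exact mul_le_mul_of_nonneg_left (hM n s) (rieszKernel_nonneg hσ _)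

lemma tendsto_fracInt (hβ : 0 < β) (hf : ∀ n, Continuous (f n)) (hM : ∀ n s, |f n s| ≤ M)
    (h : ∀ᵐ s ∂unitMeasure, Tendsto (fun n => f n s) atTop (𝓝 (w s))) (hx : x ∈ Icc (0 : ℝ) 1) :
    Tendsto (fun n => fracInt β θ (f n) x) atTop (𝓝 (fracInt β θ w x)) := by
  refine ((tendsto_leftInt hβ (fun n => (hf n).aestronglyMeasurable) hM h hx).const_mul _).add
    (Tendsto.const_mul _ ?_)
  simp only [rightInt_eq_leftInt]
  exact tendsto_leftInt hβ (fun n => ((hf n).comp (by fun_prop)).aestronglyMeasurable)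
    (fun n s => hM n _) (measurePreserving_one_sub.quasiMeasurePreserving.ae h)
    ⟨by linarith [hx.2], by linarith [hx.1]⟩

lemma exists_tendsto_testEmbed {μ : ℝ} (hμ : μ ∈ Icc (0 : ℝ) 1) (w : H0 μ) :
    ∃ φ : ℕ → testSpace, Tendsto (fun n => testEmbed hμ (φ n)) atTop (𝓝 w) ∧
      ∀ᵐ s ∂unitMeasure, Tendsto (fun n => (φ n : ℝ → ℝ) s) atTop (𝓝 (w.fn s)) := by
  obtain ⟨u, hu, huw⟩ := mem_closure_iff_seq_limit.1 (denseRange_testEmbed hμ w)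
  choose φ hφ using hu
  obtain rfl : (fun n => testEmbed hμ (φ n)) = u := funext hφ
  have hfn : Tendsto (fun n => fnL μ (testEmbed hμ (φ n))) atTop (𝓝 (fnL μ w)) :=
    ((fnL μ).continuous.tendsto w).comp huw
  obtain ⟨ns, hns, hae⟩ := (tendstoInMeasure_of_tendsto_Lp hfn).exists_seq_tendsto_ae
  refine ⟨φ ∘ ns, huw.comp hns.tendsto_atTop, ae_restrict_of_ae ?_⟩
  filter_upwards [hae, ae_all_iff.2 fun n => testEmbed_fn hμ (φ n)] with s hs hφs
  simpa only [Function.comp_apply, coe_fnL, hφs] using hs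

lemma fracInt_fn_eq (hβ : 0 < β) (hβ' : β < 1 / 2) (hθ : θ = 0 ∨ θ = 1) (w : H0 (1 - β))
    (hx : x ∈ Icc (0 : ℝ) 1) :
    fracInt β θ w.fn x = fracInt β θ w.fn 0 + ∫ s in (0 : ℝ)..x, fracDeriv hβ hβ' hθ w s := by
  obtain ⟨φ, hφw, hae⟩ := exists_tendsto_testEmbed (one_sub_mem_Icc hβ hβ') w
  have hT : Tendsto (fun n => testFracDeriv hβ hθ (φ n)) atTop (𝓝 (fracDeriv hβ hβ' hθ w)) := by
    simpa only [Function.comp_def, fracDeriv_testEmbed] using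
      ((fracDeriv hβ hβ' hθ).continuous.tendsto w).comp hφw
  obtain ⟨B, hB⟩ := hT.norm.bddAbove_range
  set C := Real.Gamma (1 - 2 * β) / Real.Gamma (1 - β) ^ 2 / Real.Gamma (2 - 2 * β)
  have hC : 0 ≤ C := by
    have := Real.Gamma_nonneg_of_nonneg (show 0 ≤ 1 - 2 * β by linarith)
    have := Real.Gamma_nonneg_of_nonneg (show 0 ≤ 2 - 2 * β by linarith)
    positivity
  have hbound (n : ℕ) (s : ℝ) : |(φ n : ℝ → ℝ) s| ≤ √(C * B ^ 2) := by
    refine Real.abs_le_sqrt (((isTestFunction_coe _).sq_le_fracInt_deriv hβ hβ' hθ s).trans ?_)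
    rw [← norm_sq_testFracDeriv hβ hθ]
    have : ‖testFracDeriv hβ hθ (φ n)‖ ≤ B := hB ⟨n, rfl⟩
    gcongr
  have hlim {y : ℝ} (hy : y ∈ Icc (0 : ℝ) 1) :
      Tendsto (fun n => fracInt β θ (φ n) y) atTop (𝓝 (fracInt β θ w.fn y)) :=
    tendsto_fracInt hβ (fun n => (isTestFunction_coe _).continuous) hbound hae hy
  have hprim := ((continuous_primitive_apply hx).tendsto _).comp hT
  refine tendsto_nhds_unique (hlim hx)
    (((hlim (left_mem_Icc.2 zero_le_one)).add hprim).congr fun n => ?_)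
  rw [(isTestFunction_coe (φ n)).fracInt_eq_add_integral hβ hθ hx]
  congr 1
  exact primitive_congr_ae ((isTestFunction_coe (φ n)).memLp_fracInt_deriv hβ hθ).coeFn_toLp hx

lemma fn_ae_eq_primitive (v : H0 1) :
    ∀ᵐ x ∂unitMeasure, v.fn x = ∫ s in (0 : ℝ)..x, derivL2 v s := by
  obtain ⟨φ, hφv, hae⟩ := exists_tendsto_testEmbed one_mem_Icc v
  have hS : Tendsto (fun n => testDeriv (φ n)) atTop (𝓝 (derivL2 v)) := by
    simpa only [Function.comp_def, derivL2_testEmbed] using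
      (derivL2.continuous.tendsto v).comp hφv
  rw [ae_unitMeasure_iff] at hae ⊢
  filter_upwards [hae] with x hx hx01
  have hxI := Ioo_subset_Icc_self hx01
  refine tendsto_nhds_unique (hx hx01)
    ((((continuous_primitive_apply hxI).tendsto _).comp hS).congr fun n => ?_)
  have hφ := isTestFunction_coe (φ n)
  have hcoe : testDeriv (φ n) =ᵐ[unitMeasure] deriv (φ n) :=
    (hφ.deriv.memLp 2 unitMeasure).coeFn_toLp
  rw [Function.comp_apply, primitive_congr_ae hcoe hxI, hφ.integral_deriv_eq,
    hφ.eq_zero_of_notMem (x := 0) (by simp), sub_zero]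

lemma isWeakDeriv_derivL2 (v : H0 1) : IsWeakDeriv 1 v.fn (derivL2 v) :=
  isWeakDeriv_one_of_eq_primitive (c := 0) (Lp.memLp _)
    ((fn_ae_eq_primitive v).mono fun x hx => by rw [hx, zero_add])

lemma isWeakDeriv_fracInt (hβ : 0 < β) (hβ' : β < 1 / 2) (hθ : θ = 0 ∨ θ = 1) (w : H0 (1 - β)) :
    IsWeakDeriv 1 (fracInt β θ w.fn) (fracDeriv hβ hβ' hθ w) :=
  isWeakDeriv_one_of_eq_primitive (Lp.memLp _)
    (ae_unitMeasure_of_forall fun _ hx => fracInt_fn_eq hβ hβ' hθ w (Ioo_subset_Icc_self hx))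

lemma continuousOn_fracInt (hβ : 0 < β) (hβ' : β < 1 / 2) (hθ : θ = 0 ∨ θ = 1) (w : H0 (1 - β)) :
    ContinuousOn (fracInt β θ w.fn) (Icc 0 1) :=
  ((continuousOn_primitive (integrable_of_memLp_two (Lp.memLp _))).const_add _).congr
    fun _ hx => fracInt_fn_eq hβ hβ' hθ w hx

lemma memH_one {w g : ℝ → ℝ} (h : ContinuousOn w (Icc 0 1)) (hg : IsWeakDeriv 1 w g) :
    MemH 1 w := by
  have hw := memLp_two_of_continuousOn h
  refine ⟨hw, fun k hk => ?_⟩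
  interval_cases k
  exacts [⟨w, isWeakDeriv_zero hw⟩, ⟨g, hg⟩]

lemma memH_one_fracInt (hβ : 0 < β) (hβ' : β < 1 / 2) (hθ : θ = 0 ∨ θ = 1) (w : H0 (1 - β)) :
    MemH 1 (fracInt β θ w.fn) :=
  memH_one (continuousOn_fracInt hβ hβ' hθ w) (isWeakDeriv_fracInt hβ hβ' hθ w)

end Representation

/-! ### The Petrov–Galerkin form -/

section PetrovGalerkin

variable {W V E : Type*} [NormedAddCommGroup W] [NormedSpace ℝ W] [NormedAddCommGroup V]
  [InnerProductSpace ℝ V] [NormedAddCommGroup E] [InnerProductSpace ℝ E] {T : W →L[ℝ] E}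
  {S : V →L[ℝ] E} {J : E ≃L[ℝ] E} {p q g : E} {c c' j η a : ℝ}

/-- The Petrov–Galerkin form `(w, v) ↦ ⟪J (T w), S v⟫`; here `T = D I^β_θ`, `S = D` and `J` is
multiplication by the diffusivity. -/
noncomputable def petrovGalerkin (J : E ≃L[ℝ] E) (T : W →L[ℝ] E) (S : V →L[ℝ] E) :
    W →L[ℝ] V →L[ℝ] ℝ :=
  (innerSL ℝ).bilinearComp ((J : E →L[ℝ] E) ∘L T) S

lemma petrovGalerkin_apply (w : W) (v : V) :
    petrovGalerkin J T S w v = inner ℝ (J (T w)) (S v) := rfl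

lemma norm_petrovGalerkin_le (hT : ‖T‖ ≤ 1) (hS : ‖S‖ ≤ 1) (hj : 0 ≤ j)
    (hJ : ∀ x, ‖J x‖ ≤ j * ‖x‖) : ‖petrovGalerkin J T S‖ ≤ j := by
  refine ContinuousLinearMap.opNorm_le_bound₂ _ hj fun w v => ?_
  calc ‖inner ℝ (J (T w)) (S v)‖ ≤ ‖J (T w)‖ * ‖S v‖ := norm_inner_le_norm _ _
    _ ≤ (j * ‖w‖) * ‖v‖ := by
      gcongr
      · refine (hJ _).trans ?_
        gcongr
        simpa using T.le_of_opNorm_le hT w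
      · simpa using S.le_of_opNorm_le hS v

lemma norm_map_add_smul_le {L : E →L[ℝ] E} (hL : ∀ x, ‖L x‖ ≤ j * ‖x‖) (hj : 0 ≤ j) (hη : 0 < η)
    (hpq : η ≤ inner ℝ p (L q)) (h : inner ℝ p (L (g + a • q)) = 0) :
    ‖L (g + a • q)‖ ≤ j * (1 + ‖p‖ * j / η * ‖q‖) * ‖g‖ := by
  have ha : |a| * η ≤ ‖p‖ * (j * ‖g‖) := by
    rw [map_add, map_smul, inner_add_right, inner_smul_right, add_eq_zero_iff_eq_neg'] at h
    calc |a| * η ≤ |a| * |inner ℝ p (L q)| := by gcongr; exact hpq.trans (le_abs_self _)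
      _ = |inner ℝ p (L g)| := by rw [← abs_mul, h, abs_neg]
      _ ≤ ‖p‖ * ‖L g‖ := abs_real_inner_le_norm _ _
      _ ≤ ‖p‖ * (j * ‖g‖) := by gcongr; exact hL g
  calc ‖L (g + a • q)‖ ≤ j * ‖g + a • q‖ := hL _
    _ ≤ j * (‖g‖ + |a| * ‖q‖) := by
      gcongr
      exact (norm_add_le _ _).trans_eq (by rw [norm_smul, Real.norm_eq_abs])
    _ ≤ j * (‖g‖ + ‖p‖ * (j * ‖g‖) / η * ‖q‖) := by
      gcongr
      rwa [le_div_iff₀ hη]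
    _ = j * (1 + ‖p‖ * j / η * ‖q‖) * ‖g‖ := by ring

/-- `S v` is the component of `J (T w)` orthogonal to `q`. -/
lemma exists_petrovGalerkin_eq_norm_sq (hT : T.range = (Submodule.span ℝ {p})ᗮ)
    (hS : S.range = (Submodule.span ℝ {q})ᗮ) (hj : 0 ≤ j) (hJ : ∀ x, ‖J.symm x‖ ≤ j * ‖x‖)
    (hη : 0 < η) (hpq : η ≤ inner ℝ p (J.symm q)) (w : W) :
    ∃ v, petrovGalerkin J T S w v = ‖S v‖ ^ 2 ∧
      ‖T w‖ ≤ j * (1 + ‖p‖ * j / η * ‖q‖) * ‖S v‖ := by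
  obtain ⟨y, hy, g, hg, hsum⟩ := (Submodule.span ℝ {q}).exists_add_mem_mem_orthogonal (J (T w))
  obtain ⟨a, rfl⟩ := Submodule.mem_span_singleton.1 hy
  have hqg : inner ℝ q g = 0 := Submodule.mem_orthogonal_singleton_iff_inner_right.1 hg
  have hTw : J.symm (g + a • q) = T w := by rw [add_comm, ← hsum, J.symm_apply_apply]
  have hpT : inner ℝ p (J.symm (g + a • q)) = 0 := by
    rw [hTw]
    exact Submodule.mem_orthogonal_singleton_iff_inner_right.1 (hT ▸ LinearMap.mem_range_self _ w)
  rw [← hS] at hg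
  obtain ⟨v, rfl : S v = g⟩ := hg
  refine ⟨v, ?_, hTw ▸ norm_map_add_smul_le (L := (J.symm : E →L[ℝ] E)) hJ hj hη hpq hpT⟩
  rw [petrovGalerkin_apply, hsum, inner_add_left, inner_smul_left, hqg, mul_zero, zero_add,
    real_inner_self_eq_norm_sq]

lemma mul_norm_le_norm_petrovGalerkin (hT : T.range = (Submodule.span ℝ {p})ᗮ)
    (hS : S.range = (Submodule.span ℝ {q})ᗮ) (hcT : ∀ w, c * ‖w‖ ≤ ‖T w‖) (hc' : 0 < c')
    (hcS : ∀ v, c' * ‖v‖ ≤ ‖S v‖) (hj : 0 < j) (hJ : ∀ x, ‖J.symm x‖ ≤ j * ‖x‖)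
    (hη : 0 < η) (hpq : η ≤ inner ℝ p (J.symm q)) (w : W) :
    c' * (c / (j * (1 + ‖p‖ * j / η * ‖q‖))) * ‖w‖ ≤ ‖petrovGalerkin J T S w‖ := by
  obtain ⟨v, hBv, hTS⟩ := exists_petrovGalerkin_eq_norm_sq hT hS hj.le hJ hη hpq w
  have hwS : c / (j * (1 + ‖p‖ * j / η * ‖q‖)) * ‖w‖ ≤ ‖S v‖ := by
    rw [div_mul_eq_mul_div, div_le_iff₀ (by positivity), mul_comm ‖S v‖]
    exact (hcT w).trans hTS
  have hSB : c' * ‖S v‖ ≤ ‖petrovGalerkin J T S w‖ := by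
    rcases (norm_nonneg (S v)).eq_or_lt' with h0 | h0
    · simp [h0]
    refine le_of_mul_le_mul_right ?_ h0
    calc c' * ‖S v‖ * ‖S v‖ = c' * petrovGalerkin J T S w v := by rw [hBv, sq, mul_assoc]
      _ ≤ c' * (‖petrovGalerkin J T S w‖ * ‖v‖) := by
        gcongr
        exact (le_abs_self _).trans ((petrovGalerkin J T S w).le_opNorm v)
      _ = ‖petrovGalerkin J T S w‖ * (c' * ‖v‖) := by ring
      _ ≤ ‖petrovGalerkin J T S w‖ * ‖S v‖ := by gcongr; exact hcS v
  calc _ = c' * (c / (j * (1 + ‖p‖ * j / η * ‖q‖)) * ‖w‖) := by ring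
    _ ≤ c' * ‖S v‖ := by gcongr
    _ ≤ _ := hSB

lemma exists_inner_map_eq_dual [CompleteSpace V] (hc' : 0 < c') (hcS : ∀ v, c' * ‖v‖ ≤ ‖S v‖)
    (f : StrongDual ℝ V) : ∃ u, ∀ v, inner ℝ (S u) (S v) = f v := by
  let B : V →L[ℝ] V →L[ℝ] ℝ := (innerSL ℝ).bilinearComp S S
  have hB : IsCoercive B := by
    refine ⟨c' * c', by positivity, fun v => ?_⟩
    calc c' * c' * ‖v‖ * ‖v‖ = (c' * ‖v‖) * (c' * ‖v‖) := by ring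
      _ ≤ ‖S v‖ * ‖S v‖ := by gcongr <;> exact hcS v
      _ = B v v := (real_inner_self_eq_norm_mul_norm (S v)).symm
  refine ⟨hB.continuousLinearEquivOfBilin.symm ((InnerProductSpace.toDual ℝ V).symm f),
    fun v => ?_⟩
  change B _ v = f v
  rw [← hB.continuousLinearEquivOfBilin_apply, ContinuousLinearEquiv.apply_symm_apply,
    InnerProductSpace.toDual_symm_apply]

lemma surjective_petrovGalerkin [CompleteSpace V] (hT : T.range = (Submodule.span ℝ {p})ᗮ)
    (hS : S.range = (Submodule.span ℝ {q})ᗮ) (hc' : 0 < c') (hcS : ∀ v, c' * ‖v‖ ≤ ‖S v‖)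
    (hpq : inner ℝ p (J.symm q) ≠ 0) : Function.Surjective (petrovGalerkin J T S) := fun f => by
  obtain ⟨u, hu⟩ := exists_inner_map_eq_dual hc' hcS f
  set a := inner ℝ p (J.symm (S u)) / inner ℝ p (J.symm q)
  have horth : J.symm (S u - a • q) ∈ T.range := by
    rw [hT, Submodule.mem_orthogonal_singleton_iff_inner_right, map_sub, map_smul,
      inner_sub_right, inner_smul_right, div_mul_cancel₀ _ hpq, sub_self]
  obtain ⟨w, hw⟩ := horth
  refine ⟨w, ContinuousLinearMap.ext fun v => ?_⟩
  have hqS : inner ℝ q (S v) = 0 :=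
    Submodule.mem_orthogonal_singleton_iff_inner_right.1 (hS ▸ LinearMap.mem_range_self _ v)
  have hJw : J (T w) = S u - a • q := J.eq_symm_apply.1 hw
  rw [petrovGalerkin_apply, hJw, inner_sub_left, inner_smul_left, hqS, mul_zero, sub_zero, hu]

lemma injective_of_mul_norm_le_norm {F : Type*} [NormedAddCommGroup F] [NormedSpace ℝ F]
    {L : W →L[ℝ] F} (hc : 0 < c) (hL : ∀ w, c * ‖w‖ ≤ ‖L w‖) : Function.Injective L :=
  (injective_iff_map_eq_zero L).2 fun w hw => by
    have h := hL w
    rw [hw, norm_zero] at h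
    exact norm_le_zero_iff.1 (nonpos_of_mul_nonpos_right h hc)

lemma le_iInf_iSup_div [CompleteSpace V] {B : W →L[ℝ] V →L[ℝ] ℝ} (hc : 0 < c)
    (hB : ∀ w, c * ‖w‖ ≤ ‖B w‖) :
    (c : EReal) ≤ ⨅ w : {w : W // w ≠ 0}, ⨆ v : {v : V // v ≠ 0},
      ((B w v / (‖(w : W)‖ * ‖(v : V)‖) : ℝ) : EReal) := by
  refine le_iInf fun w => ?_
  set v := (InnerProductSpace.toDual ℝ V).symm (B w)
  have hw : 0 < ‖(w : W)‖ := norm_pos_iff.2 w.2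
  have hv : ‖v‖ = ‖B w‖ := LinearIsometryEquiv.norm_map _ _
  have hv0 : 0 < ‖v‖ := hv ▸ (mul_pos hc hw).trans_le (hB w)
  have hBv : B w v = ‖v‖ * ‖v‖ := by
    rw [← InnerProductSpace.toDual_symm_apply, real_inner_self_eq_norm_mul_norm]
  refine le_iSup_of_le ⟨v, norm_pos_iff.1 hv0⟩ (EReal.coe_le_coe_iff.2 ?_)
  rw [hBv, mul_div_mul_right _ _ hv0.ne', le_div_iff₀ hw, hv]
  exact hB w

end PetrovGalerkin

section Multiplication

variable {α : Type*} [MeasurableSpace α] {μ : Measure α} {a b : α → ℝ}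

/-- Multiplication by an essentially bounded function, as an operator on `L²`. -/
noncomputable def mulL2 (ha : MemLp a ⊤ μ) : Lp ℝ 2 μ →L[ℝ] Lp ℝ 2 μ :=
  (ContinuousLinearMap.mul ℝ ℝ).holderL μ ⊤ 2 2 (ha.toLp a)

lemma coeFn_mulL2 (ha : MemLp a ⊤ μ) (g : Lp ℝ 2 μ) : mulL2 ha g =ᵐ[μ] fun x => a x * g x := by
  filter_upwards [(ContinuousLinearMap.mul ℝ ℝ).coeFn_holder (r := 2) (ha.toLp a) g,
    ha.coeFn_toLp] with x hx hax
  exact hx.trans (by rw [hax, ContinuousLinearMap.mul_apply'])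

lemma norm_mulL2_le (ha : MemLp a ⊤ μ) {C : ℝ} (hC : ∀ᵐ x ∂μ, |a x| ≤ C) (g : Lp ℝ 2 μ) :
    ‖mulL2 ha g‖ ≤ C * ‖g‖ := by
  refine Lp.norm_le_mul_norm_of_ae_le_mul ?_
  filter_upwards [coeFn_mulL2 ha g, hC] with x hx hax
  rw [hx, norm_mul, Real.norm_eq_abs]
  gcongr

lemma mulL2_mulL2 (ha : MemLp a ⊤ μ) (hb : MemLp b ⊤ μ) (h : ∀ᵐ x ∂μ, a x * b x = 1)
    (g : Lp ℝ 2 μ) : mulL2 ha (mulL2 hb g) = g := by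
  refine Lp.ext ?_
  filter_upwards [coeFn_mulL2 ha (mulL2 hb g), coeFn_mulL2 hb g, h] with x hax hbx hx
  rw [hax, hbx, ← mul_assoc, hx, one_mul]

end Multiplication

namespace IsDiffusivity

variable {Km KM : ℝ} {K p : ℝ → ℝ}

lemma le (hK : IsDiffusivity Km KM K) : Km ≤ KM := by
  obtain ⟨x, hx⟩ := hK.2.exists
  exact hx.1.trans hx.2

lemma ae_pos (hK : IsDiffusivity Km KM K) (hKm : 0 < Km) : ∀ᵐ x ∂unitMeasure, 0 < K x :=
  hK.2.mono fun _ hx => hKm.trans_le hx.1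

lemma ae_abs_le (hK : IsDiffusivity Km KM K) (hKm : 0 < Km) : ∀ᵐ x ∂unitMeasure, |K x| ≤ KM :=
  hK.2.mono fun _ hx => (abs_of_pos (hKm.trans_le hx.1)).trans_le hx.2

lemma ae_abs_inv_le (hK : IsDiffusivity Km KM K) (hKm : 0 < Km) :
    ∀ᵐ x ∂unitMeasure, |(K x)⁻¹| ≤ Km⁻¹ :=
  hK.2.mono fun _ hx => by
    rw [abs_of_pos (inv_pos.2 (hKm.trans_le hx.1))]
    exact inv_anti₀ hKm hx.1

lemma memLp_top (hK : IsDiffusivity Km KM K) (hKm : 0 < Km) : MemLp K ⊤ unitMeasure :=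
  memLp_top_of_bound hK.1 KM (hK.ae_abs_le hKm)

lemma memLp_top_inv (hK : IsDiffusivity Km KM K) (hKm : 0 < Km) :
    MemLp (fun x => (K x)⁻¹) ⊤ unitMeasure :=
  memLp_top_of_bound hK.1.aemeasurable.inv.aestronglyMeasurable Km⁻¹ (hK.ae_abs_inv_le hKm)

/-- Multiplication by `K` on `L²(0,1)`. -/
noncomputable def mulEquiv (hK : IsDiffusivity Km KM K) (hKm : 0 < Km) : UnitL2 ≃L[ℝ] UnitL2 :=
  .equivOfInverse (mulL2 (hK.memLp_top hKm)) (mulL2 (hK.memLp_top_inv hKm))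
    (mulL2_mulL2 _ _ ((hK.ae_pos hKm).mono fun _ hx => inv_mul_cancel₀ hx.ne'))
    (mulL2_mulL2 _ _ ((hK.ae_pos hKm).mono fun _ hx => mul_inv_cancel₀ hx.ne'))

lemma coeFn_mulEquiv (hK : IsDiffusivity Km KM K) (hKm : 0 < Km) (g : UnitL2) :
    hK.mulEquiv hKm g =ᵐ[unitMeasure] fun x => K x * g x :=
  coeFn_mulL2 _ g

lemma norm_mulEquiv_le (hK : IsDiffusivity Km KM K) (hKm : 0 < Km) (g : UnitL2) :
    ‖hK.mulEquiv hKm g‖ ≤ KM * ‖g‖ :=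
  norm_mulL2_le _ (hK.ae_abs_le hKm) g

lemma norm_mulEquiv_symm_le (hK : IsDiffusivity Km KM K) (hKm : 0 < Km) (g : UnitL2) :
    ‖(hK.mulEquiv hKm).symm g‖ ≤ Km⁻¹ * ‖g‖ :=
  norm_mulL2_le _ (hK.ae_abs_inv_le hKm) g

lemma memLp_inv (hK : IsDiffusivity Km KM K) (hKm : 0 < Km) :
    MemLp (fun x => (K x)⁻¹) 2 unitMeasure :=
  (hK.memLp_top_inv hKm).mono_exponent le_top

lemma inv_le_integral_mul_inv (hK : IsDiffusivity Km KM K) (hKm : 0 < Km)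
    (hp : MemLp p 2 unitMeasure) (hp1 : ∀ᵐ x ∂unitMeasure, 1 ≤ p x) :
    KM⁻¹ ≤ ∫ x, p x * (K x)⁻¹ ∂unitMeasure := by
  have hmono : ∫ _, KM⁻¹ ∂unitMeasure ≤ ∫ x, p x * (K x)⁻¹ ∂unitMeasure := by
    refine integral_mono_ae (integrable_const _) (hp.integrable_mul (hK.memLp_inv hKm)) ?_
    filter_upwards [hp1, hK.2] with x hpx hx
    have hKx : 0 < K x := hKm.trans_le hx.1
    calc KM⁻¹ ≤ (K x)⁻¹ := inv_anti₀ hKx hx.2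
      _ ≤ p x * (K x)⁻¹ := le_mul_of_one_le_left (inv_pos.2 hKx).le hpx
  simpa using hmono

lemma integral_inv_pos (hK : IsDiffusivity Km KM K) (hKm : 0 < Km) :
    0 < ∫ x, (K x)⁻¹ ∂unitMeasure := by
  refine (inv_pos.2 (hKm.trans_le hK.le)).trans_le ?_
  simpa using hK.inv_le_integral_mul_inv hKm (memLp_const 1) (ae_of_all _ fun _ => le_rfl)

end IsDiffusivity

section WeakForm

variable {β θ Km KM : ℝ} {K : ℝ → ℝ}

lemma inv_le_inner_weightL2 (hK : IsDiffusivity Km KM K) (hKm : 0 < Km) (hβ : 0 < β)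
    (hβ' : β < 1 / 2) (hθ : θ = 0 ∨ θ = 1) :
    KM⁻¹ ≤ inner ℝ (weightL2 hβ' hθ) ((hK.mulEquiv hKm).symm oneL2) := by
  rw [weightL2, inner_toLp_left]
  refine (hK.inv_le_integral_mul_inv hKm (memLp_weight hβ' hθ)
    (ae_unitMeasure_of_forall fun _ hx => one_le_weight hβ.le hθ hx)).trans_eq
    (integral_congr_ae ?_)
  filter_upwards [coeFn_mulL2 (hK.memLp_top_inv hKm) oneL2,
    (memLp_const (1 : ℝ)).coeFn_toLp (μ := unitMeasure) (p := 2)] with x hx h1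
  exact congrArg _ (hx.trans (by rw [oneL2, h1, mul_one])).symm

/-- The form `A` of the equation with diffusivity `K`, as a bounded bilinear map. -/
noncomputable def formBilin (hβ : 0 < β) (hβ' : β < 1 / 2) (hθ : θ = 0 ∨ θ = 1)
    (hKm : 0 < Km) (hK : IsDiffusivity Km KM K) : H0 (1 - β) →L[ℝ] H0 1 →L[ℝ] ℝ :=
  petrovGalerkin (hK.mulEquiv hKm) (fracDeriv hβ hβ' hθ) derivL2

lemma formBilin_apply (hβ : 0 < β) (hβ' : β < 1 / 2) (hθ : θ = 0 ∨ θ = 1) (hKm : 0 < Km)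
    (hK : IsDiffusivity Km KM K) (w : H0 (1 - β)) (v : H0 1) :
    formBilin hβ hβ' hθ hKm hK w v = formA β θ K w v := by
  rw [formBilin, petrovGalerkin_apply, L2.inner_def]
  refine integral_congr_ae ?_
  filter_upwards [hK.coeFn_mulEquiv hKm (fracDeriv hβ hβ' hθ w),
    (isWeakDeriv_fracInt hβ hβ' hθ w).weakDeriv_ae_eq,
    (isWeakDeriv_derivL2 v).weakDeriv_ae_eq] with x hKx hwx hvx
  rw [hKx, hwx, hvx]
  exact mul_comm _ _

lemma norm_formBilin_le (hβ : 0 < β) (hβ' : β < 1 / 2) (hθ : θ = 0 ∨ θ = 1) (hKm : 0 < Km)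
    (hK : IsDiffusivity Km KM K) : ‖formBilin hβ hβ' hθ hKm hK‖ ≤ KM :=
  norm_petrovGalerkin_le (norm_fracDeriv_le hβ hβ' hθ) norm_derivL2_le (hKm.le.trans hK.le)
    (hK.norm_mulEquiv_le hKm)

theorem exists_mul_norm_le_norm_formBilin (hβ : 0 < β) (hβ' : β < 1 / 2) (hθ : θ = 0 ∨ θ = 1)
    (hKm : 0 < Km) (KM : ℝ) :
    ∃ κ > 0, ∀ K, ∀ hK : IsDiffusivity Km KM K, ∀ w,
      κ * ‖w‖ ≤ ‖formBilin hβ hβ' hθ hKm hK w‖ := by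
  rcases le_or_gt KM 0 with hKM | hKM
  · exact ⟨1, one_pos, fun K hK => absurd (hKm.trans_le hK.le) hKM.not_gt⟩
  obtain ⟨c, hc, hcT⟩ := exists_mul_norm_le_norm_fracDeriv hβ hβ' hθ
  exact ⟨_, by positivity, fun K hK => mul_norm_le_norm_petrovGalerkin (range_fracDeriv hβ hβ' hθ)
    range_derivL2 hcT one_half_pos half_mul_norm_le_norm_derivL2 (inv_pos.2 hKm)
    (hK.norm_mulEquiv_symm_le hKm) (inv_pos.2 hKM) (inv_le_inner_weightL2 hK hKm hβ hβ' hθ)⟩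

theorem surjective_formBilin (hβ : 0 < β) (hβ' : β < 1 / 2) (hθ : θ = 0 ∨ θ = 1) (hKm : 0 < Km)
    (hK : IsDiffusivity Km KM K) : Function.Surjective (formBilin hβ hβ' hθ hKm hK) :=
  surjective_petrovGalerkin (range_fracDeriv hβ hβ' hθ) range_derivL2 one_half_pos
    half_mul_norm_le_norm_derivL2
    ((inv_pos.2 (hKm.trans_le hK.le)).trans_le (inv_le_inner_weightL2 hK hKm hβ hβ' hθ)).ne'

lemma isWeakSolution_iff (hβ : 0 < β) (hβ' : β < 1 / 2) (hθ : θ = 0 ∨ θ = 1) (hKm : 0 < Km)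
    (hK : IsDiffusivity Km KM K) {f : HNeg1} {u : H0 (1 - β)} :
    IsWeakSolution β θ K f u ↔ formBilin hβ hβ' hθ hKm hK u = f := by
  simp only [IsWeakSolution, ContinuousLinearMap.ext_iff, formBilin_apply]

theorem existsUnique_isWeakSolution (hβ : 0 < β) (hβ' : β < 1 / 2) (hθ : θ = 0 ∨ θ = 1)
    (hKm : 0 < Km) (hK : IsDiffusivity Km KM K) (f : HNeg1) :
    ∃! u : H0 (1 - β), IsWeakSolution β θ K f u := by
  obtain ⟨κ, hκ, hκB⟩ := exists_mul_norm_le_norm_formBilin hβ hβ' hθ hKm KM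
  simp only [isWeakSolution_iff hβ hβ' hθ hKm hK]
  exact Function.Bijective.existsUnique
    ⟨injective_of_mul_norm_le_norm hκ (hκB K hK), surjective_formBilin hβ hβ' hθ hKm hK⟩ f

theorem existsUnique_isWeakSolution_integral (hβ : 0 < β) (hβ' : β < 1 / 2) (hθ : θ = 0 ∨ θ = 1)
    (hKm : 0 < Km) (hK : IsDiffusivity Km KM K) {f : ℝ → ℝ} (hf : MemLp f 2 unitMeasure) :
    ∃! u : H0 (1 - β), IsWeakSolution β θ K (fun v => ∫ x, f x * v.fn x ∂unitMeasure) u := by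
  obtain ⟨ℓ, hℓ⟩ := exists_dual_eq_integral_mul 1 hf
  simpa only [← funext hℓ] using existsUnique_isWeakSolution hβ hβ' hθ hKm hK ℓ

theorem exists_formA_pos (hβ : 0 < β) (hβ' : β < 1 / 2) (hθ : θ = 0 ∨ θ = 1) (hKm : 0 < Km)
    (hK : IsDiffusivity Km KM K) {v : H0 1} (hv : v ≠ 0) :
    ∃ u : H0 (1 - β), 0 < formA β θ K u v := by
  obtain ⟨u, hu⟩ := surjective_formBilin hβ hβ' hθ hKm hK (innerSL ℝ v)
  refine ⟨u, ?_⟩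
  rw [← formBilin_apply hβ hβ' hθ hKm hK, hu]
  exact real_inner_self_pos.2 hv

end WeakForm

/-! ### The auxiliary functions and the nondegeneracy condition -/

section FluxEquation

variable {q f : ℝ → ℝ}

lemma weakDeriv_testEmbed (φ : testSpace) :
    weakDeriv 1 (testEmbed one_mem_Icc φ).fn =ᵐ[unitMeasure] deriv φ := by
  have h := (isWeakDeriv_derivL2 (testEmbed one_mem_Icc φ)).weakDeriv_ae_eq
  rw [derivL2_testEmbed] at h
  exact h.trans ((isTestFunction_coe φ).deriv.memLp 2 unitMeasure).coeFn_toLp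

lemma ae_add_primitive_eq_const (hq : MemLp q 2 unitMeasure) (hf : MemLp f 2 unitMeasure)
    (h : ∀ v : H0 1,
      ∫ x, q x * weakDeriv 1 v.fn x ∂unitMeasure = ∫ x, f x * v.fn x ∂unitMeasure) :
    ∃ a : ℝ, ∀ᵐ x ∂unitMeasure, q x + ∫ s in (0 : ℝ)..x, f s = a := by
  have hf1 := integrable_of_memLp_two hf
  have hq1 := integrable_of_memLp_two hq
  have hF := integrable_of_memLp_two (memLp_two_of_continuousOn (continuousOn_primitive hf1))
  refine ae_eq_const_of_forall_integral_mul_deriv_eq_zero (hq1.add hF) fun φ hφ => ?_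
  set v := testEmbed one_mem_Icc ⟨φ, hφ⟩
  have hweak : ∫ x, q x * deriv φ x ∂unitMeasure = ∫ x, f x * φ x ∂unitMeasure :=
    calc ∫ x, q x * deriv φ x ∂unitMeasure
        = ∫ x, q x * weakDeriv 1 v.fn x ∂unitMeasure :=
          integral_congr_ae ((ae_eq_refl q).mul (weakDeriv_testEmbed ⟨φ, hφ⟩).symm)
      _ = ∫ x, f x * v.fn x ∂unitMeasure := h v
      _ = ∫ x, f x * φ x ∂unitMeasure :=
          integral_congr_ae ((ae_eq_refl f).mul (ae_restrict_of_ae (testEmbed_fn one_mem_Icc _)))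
  simp only [add_mul]
  rw [integral_add (hφ.deriv.integrable_mul hq1) (hφ.deriv.integrable_mul hF),
    integral_primitive_mul_deriv hf1 hφ, hweak, add_neg_cancel]

end FluxEquation

section LinearProfile

variable {Km KM : ℝ} {K w : ℝ → ℝ}

lemma integral_derivL2 (v : H0 1) : ∫ x, derivL2 v x ∂unitMeasure = 0 := by
  have h : derivL2 v ∈ derivL2.range := LinearMap.mem_range_self _ v
  rw [range_derivL2, Submodule.mem_orthogonal_singleton_iff_inner_right, oneL2,
    inner_toLp_left] at h
  simpa only [one_mul] using h

/-- The function `w_l`: the solution of `D (K D w) = 0`, `w 0 = 1`, `w 1 = 0`. -/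
noncomputable def linearProfile (K : ℝ → ℝ) (x : ℝ) : ℝ :=
  1 - (∫ s in (0 : ℝ)..x, (K s)⁻¹) / ∫ s, (K s)⁻¹ ∂unitMeasure

lemma isWl_linearProfile (hK : IsDiffusivity Km KM K) (hKm : 0 < Km) :
    IsWl K (linearProfile K) := by
  have hJ := hK.integral_inv_pos hKm
  have hm := hK.memLp_inv hKm
  have hc : ContinuousOn (linearProfile K) (Icc 0 1) :=
    continuousOn_const.sub ((continuousOn_primitive (integrable_of_memLp_two hm)).div_const _)
  set J := ∫ s, (K s)⁻¹ ∂unitMeasure with hJ_def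
  have hd : IsWeakDeriv 1 (linearProfile K) (fun x => -J⁻¹ * (K x)⁻¹) := by
    refine isWeakDeriv_one_of_eq_primitive (c := 1) (hm.const_mul _) (ae_of_all _ fun x => ?_)
    rw [intervalIntegral.integral_const_mul, linearProfile, ← hJ_def]
    ring
  refine ⟨hc, memH_one hc hd, by simp [linearProfile], ?_, fun v => ?_⟩
  · rw [linearProfile, ← integral_unitMeasure, ← hJ_def, div_self hJ.ne', sub_self]
  · have hflux : ∫ x, K x * weakDeriv 1 (linearProfile K) x * weakDeriv 1 v.fn x ∂unitMeasure =
        ∫ x, -J⁻¹ * derivL2 v x ∂unitMeasure := by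
      refine integral_congr_ae ?_
      filter_upwards [hd.weakDeriv_ae_eq, (isWeakDeriv_derivL2 v).weakDeriv_ae_eq, hK.ae_pos hKm]
        with x hwx hvx hKx
      rw [hwx, hvx]
      field_simp
    rw [hflux, integral_const_mul, integral_derivL2, mul_zero]

lemma IsWl.exists_eqOn_primitive (hK : IsDiffusivity Km KM K) (hKm : 0 < Km) (hw : IsWl K w) :
    ∃ a : ℝ, EqOn w (fun x => 1 + a * ∫ s in (0 : ℝ)..x, (K s)⁻¹) (Icc 0 1) := by
  obtain ⟨hc, ⟨hw2, hwH⟩, h0, -, hv⟩ := hw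
  obtain ⟨g, hg⟩ := hwH 1 le_rfl
  have hm := integrable_of_memLp_two (hK.memLp_inv hKm)
  have hflux : MemLp (fun x => K x * weakDeriv 1 w x) 2 unitMeasure :=
    hg.weakDeriv.1.mul (hK.memLp_top hKm)
  obtain ⟨a, ha⟩ := ae_add_primitive_eq_const (f := 0) hflux MemLp.zero
    fun v => by simpa using hv v
  obtain ⟨c, hcw⟩ := hg.exists_eq_primitive (integrable_of_memLp_two hw2)
  have hga : g =ᵐ[unitMeasure] fun x => a * (K x)⁻¹ := by
    filter_upwards [ha, hg.weakDeriv_ae_eq, hK.ae_pos hKm] with x hax hwx hKx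
    simp only [Pi.zero_apply, intervalIntegral.integral_zero, add_zero, hwx] at hax
    rw [← hax, mul_right_comm, mul_inv_cancel₀ hKx.ne', one_mul]
  have hwc : EqOn w (fun x => c + a * ∫ s in (0 : ℝ)..x, (K s)⁻¹) (Icc 0 1) := by
    refine eqOn_Icc_of_ae_eq hc (((continuousOn_primitive hm).const_mul a).const_add c) ?_
    filter_upwards [hcw, ae_unitMeasure_of_forall fun x hx => hx] with x hx hx01
    rw [hx, primitive_congr_ae hga (Ioo_subset_Icc_self hx01),
      intervalIntegral.integral_const_mul]
  have hc1 : c = 1 := by simpa [h0] using (hwc (left_mem_Icc.2 zero_le_one)).symm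
  exact ⟨a, hc1 ▸ hwc⟩

lemma IsWl.eqOn (hK : IsDiffusivity Km KM K) (hKm : 0 < Km) (hw : IsWl K w) :
    EqOn w (linearProfile K) (Icc 0 1) := by
  obtain ⟨a, ha⟩ := hw.exists_eqOn_primitive hK hKm
  have h1 := ha one_mem_Icc
  simp only [hw.2.2.2.1, ← integral_unitMeasure] at h1
  have ha' : a = -1 / ∫ s, (K s)⁻¹ ∂unitMeasure :=
    (eq_div_iff (hK.integral_inv_pos hKm).ne').2 (by linarith)
  intro x hx
  rw [ha hx, linearProfile, ha']
  ring

end LinearProfile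

section NondegeneracyNumber

variable {β θ Km KM : ℝ} {K wl : ℝ → ℝ} {u : H0 (1 - β)}

lemma fracInt_zero_right (β θ : ℝ) (w : ℝ → ℝ) : fracInt β θ w 0 = (1 - θ) * rightInt β w 0 := by
  simp [fracInt, leftInt]

lemma fracInt_one_right (β θ : ℝ) (w : ℝ → ℝ) : fracInt β θ w 1 = θ * leftInt β w 1 := by
  simp [fracInt, rightInt]

lemma leftInt_sub_rightInt_eq (hβ : 0 < β) (hβ' : β < 1 / 2) (hθ : θ = 0 ∨ θ = 1)
    (u : H0 (1 - β)) :
    θ * leftInt β u.fn 1 - (1 - θ) * rightInt β u.fn 0 =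
      ∫ s, fracDeriv hβ hβ' hθ u s ∂unitMeasure := by
  rw [← fracInt_zero_right, ← fracInt_one_right, integral_unitMeasure,
    fracInt_fn_eq hβ hβ' hθ u one_mem_Icc, add_sub_cancel_left]

lemma integral_weight_mul_fracDeriv (hβ : 0 < β) (hβ' : β < 1 / 2) (hθ : θ = 0 ∨ θ = 1)
    (u : H0 (1 - β)) : ∫ x, weight β θ x * fracDeriv hβ hβ' hθ u x ∂unitMeasure = 0 := by
  have h : fracDeriv hβ hβ' hθ u ∈ (fracDeriv hβ hβ' hθ).range := LinearMap.mem_range_self _ u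
  rwa [range_fracDeriv, Submodule.mem_orthogonal_singleton_iff_inner_right, weightL2,
    inner_toLp_left] at h

lemma exists_fracDeriv_ae_eq (hβ : 0 < β) (hβ' : β < 1 / 2) (hθ : θ = 0 ∨ θ = 1) {g : ℝ → ℝ}
    (hg : MemLp g 2 unitMeasure) (h : ∫ x, weight β θ x * g x ∂unitMeasure = 0) :
    ∃ u : H0 (1 - β), fracDeriv hβ hβ' hθ u =ᵐ[unitMeasure] g := by
  have hmem : hg.toLp g ∈ (fracDeriv hβ hβ' hθ).range := by
    rwa [range_fracDeriv, Submodule.mem_orthogonal_singleton_iff_inner_right, weightL2,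
      inner_toLp (memLp_weight hβ' hθ)]
  obtain ⟨u, hu⟩ := hmem
  exact ⟨u, hu ▸ hg.coeFn_toLp⟩

lemma fracDeriv_injective (hβ : 0 < β) (hβ' : β < 1 / 2) (hθ : θ = 0 ∨ θ = 1) :
    Function.Injective (fracDeriv hβ hβ' hθ) := by
  obtain ⟨c, hc0, hc⟩ := exists_mul_norm_le_norm_fracDeriv hβ hβ' hθ
  exact injective_of_mul_norm_le_norm hc0 hc

lemma IsWl.integral_const_sub_inv (hwl : IsWl K wl) (hKm : 0 < Km) (hK : IsDiffusivity Km KM K)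
    (b : ℝ) {x : ℝ} (hx : x ∈ Icc (0 : ℝ) 1) :
    ∫ s in (0 : ℝ)..x, (b - (∫ s, (K s)⁻¹ ∂unitMeasure)⁻¹ * (K s)⁻¹) = b * x + (wl x - 1) := by
  rw [intervalIntegral.integral_sub (by simp) (intervalIntegrable_of_integrable_unitMeasure
      ((integrable_of_memLp_two (hK.memLp_inv hKm)).const_mul _) (left_mem_Icc.2 zero_le_one) hx),
    intervalIntegral.integral_const, intervalIntegral.integral_const_mul, hwl.eqOn hK hKm hx,
    linearProfile, smul_eq_mul]
  ring

lemma isUl_iff (hβ : 0 < β) (hβ' : β < 1 / 2) (hθ : θ = 0 ∨ θ = 1) (hKm : 0 < Km)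
    (hK : IsDiffusivity Km KM K) (hwl : IsWl K wl) :
    IsUl β θ wl u ↔ fracDeriv hβ hβ' hθ u =ᵐ[unitMeasure] fun x =>
      (1 + ∫ s, fracDeriv hβ hβ' hθ u s ∂unitMeasure) -
        (∫ s, (K s)⁻¹ ∂unitMeasure)⁻¹ * (K x)⁻¹ := by
  set J := ∫ s, (K s)⁻¹ ∂unitMeasure
  set b := 1 + ∫ s, fracDeriv hβ hβ' hθ u s ∂unitMeasure with hb
  have hT := integrable_of_memLp_two (Lp.memLp (fracDeriv hβ hβ' hθ u))
  have hi : Integrable (fun s => b - J⁻¹ * (K s)⁻¹) unitMeasure :=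
    (integrable_const _).sub ((integrable_of_memLp_two (hK.memLp_inv hKm)).const_mul _)
  have h0 : (0 : ℝ) ∈ Icc (0 : ℝ) 1 := left_mem_Icc.2 zero_le_one
  have hiff : IsUl β θ wl u ↔ ∀ x ∈ Icc (0 : ℝ) 1,
      ∫ s in (0 : ℝ)..x, fracDeriv hβ hβ' hθ u s = ∫ s in (0 : ℝ)..x, (b - J⁻¹ * (K s)⁻¹) := by
    refine forall₂_congr fun x hx => ?_
    rw [hwl.integral_const_sub_inv hKm hK b hx, fracInt_fn_eq hβ hβ' hθ u hx, fracInt_zero_right,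
      hb, ← leftInt_sub_rightInt_eq hβ hβ' hθ u]
    constructor <;> intro h <;> linear_combination h
  rw [hiff]
  refine ⟨fun h => ?_, fun h x hx => primitive_congr_ae h hx⟩
  refine (ae_eq_zero_of_forall_primitive_eq_zero (hT.sub hi) fun x hx => ?_).mono
    fun x hx => sub_eq_zero.1 hx
  simp only [Pi.sub_apply]
  rw [intervalIntegral.integral_sub (intervalIntegrable_of_integrable_unitMeasure hT h0 hx)
    (intervalIntegrable_of_integrable_unitMeasure hi h0 hx), h x hx, sub_self]

/-- The value of `1 + θ (ˡI^β u_l)(1) - (1-θ) (ʳI^β u_l)(0)`, obtained by testing the equation for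
`D I^β_θ u_l` against the weight. -/
noncomputable def nondegeneracyNumber (β θ : ℝ) (K : ℝ → ℝ) : ℝ :=
  (∫ x, weight β θ x * (K x)⁻¹ ∂unitMeasure) /
    ((∫ x, (K x)⁻¹ ∂unitMeasure) * ∫ x, weight β θ x ∂unitMeasure)

lemma integral_weight_pos (hβ : 0 < β) (hβ' : β < 1 / 2) (hθ : θ = 0 ∨ θ = 1) :
    0 < ∫ x, weight β θ x ∂unitMeasure := by
  have h : ∫ _, (1 : ℝ) ∂unitMeasure ≤ ∫ x, weight β θ x ∂unitMeasure :=
    integral_mono_ae (integrable_const 1) (integrable_of_memLp_two (memLp_weight hβ' hθ))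
      (ae_unitMeasure_of_forall fun _ hx => one_le_weight hβ.le hθ hx)
  exact one_pos.trans_le (by simpa using h)

lemma nondegeneracyNumber_pos (hβ : 0 < β) (hβ' : β < 1 / 2) (hθ : θ = 0 ∨ θ = 1) (hKm : 0 < Km)
    (hK : IsDiffusivity Km KM K) : 0 < nondegeneracyNumber β θ K :=
  div_pos ((inv_pos.2 (hKm.trans_le hK.le)).trans_le (hK.inv_le_integral_mul_inv hKm
      (memLp_weight hβ' hθ) (ae_unitMeasure_of_forall fun _ hx => one_le_weight hβ.le hθ hx)))
    (mul_pos (hK.integral_inv_pos hKm) (integral_weight_pos hβ hβ' hθ))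

lemma integral_weight_mul_sub (hβ : 0 < β) (hβ' : β < 1 / 2) (hθ : θ = 0 ∨ θ = 1) (hKm : 0 < Km)
    (hK : IsDiffusivity Km KM K) (b : ℝ) :
    ∫ x, weight β θ x * (b - (∫ s, (K s)⁻¹ ∂unitMeasure)⁻¹ * (K x)⁻¹) ∂unitMeasure =
      (b - nondegeneracyNumber β θ K) * ∫ x, weight β θ x ∂unitMeasure := by
  have hw := memLp_weight hβ' hθ
  have hW := (integral_weight_pos hβ hβ' hθ).ne'
  have hwK : Integrable (fun x => weight β θ x * (K x)⁻¹) unitMeasure :=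
    hw.integrable_mul (hK.memLp_inv hKm)
  simp only [mul_sub, mul_left_comm _ (∫ s, (K s)⁻¹ ∂unitMeasure)⁻¹]
  rw [integral_sub ((integrable_of_memLp_two hw).mul_const b) (hwK.const_mul _),
    integral_mul_const, integral_const_mul, nondegeneracyNumber]
  field_simp

theorem IsUl.one_add_eq_nondegeneracyNumber (hβ : 0 < β) (hβ' : β < 1 / 2) (hθ : θ = 0 ∨ θ = 1)
    (hKm : 0 < Km) (hK : IsDiffusivity Km KM K) (hwl : IsWl K wl) (hu : IsUl β θ wl u) :
    1 + ∫ s, fracDeriv hβ hβ' hθ u s ∂unitMeasure = nondegeneracyNumber β θ K := by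
  have h := (integral_congr_ae ((ae_eq_refl (weight β θ)).mul
    ((isUl_iff hβ hβ' hθ hKm hK hwl).1 hu))).symm.trans (integral_weight_mul_fracDeriv hβ hβ' hθ u)
  simp only [Pi.mul_apply] at h
  rw [integral_weight_mul_sub hβ hβ' hθ hKm hK] at h
  exact sub_eq_zero.1 ((mul_eq_zero.1 h).resolve_right (integral_weight_pos hβ hβ' hθ).ne')

theorem existsUnique_isUl (hβ : 0 < β) (hβ' : β < 1 / 2) (hθ : θ = 0 ∨ θ = 1) (hKm : 0 < Km)
    (hK : IsDiffusivity Km KM K) (hwl : IsWl K wl) : ∃! u : H0 (1 - β), IsUl β θ wl u := by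
  have hm := (hK.memLp_inv hKm).const_mul (∫ s, (K s)⁻¹ ∂unitMeasure)⁻¹
  obtain ⟨u, hu⟩ := exists_fracDeriv_ae_eq hβ hβ' hθ
    ((memLp_const (nondegeneracyNumber β θ K)).sub hm) (by
      rw [← zero_mul (∫ x, weight β θ x ∂unitMeasure), ← sub_self (nondegeneracyNumber β θ K)]
      exact integral_weight_mul_sub hβ hβ' hθ hKm hK _)
  have hInt : 1 + ∫ s, fracDeriv hβ hβ' hθ u s ∂unitMeasure = nondegeneracyNumber β θ K := by
    rw [integral_congr_ae hu, integral_sub' (integrable_const _) (integrable_of_memLp_two hm),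
      integral_const_mul, inv_mul_cancel₀ (hK.integral_inv_pos hKm).ne']
    simp
  refine ⟨u, (isUl_iff hβ hβ' hθ hKm hK hwl).2 (hInt ▸ hu), fun u' hu' => ?_⟩
  have h := (isUl_iff hβ hβ' hθ hKm hK hwl).1 hu'
  rw [hu'.one_add_eq_nondegeneracyNumber hβ hβ' hθ hKm hK hwl] at h
  exact fracDeriv_injective hβ hβ' hθ (Lp.ext (h.trans hu.symm))

theorem exists_isWl_existsUnique_isUl (hβ : 0 < β) (hβ' : β < 1 / 2) (hθ : θ = 0 ∨ θ = 1)
    (hKm : 0 < Km) (hK : IsDiffusivity Km KM K) :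
    ∃ wl, IsWl K wl ∧ (∀ w, IsWl K w → EqOn w wl (Icc 0 1)) ∧
      ∃! ul : H0 (1 - β), IsUl β θ wl ul :=
  ⟨linearProfile K, isWl_linearProfile hK hKm, fun _ hw => hw.eqOn hK hKm,
    existsUnique_isUl hβ hβ' hθ hKm hK (isWl_linearProfile hK hKm)⟩

theorem nondegenerate (hβ : 0 < β) (hβ' : β < 1 / 2) (hθ : θ = 0 ∨ θ = 1) (hKm : 0 < Km)
    (hK : IsDiffusivity Km KM K) : Nondegenerate β θ K := by
  intro wl ul hwl hul
  rw [add_sub_assoc, leftInt_sub_rightInt_eq hβ hβ' hθ,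
    hul.one_add_eq_nondegeneracyNumber hβ hβ' hθ hKm hK hwl]
  exact (nondegeneracyNumber_pos hβ hβ' hθ hKm hK).ne'

end NondegeneracyNumber

/-! ### Regularity -/

section Primitive

variable {a h g K q : ℝ → ℝ} {c : ℝ}

lemma derivWithin_Icc_eq_deriv {x : ℝ} (hx : x ∈ Ioo (0 : ℝ) 1) :
    derivWithin a (Icc 0 1) x = deriv a x :=
  derivWithin_of_mem_nhds (Icc_mem_nhds hx.1 hx.2)

lemma mul_ae_eq_primitive (ha : ContDiffOn ℝ 1 a (Icc 0 1)) (hg : Integrable g unitMeasure)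
    (hh : ∀ᵐ x ∂unitMeasure, h x = c + ∫ s in (0 : ℝ)..x, g s) :
    ∀ᵐ x ∂unitMeasure, a x * h x =
      a 0 * c + ∫ s in (0 : ℝ)..x, (derivWithin a (Icc 0 1) s * h s + a s * g s) := by
  set H : ℝ → ℝ := fun x => c + ∫ s in (0 : ℝ)..x, g s with hH
  have hHac : AbsolutelyContinuousOnInterval H 0 1 :=
    (contDiffOn_const.absolutelyContinuousOnInterval (f := fun _ => c)).add
      (absolutelyContinuousOnInterval_primitive hg)
  have haac : AbsolutelyContinuousOnInterval a 0 1 :=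
    ContDiffOn.absolutelyContinuousOnInterval (by rwa [uIcc_of_le zero_le_one])
  have hd : (fun s => derivWithin a (Icc 0 1) s * h s + a s * g s) =ᵐ[unitMeasure]
      fun s => deriv a s * H s + a s * deriv H s := by
    filter_upwards [hh, ae_hasDerivAt_primitive hg, ae_unitMeasure_of_forall fun x hx => hx]
      with s hs hderiv hs01
    rw [derivWithin_Icc_eq_deriv hs01, hs, hH, (hderiv.const_add c).deriv]
  filter_upwards [hh, ae_unitMeasure_of_forall fun x hx => hx] with x hx hx01
  have hx' := Ioo_subset_Icc_self hx01
  have hsub : uIcc 0 x ⊆ uIcc (0 : ℝ) 1 := by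
    rw [uIcc_of_le hx'.1, uIcc_of_le zero_le_one]
    exact Icc_subset_Icc_right hx'.2
  rw [primitive_congr_ae hd hx', (haac.mono hsub).integral_deriv_mul_eq_sub (hHac.mono hsub), hx]
  simp [hH]

lemma inv_mul_ae_eq_primitive (hK : ContDiffOn ℝ 1 K (Icc 0 1)) (hK0 : ∀ x ∈ Icc (0 : ℝ) 1, K x ≠ 0)
    (hg : Integrable g unitMeasure) (hq : ∀ᵐ x ∂unitMeasure, q x = c + ∫ s in (0 : ℝ)..x, g s) :
    ∀ᵐ x ∂unitMeasure, (K x)⁻¹ * q x = (K 0)⁻¹ * c +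
      ∫ s in (0 : ℝ)..x, (K s)⁻¹ * (g s - derivWithin K (Icc 0 1) s * ((K s)⁻¹ * q s)) := by
  filter_upwards [mul_ae_eq_primitive (hK.inv hK0) hg hq, ae_unitMeasure_of_forall fun x hx => hx]
    with x hx hx01
  refine hx.trans (congrArg _ (primitive_congr_ae ?_ (Ioo_subset_Icc_self hx01)))
  refine ae_unitMeasure_of_forall fun s hs => ?_
  have hs' := Ioo_subset_Icc_self hs
  have hKs := hK0 s hs'
  simp only [derivWithin_inv' (hK.differentiableOn one_ne_zero s hs') hKs, Pi.inv_apply]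
  field_simp
  ring

end Primitive

section L2Bound

variable {w w' : ℝ → ℝ} {C C' : ℝ}

/-- `w ∈ L²(0,1)` with norm at most `C`; the nonnegativity of `C` is recorded because
`ENNReal.ofReal` truncates. -/
structure L2Bound (w : ℝ → ℝ) (C : ℝ) : Prop where
  memLp : MemLp w 2 unitMeasure
  nonneg : 0 ≤ C
  eLpNorm_le : eLpNorm w 2 unitMeasure ≤ ENNReal.ofReal C

lemma l2Bound_iff (hw : MemLp w 2 unitMeasure) (hC : 0 ≤ C) :
    L2Bound w C ↔ ∫ x, w x ^ 2 ∂unitMeasure ≤ C ^ 2 := by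
  have hnorm := norm_sq_toLp hw
  simp only [Real.norm_eq_abs, sq_abs] at hnorm
  rw [← hnorm, sq_le_sq₀ (norm_nonneg _) hC, Lp.norm_toLp, ← ENNReal.le_ofReal_iff_toReal_le
    hw.2.ne hC]
  exact ⟨L2Bound.eLpNorm_le, fun h => ⟨hw, hC, h⟩⟩

namespace L2Bound

lemma integral_sq_le (h : L2Bound w C) : ∫ x, w x ^ 2 ∂unitMeasure ≤ C ^ 2 :=
  (l2Bound_iff h.memLp h.nonneg).1 h

lemma congr (h : L2Bound w C) (hw : w =ᵐ[unitMeasure] w') : L2Bound w' C :=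
  ⟨h.memLp.ae_eq hw, h.nonneg, (eLpNorm_congr_ae hw).symm.trans_le h.eLpNorm_le⟩

lemma mono (h : L2Bound w C) (hC : C ≤ C') : L2Bound w C' :=
  ⟨h.memLp, h.nonneg.trans hC, h.eLpNorm_le.trans (ENNReal.ofReal_le_ofReal hC)⟩

lemma neg (h : L2Bound w C) : L2Bound (fun x => -w x) C :=
  ⟨h.memLp.neg, h.nonneg, (eLpNorm_neg w 2 unitMeasure).trans_le h.eLpNorm_le⟩

lemma add (h : L2Bound w C) (h' : L2Bound w' C') : L2Bound (fun x => w x + w' x) (C + C') := by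
  refine ⟨h.memLp.add h'.memLp, add_nonneg h.nonneg h'.nonneg, ?_⟩
  rw [ENNReal.ofReal_add h.nonneg h'.nonneg]
  exact (eLpNorm_add_le h.memLp.1 h'.memLp.1 one_le_two).trans
    (add_le_add h.eLpNorm_le h'.eLpNorm_le)

lemma bdd_mul {a : ℝ → ℝ} {R : ℝ} (h : L2Bound w C) (ha : AEStronglyMeasurable a unitMeasure)
    (hR : ∀ᵐ x ∂unitMeasure, |a x| ≤ R) : L2Bound (fun x => a x * w x) (R * C) := by
  have hR0 : 0 ≤ R := by
    obtain ⟨x, hx⟩ := hR.exists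
    exact (abs_nonneg _).trans hx
  refine ⟨h.memLp.mul (memLp_top_of_bound ha R hR), mul_nonneg hR0 h.nonneg, ?_⟩
  rw [ENNReal.ofReal_mul hR0]
  refine (eLpNorm_le_mul_eLpNorm_of_ae_le_mul (c := R) ?_ 2).trans (by gcongr; exact h.eLpNorm_le)
  filter_upwards [hR] with x hx
  rw [norm_mul, Real.norm_eq_abs]
  gcongr

lemma continuousOn_mul {a : ℝ → ℝ} {R : ℝ} (h : L2Bound w C) (ha : ContinuousOn a (Icc 0 1))
    (hR : ∀ x ∈ Icc (0 : ℝ) 1, |a x| ≤ R) : L2Bound (fun x => a x * w x) (R * C) :=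
  h.bdd_mul (memLp_two_of_continuousOn ha).1
    (ae_unitMeasure_of_forall fun x hx => hR x (Ioo_subset_Icc_self hx))

end L2Bound

lemma l2Bound_of_continuousOn {a : ℝ → ℝ} {C : ℝ} (ha : ContinuousOn a (Icc 0 1))
    (h : ∀ x ∈ Icc (0 : ℝ) 1, |a x| ≤ C) : L2Bound a C := by
  have hone : L2Bound (fun _ => (1 : ℝ)) 1 :=
    (l2Bound_iff (memLp_const _) zero_le_one).2 (by simp)
  simpa using hone.continuousOn_mul ha h

lemma L2Bound.abs_primitive_le {x : ℝ} (h : L2Bound w C) (hx : x ∈ Icc (0 : ℝ) 1) :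
    |∫ s in (0 : ℝ)..x, w s| ≤ C := by
  have hL1 : ∫ s, |w s| ∂unitMeasure ≤ C := by
    have hCS := sq_integral_mul_le (memLp_const (1 : ℝ)) h.memLp.abs
    simp only [one_mul, one_pow, Pi.abs_apply, sq_abs, integral_const, probReal_univ, smul_eq_mul,
      mul_one] at hCS
    exact (abs_le_of_sq_le_sq' (hCS.trans h.integral_sq_le) h.nonneg).2
  have habs := intervalIntegrable_of_integrable_unitMeasure
    (integrable_of_memLp_two h.memLp).abs (left_mem_Icc.2 zero_le_one) (right_mem_Icc.2 zero_le_one)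
  rw [integral_unitMeasure] at hL1
  exact ((intervalIntegral.abs_integral_le_integral_abs hx.1).trans
    (intervalIntegral.integral_mono_interval le_rfl hx.1 hx.2
      (ae_of_all _ fun _ => abs_nonneg _) habs)).trans hL1

end L2Bound

section CBound

variable {n : ℕ} {a : ℝ → ℝ} {R : ℝ}

/-- `a ∈ C^n[0,1]`, with all derivatives up to order `n` at most `R` in absolute value. -/
structure CBound (n : ℕ) (a : ℝ → ℝ) (R : ℝ) : Prop where
  contDiffOn : ContDiffOn ℝ n a (Icc 0 1)
  abs_iteratedDerivWithin_le : ∀ k ≤ n, ∀ x ∈ Icc (0 : ℝ) 1,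
    |iteratedDerivWithin k a (Icc 0 1) x| ≤ R

namespace CBound

lemma abs_le (h : CBound n a R) : ∀ x ∈ Icc (0 : ℝ) 1, |a x| ≤ R := fun x hx => by
  simpa using h.abs_iteratedDerivWithin_le 0 n.zero_le x hx

lemma nonneg (h : CBound n a R) : 0 ≤ R :=
  (abs_nonneg _).trans (h.abs_le 0 (left_mem_Icc.2 zero_le_one))

lemma of_le {m : ℕ} (h : CBound n a R) (hm : m ≤ n) : CBound m a R :=
  ⟨h.contDiffOn.of_le (by exact_mod_cast hm),
    fun k hk => h.abs_iteratedDerivWithin_le k (hk.trans hm)⟩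

lemma derivWithin (h : CBound (n + 1) a R) : CBound n (derivWithin a (Icc 0 1)) R := by
  refine ⟨h.contDiffOn.derivWithin (uniqueDiffOn_Icc one_pos) (by norm_cast), fun k hk x hx => ?_⟩
  rw [← iteratedDerivWithin_succ']
  exact h.abs_iteratedDerivWithin_le (k + 1) (by lia) x hx

lemma contDiffOn_one (h : CBound (n + 1) a R) : ContDiffOn ℝ 1 a (Icc 0 1) :=
  h.contDiffOn.of_le (by norm_cast; lia)

end CBound

lemma normC_nonneg (n : ℕ) (a : ℝ → ℝ) : 0 ≤ normC n a :=
  Finset.sum_nonneg fun _ _ => Real.iSup_nonneg fun _ => abs_nonneg _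

lemma cBound_normC (ha : ContDiffOn ℝ n a (Icc 0 1)) : CBound n a (normC n a) := by
  refine ⟨ha, fun k hk x hx => ?_⟩
  obtain ⟨M, hM⟩ := isCompact_Icc.exists_bound_of_continuousOn
    (ha.continuousOn_iteratedDerivWithin (m := k) (by exact_mod_cast hk)
      (uniqueDiffOn_Icc one_pos))
  have hbdd : BddAbove (range fun x : Icc (0 : ℝ) 1 => |iteratedDerivWithin k a (Icc 0 1) x|) :=
    ⟨M, by rintro _ ⟨y, rfl⟩; exact hM y y.2⟩
  refine (le_ciSup hbdd ⟨x, hx⟩).trans ?_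
  exact Finset.single_le_sum
    (f := fun k => ⨆ x : Icc (0 : ℝ) 1, |iteratedDerivWithin k a (Icc 0 1) x|)
    (fun _ _ => Real.iSup_nonneg fun _ => abs_nonneg _) (Finset.mem_range.2 (by lia))

lemma CBound.mono {R' : ℝ} (h : CBound n a R) (hR : R ≤ R') : CBound n a R' :=
  ⟨h.contDiffOn, fun k hk x hx => (h.abs_iteratedDerivWithin_le k hk x hx).trans hR⟩

end CBound

section HBound

variable {n : ℕ} {w w' : ℝ → ℝ} {C C' : ℝ}

/-- `w ∈ H^n(0,1)`, with the `L²` norms of all derivatives up to order `n` at most `C`. The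
derivative is described by its primitive rather than by test functions, so that the product rule is
integration by parts for absolutely continuous functions. -/
def HBound : ℕ → (ℝ → ℝ) → ℝ → Prop
  | 0, w, C => L2Bound w C
  | n + 1, w, C => L2Bound w C ∧ ∃ (c : ℝ) (g : ℝ → ℝ),
      (∀ᵐ x ∂unitMeasure, w x = c + ∫ s in (0 : ℝ)..x, g s) ∧ HBound n g C

namespace HBound

lemma l2Bound (h : HBound n w C) : L2Bound w C := by
  cases n with
  | zero => exact h
  | succ n => exact h.1

lemma nonneg (h : HBound n w C) : 0 ≤ C := h.l2Bound.nonneg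

lemma integrable (h : HBound n w C) : Integrable w unitMeasure :=
  integrable_of_memLp_two h.l2Bound.memLp

lemma congr (h : HBound n w C) (hw : w =ᵐ[unitMeasure] w') : HBound n w' C := by
  cases n with
  | zero => exact L2Bound.congr h hw
  | succ n =>
    obtain ⟨hL2, c, g, hwg, hg⟩ := h
    refine ⟨hL2.congr hw, c, g, ?_, hg⟩
    filter_upwards [hwg, hw] with x hx hx'
    rw [← hx', hx]

lemma mono (h : HBound n w C) (hC : C ≤ C') : HBound n w C' := by
  induction n generalizing w with
  | zero => exact L2Bound.mono h hC
  | succ n ih =>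
    obtain ⟨hL2, c, g, hwg, hg⟩ := h
    exact ⟨hL2.mono hC, c, g, hwg, ih hg⟩

lemma of_succ (h : HBound (n + 1) w C) : HBound n w C := by
  induction n generalizing w with
  | zero => exact h.1
  | succ n ih =>
    obtain ⟨hL2, c, g, hwg, hg⟩ := h
    exact ⟨hL2, c, g, hwg, ih hg⟩

lemma add (h : HBound n w C) (h' : HBound n w' C') :
    HBound n (fun x => w x + w' x) (C + C') := by
  induction n generalizing w w' with
  | zero => exact L2Bound.add h h'
  | succ n ih =>
    obtain ⟨hL2, c, g, hwg, hg⟩ := h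
    obtain ⟨hL2', c', g', hwg', hg'⟩ := h'
    refine ⟨hL2.add hL2', c + c', _, ?_, ih hg hg'⟩
    filter_upwards [hwg, hwg', ae_unitMeasure_of_forall fun x hx => hx] with x hx hx' hx01
    have h0 : (0 : ℝ) ∈ Icc (0 : ℝ) 1 := left_mem_Icc.2 zero_le_one
    have hxm := Ioo_subset_Icc_self hx01
    rw [hx, hx', intervalIntegral.integral_add
      (intervalIntegrable_of_integrable_unitMeasure hg.integrable h0 hxm)
      (intervalIntegrable_of_integrable_unitMeasure hg'.integrable h0 hxm), add_add_add_comm]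

lemma neg (h : HBound n w C) : HBound n (fun x => -w x) C := by
  induction n generalizing w with
  | zero => exact L2Bound.neg h
  | succ n ih =>
    obtain ⟨hL2, c, g, hwg, hg⟩ := h
    refine ⟨hL2.neg, -c, _, ?_, ih hg⟩
    filter_upwards [hwg] with x hx
    rw [hx, intervalIntegral.integral_neg, neg_add]

lemma sub (h : HBound n w C) (h' : HBound n w' C') :
    HBound n (fun x => w x - w' x) (C + C') := by
  simpa only [sub_eq_add_neg] using h.add h'.neg

lemma const (n : ℕ) {a : ℝ} (h : |a| ≤ C) : HBound n (fun _ => a) C := by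
  have hL2 : ∀ a : ℝ, |a| ≤ C → L2Bound (fun _ => a) C := fun a ha =>
    l2Bound_of_continuousOn continuousOn_const fun _ _ => ha
  induction n generalizing a with
  | zero => exact hL2 a h
  | succ n ih =>
    exact ⟨hL2 a h, a, fun _ => 0, ae_of_all _ fun x => by simp,
      ih (by simpa using (abs_nonneg a).trans h)⟩

lemma primitive (h : HBound n w C) : HBound (n + 1) (fun x => ∫ s in (0 : ℝ)..x, w s) C :=
  ⟨l2Bound_of_continuousOn (continuousOn_primitive h.integrable)
    fun _ hx => h.l2Bound.abs_primitive_le hx, 0, w, ae_of_all _ fun _ => (zero_add _).symm, h⟩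

lemma cBound_mul {a : ℝ → ℝ} {R : ℝ} (ha : CBound n a R) (h : HBound n w C) :
    HBound n (fun x => a x * w x) (2 ^ n * R * C) := by
  induction n generalizing a w with
  | zero =>
    rw [pow_zero, one_mul]
    exact h.l2Bound.continuousOn_mul ha.contDiffOn.continuousOn ha.abs_le
  | succ n ih =>
    have hRC : 0 ≤ R * C := mul_nonneg ha.nonneg h.nonneg
    have hderiv : HBound n (fun x => derivWithin a (Icc 0 1) x * w x) (2 ^ n * R * C) :=
      ih ha.derivWithin h.of_succ
    obtain ⟨hL2, c, g, hwg, hg⟩ := h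
    refine ⟨(hL2.continuousOn_mul ha.contDiffOn.continuousOn ha.abs_le).mono ?_, _, _,
      mul_ae_eq_primitive ha.contDiffOn_one hg.integrable hwg,
      (hderiv.add (ih (ha.of_le n.le_succ) hg)).mono (by rw [pow_succ]; linarith)⟩
    rw [mul_assoc]
    exact le_mul_of_one_le_left hRC (one_le_pow₀ one_le_two)

end HBound

lemma L2Bound.inv_mul {K : ℝ → ℝ} {Km : ℝ} (h : L2Bound w C) (hKm : 0 < Km)
    (hK : ContinuousOn K (Icc 0 1)) (hle : ∀ x ∈ Icc (0 : ℝ) 1, Km ≤ K x) :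
    L2Bound (fun x => (K x)⁻¹ * w x) (Km⁻¹ * C) := by
  refine h.continuousOn_mul (hK.inv₀ fun x hx => (hKm.trans_le (hle x hx)).ne') fun x hx => ?_
  rw [abs_of_pos (inv_pos.2 (hKm.trans_le (hle x hx)))]
  exact inv_anti₀ hKm (hle x hx)

lemma exists_hBound_inv_mul {Km R : ℝ} (hKm : 0 < Km) (hR : 0 ≤ R) (n : ℕ) :
    ∃ D > 0, ∀ K : ℝ → ℝ, CBound n K R → (∀ x ∈ Icc (0 : ℝ) 1, Km ≤ K x) →
      ∀ q C, HBound n q C → HBound n (fun x => (K x)⁻¹ * q x) (D * C) := by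
  induction n with
  | zero => exact ⟨Km⁻¹, inv_pos.2 hKm, fun K hK hle q C hq =>
      L2Bound.inv_mul hq hKm hK.contDiffOn.continuousOn hle⟩
  | succ n ih =>
    obtain ⟨D, hD, ih⟩ := ih
    refine ⟨Km⁻¹ + D * (1 + 2 ^ n * R * D), by positivity, fun K hK hle q C hq => ?_⟩
    have hKn := hK.of_le n.le_succ
    have hdq : HBound n (fun x => derivWithin K (Icc 0 1) x * ((K x)⁻¹ * q x))
        (2 ^ n * R * (D * C)) := (ih K hKn hle q C hq.of_succ).cBound_mul hK.derivWithin
    have hL2le : 0 ≤ D * (1 + 2 ^ n * R * D) * C := by have := hq.nonneg; positivity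
    have hle' : 0 ≤ Km⁻¹ * C := by have := hq.nonneg; positivity
    obtain ⟨hL2, c, g, hqg, hg⟩ := hq
    exact ⟨(hL2.inv_mul hKm hK.contDiffOn.continuousOn hle).mono (by linarith), _, _,
      inv_mul_ae_eq_primitive hK.contDiffOn_one (fun x hx => (hKm.trans_le (hle x hx)).ne')
        hg.integrable hqg,
      (ih K hKn hle _ _ (hg.sub hdq)).mono (by linarith)⟩

end HBound

section NormH

variable {n k : ℕ} {w g g' : ℝ → ℝ} {C : ℝ}

lemma MemH.isWeakDeriv (h : MemH n w) (hk : k ≤ n) : IsWeakDeriv k w (weakDeriv k w) :=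
  (h.2 k hk).choose_spec.weakDeriv

lemma isWeakDeriv_succ_iff (hg : IsWeakDeriv 1 w g) :
    IsWeakDeriv (k + 1) w g' ↔ IsWeakDeriv k g g' := by
  refine and_congr_right fun _ => forall₂_congr fun φ hφ => ?_
  rw [iteratedDeriv_succ, (isWeakDeriv_one_iff.1 hg).2 _ (hφ.iteratedDeriv k), pow_succ,
    mul_neg_one, neg_mul, neg_inj]

lemma MemH.isWeakDeriv_weakDeriv_one (h : MemH (n + 1) w) (hk : k ≤ n) :
    IsWeakDeriv k (weakDeriv 1 w) (weakDeriv (k + 1) w) :=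
  (isWeakDeriv_succ_iff (h.isWeakDeriv (by lia))).1 (h.isWeakDeriv (by lia))

lemma MemH.weakDeriv_one (h : MemH (n + 1) w) : MemH n (weakDeriv 1 w) :=
  ⟨(h.isWeakDeriv (by lia)).1, fun _ hk => ⟨_, h.isWeakDeriv_weakDeriv_one hk⟩⟩

lemma integral_weakDeriv_sq (hg : IsWeakDeriv k w g) :
    ∫ x, weakDeriv k w x ^ 2 ∂unitMeasure = ∫ x, g x ^ 2 ∂unitMeasure :=
  integral_congr_ae (hg.weakDeriv_ae_eq.pow_const 2)

lemma normH_weakDeriv_one_le (h : MemH (n + 1) w) : normH n (weakDeriv 1 w) ≤ normH (n + 1) w := by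
  refine Real.sqrt_le_sqrt ?_
  rw [Finset.sum_range_succ' _ (n + 1)]
  refine le_add_of_le_of_nonneg (Finset.sum_le_sum fun k hk => le_of_eq ?_)
    (integral_nonneg fun x => sq_nonneg _)
  exact integral_weakDeriv_sq
    (h.isWeakDeriv_weakDeriv_one (by simpa [Nat.lt_succ_iff] using hk))

lemma MemH.l2Bound (h : MemH n w) : L2Bound w (normH n w) := by
  have hnonneg : 0 ≤ normH n w := Real.sqrt_nonneg _
  refine (l2Bound_iff h.1 hnonneg).2 ?_
  rw [normH, Real.sq_sqrt (Finset.sum_nonneg fun _ _ => integral_nonneg fun x => sq_nonneg _),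
    ← integral_weakDeriv_sq (isWeakDeriv_zero h.1)]
  exact Finset.single_le_sum (f := fun k => ∫ x, weakDeriv k w x ^ 2 ∂unitMeasure)
    (fun _ _ => integral_nonneg fun x => sq_nonneg _) (by simp)

lemma MemH.hBound (h : MemH n w) : HBound n w (normH n w) := by
  induction n generalizing w with
  | zero => exact h.l2Bound
  | succ n ih =>
    obtain ⟨c, hc⟩ := (h.isWeakDeriv (k := 1) (by lia)).exists_eq_primitive
      (integrable_of_memLp_two h.1)
    exact ⟨h.l2Bound, c, _, hc, (ih h.weakDeriv_one).mono (normH_weakDeriv_one_le h)⟩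

namespace HBound

lemma exists_isWeakDeriv (h : HBound n w C) (hk : k ≤ n) :
    ∃ g, IsWeakDeriv k w g ∧ L2Bound g C := by
  induction k generalizing n w with
  | zero => exact ⟨w, isWeakDeriv_zero h.l2Bound.memLp, h.l2Bound⟩
  | succ k ih =>
    obtain ⟨n, rfl⟩ := Nat.exists_eq_add_of_lt hk
    obtain ⟨-, c, g, hwg, hg⟩ := h
    obtain ⟨g', hg', hC⟩ := ih hg (by lia)
    exact ⟨g', (isWeakDeriv_succ_iff
      (isWeakDeriv_one_of_eq_primitive hg.l2Bound.memLp hwg)).2 hg', hC⟩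

lemma memH (h : HBound n w C) : MemH n w :=
  ⟨h.l2Bound.memLp, fun _ hk => (h.exists_isWeakDeriv hk).imp fun _ hg => hg.1⟩

lemma normH_le (h : HBound n w C) : normH n w ≤ √(n + 1) * C := by
  have hsq : ∀ k ∈ Finset.range (n + 1), ∫ x, weakDeriv k w x ^ 2 ∂unitMeasure ≤ C ^ 2 := by
    intro k hk
    obtain ⟨g, hg, hC⟩ := h.exists_isWeakDeriv (k := k) (by simpa [Nat.lt_succ_iff] using hk)
    exact (integral_weakDeriv_sq hg).trans_le hC.integral_sq_le
  rw [normH, ← Real.sqrt_sq h.nonneg, ← Real.sqrt_mul (by positivity)]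
  exact Real.sqrt_le_sqrt (by simpa using Finset.sum_le_card_nsmul _ _ _ hsq)

end HBound

end NormH

section Regularity

variable {β θ Km KM C : ℝ} {K f : ℝ → ℝ}

lemma IsDiffusivity.le_of_continuousOn (hK : IsDiffusivity Km KM K)
    (hc : ContinuousOn K (Icc 0 1)) : ∀ x ∈ Icc (0 : ℝ) 1, Km ≤ K x := fun _ hx =>
  max_eq_left_iff.1 <| eqOn_Icc_of_ae_eq (hc.sup continuousOn_const) hc
    (hK.2.mono fun _ hx => max_eq_left hx.1) hx

lemma abs_le_of_integral_mul_const_sub_eq_zero {α : Type*} [MeasurableSpace α] {μ : Measure α}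
    {q F : α → ℝ} {a : ℝ} (hq : Integrable q μ) (hq0 : ∀ᵐ x ∂μ, 0 ≤ q x) (hpos : 0 < ∫ x, q x ∂μ)
    (hFm : AEStronglyMeasurable F μ) (hF : ∀ᵐ x ∂μ, |F x| ≤ C)
    (h : ∫ x, q x * (a - F x) ∂μ = 0) : |a| ≤ C := by
  have hqF : Integrable (fun x => q x * F x) μ := hq.mul_bdd (c := C) hFm hF
  have hmean : a * ∫ x, q x ∂μ = ∫ x, q x * F x ∂μ := by
    simp only [mul_sub] at h
    rwa [integral_sub (hq.mul_const a) hqF, integral_mul_const, mul_comm, sub_eq_zero] at h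
  refine le_of_mul_le_mul_right ?_ hpos
  calc |a| * ∫ x, q x ∂μ = |∫ x, q x * F x ∂μ| := by rw [← hmean, abs_mul, abs_of_pos hpos]
    _ ≤ ∫ x, |q x * F x| ∂μ := abs_integral_le_integral_abs
    _ ≤ ∫ x, C * q x ∂μ := by
        refine integral_mono_ae hqF.abs (hq.const_mul C) ?_
        filter_upwards [hF, hq0] with x hFx hqx
        rw [abs_mul, abs_of_nonneg hqx, mul_comm]
        exact mul_le_mul_of_nonneg_right hFx hqx
    _ = C * ∫ x, q x ∂μ := integral_const_mul _ _

lemma exists_fracDeriv_ae_eq_inv_mul_flux (hβ : 0 < β) (hβ' : β < 1 / 2) (hθ : θ = 0 ∨ θ = 1)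
    (hKm : 0 < Km) (hK : IsDiffusivity Km KM K) (hf : MemLp f 2 unitMeasure) {u : H0 (1 - β)}
    (hu : IsWeakSolution β θ K (fun v => ∫ x, f x * v.fn x ∂unitMeasure) u) :
    ∃ a : ℝ, fracDeriv hβ hβ' hθ u =ᵐ[unitMeasure]
      fun x => (K x)⁻¹ * (a - ∫ s in (0 : ℝ)..x, f s) := by
  have hd := (isWeakDeriv_fracInt hβ hβ' hθ u).weakDeriv_ae_eq
  have hflux : MemLp (fun x => K x * weakDeriv 1 (fracInt β θ u.fn) x) 2 unitMeasure :=
    (isWeakDeriv_fracInt hβ hβ' hθ u).weakDeriv.1.mul (hK.memLp_top hKm)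
  obtain ⟨a, ha⟩ := ae_add_primitive_eq_const hflux hf hu
  refine ⟨a, ?_⟩
  filter_upwards [ha, hd, hK.ae_pos hKm] with x hax hdx hKx
  rw [← hax, add_sub_cancel_right, inv_mul_cancel_left₀ hKx.ne', hdx]

/-- `D I^β_θ u` is orthogonal to the weight, so the constant is a weighted mean of `∫₀ˣ f`. -/
lemma abs_flux_const_le (hβ : 0 < β) (hβ' : β < 1 / 2) (hθ : θ = 0 ∨ θ = 1) (hKm : 0 < Km)
    (hK : IsDiffusivity Km KM K) (hf : L2Bound f C) {u : H0 (1 - β)} {a : ℝ}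
    (h : fracDeriv hβ hβ' hθ u =ᵐ[unitMeasure] fun x => (K x)⁻¹ * (a - ∫ s in (0 : ℝ)..x, f s)) :
    |a| ≤ C := by
  have hw1 : ∀ᵐ x ∂unitMeasure, 1 ≤ weight β θ x :=
    ae_unitMeasure_of_forall fun _ hx => one_le_weight hβ.le hθ hx
  have hq0 : ∀ᵐ x ∂unitMeasure, 0 ≤ weight β θ x * (K x)⁻¹ := by
    filter_upwards [hw1, hK.ae_pos hKm] with x hwx hKx
    exact mul_nonneg (zero_le_one.trans hwx) (inv_nonneg.2 hKx.le)
  refine abs_le_of_integral_mul_const_sub_eq_zero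
    ((memLp_weight hβ' hθ).integrable_mul (hK.memLp_inv hKm)) hq0
    ((inv_pos.2 (hKm.trans_le hK.le)).trans_le
      (hK.inv_le_integral_mul_inv hKm (memLp_weight hβ' hθ) hw1))
    (memLp_two_of_continuousOn (continuousOn_primitive (integrable_of_memLp_two hf.memLp))).1
    (ae_unitMeasure_of_forall fun _ hx => hf.abs_primitive_le (Ioo_subset_Icc_self hx)) ?_
  refine Eq.trans (integral_congr_ae ?_) (integral_weight_mul_fracDeriv hβ hβ' hθ u)
  filter_upwards [h] with x hx
  rw [hx, Pi.mul_apply, mul_assoc]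

lemma abs_fracInt_le (hβ : 0 < β) (hβ' : β < 1 / 2) (hθ : θ = 0 ∨ θ = 1) {u : H0 (1 - β)}
    (hC : L2Bound (fracDeriv hβ hβ' hθ u) C) {x : ℝ} (hx : x ∈ Icc (0 : ℝ) 1) :
    |fracInt β θ u.fn x| ≤ 2 * C := by
  have h1mem := right_mem_Icc.2 (zero_le_one (α := ℝ))
  have h0 : |fracInt β θ u.fn 0| ≤ C := by
    rcases hθ with rfl | rfl
    · have h1 := fracInt_fn_eq hβ hβ' (.inl rfl) u h1mem
      rw [fracInt_one_right, zero_mul] at h1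
      rw [eq_neg_of_add_eq_zero_left h1.symm, abs_neg]
      exact hC.abs_primitive_le h1mem
    · simpa [fracInt_zero_right] using hC.nonneg
  rw [fracInt_fn_eq hβ hβ' hθ u hx, two_mul]
  exact (abs_add_le _ _).trans (add_le_add h0 (hC.abs_primitive_le hx))

lemma hBound_fracInt (hβ : 0 < β) (hβ' : β < 1 / 2) (hθ : θ = 0 ∨ θ = 1) {n : ℕ} {u : H0 (1 - β)}
    (h : HBound n (fracDeriv hβ hβ' hθ u) C) : HBound (n + 1) (fracInt β θ u.fn) (2 * C) :=
  ⟨l2Bound_of_continuousOn (continuousOn_fracInt hβ hβ' hθ u)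
    fun _ hx => abs_fracInt_le hβ hβ' hθ h.l2Bound hx, _, _,
    ae_unitMeasure_of_forall fun _ hx => fracInt_fn_eq hβ hβ' hθ u (Ioo_subset_Icc_self hx),
    h.mono (by linarith [h.nonneg])⟩

theorem exists_regularity_bound (hβ : 0 < β) (hβ' : β < 1 / 2) (hθ : θ = 0 ∨ θ = 1) (hKm : 0 < Km)
    (KM : ℝ) (m : ℕ) (R : ℝ) : ∃ C > 0, ∀ K, IsDiffusivity Km KM K →
      ContDiffOn ℝ (m + 1 : ℕ) K (Icc 0 1) → normC (m + 1) K ≤ R → ∀ f, MemH m f →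
      ∀ u : H0 (1 - β), IsWeakSolution β θ K (fun v => ∫ x, f x * v.fn x ∂unitMeasure) u →
        MemH (m + 2) (fracInt β θ u.fn) ∧ normH (m + 2) (fracInt β θ u.fn) ≤ C * normH m f := by
  obtain ⟨D, hD, hdiv⟩ := exists_hBound_inv_mul hKm (le_max_right R 0) (m + 1)
  refine ⟨√((m + 2 : ℕ) + 1) * (4 * D), by positivity, fun K hK hKc hR f hf u hu => ?_⟩
  obtain ⟨a, ha⟩ := exists_fracDeriv_ae_eq_inv_mul_flux hβ hβ' hθ hKm hK hf.1 hu
  have hflux : HBound (m + 1) (fun x => a - ∫ s in (0 : ℝ)..x, f s) (normH m f + normH m f) :=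
    (HBound.const _ (abs_flux_const_le hβ hβ' hθ hKm hK hf.l2Bound ha)).sub hf.hBound.primitive
  have hTu : HBound (m + 1) (fracDeriv hβ hβ' hθ u) (D * (normH m f + normH m f)) :=
    (hdiv K ((cBound_normC hKc).mono (hR.trans (le_max_left _ _)))
      (hK.le_of_continuousOn hKc.continuousOn) _ _ hflux).congr ha.symm
  have hI := hBound_fracInt hβ hβ' hθ hTu
  exact ⟨hI.memH, hI.normH_le.trans_eq (by ring)⟩

end Regularity

end FracDiff

open FracDiff in
theorem theorem7p1 (β θ Km KM : ℝ) (hβ : 0 < β) (hβ' : β < 1 / 2) (hθ : θ = 0 ∨ θ = 1)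
    (hKm : 0 < Km) :
    -- the auxiliary functions exist and are unique, and the nondegeneracy condition holds
    (∀ K : ℝ → ℝ, IsDiffusivity Km KM K →
      (∃ wl, IsWl K wl ∧ (∀ w, IsWl K w → Set.EqOn w wl (Set.Icc 0 1)) ∧
        ∃! ul : H0 (1 - β), IsUl β θ wl ul) ∧
      Nondegenerate β θ K) ∧
    -- existence, and uniqueness if and only if the nondegeneracy condition holds
    (∀ K : ℝ → ℝ, IsDiffusivity Km KM K → ∀ f : HNeg1,
      (∃ u, IsWeakSolution β θ K f u) ∧
      ((∃! u, IsWeakSolution β θ K f u) ↔ Nondegenerate β θ K)) ∧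
    -- boundedness and weak coercivity of the bilinear form, well-posedness and stability
    (∃ M κ : ℝ, 0 < κ ∧ ∀ K : ℝ → ℝ, IsDiffusivity Km KM K →
      (∀ u : H0 (1 - β), MemH 1 (fracInt β θ u.fn)) ∧
      (∃ B : H0 (1 - β) →L[ℝ] H0 1 →L[ℝ] ℝ,
        (∀ w v, B w v = formA β θ K w v) ∧ ‖B‖ ≤ M) ∧
      ((κ : EReal) ≤ ⨅ w : {w : H0 (1 - β) // w ≠ 0}, ⨆ v : {v : H0 1 // v ≠ 0},
        ((formA β θ K w v / (‖(w : H0 (1 - β))‖ * ‖(v : H0 1)‖) : ℝ) : EReal)) ∧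
      (∀ v : H0 1, v ≠ 0 → (0 : EReal) < ⨆ w : H0 (1 - β), (formA β θ K w v : EReal)) ∧
      (∀ f : HNeg1, ∃! u, IsWeakSolution β θ K f u) ∧
      (∀ (f : HNeg1) (u : H0 (1 - β)), IsWeakSolution β θ K f u → ‖u‖ ≤ 1 / κ * ‖f‖)) ∧
    -- regularity
    (∀ (m : ℕ) (R : ℝ), ∃ C : ℝ, 0 < C ∧ ∀ K : ℝ → ℝ, IsDiffusivity Km KM K →
      ContDiffOn ℝ (m + 1 : ℕ) K (Set.Icc 0 1) → normC (m + 1) K ≤ R →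
      ∀ f : ℝ → ℝ, MemH m f →
        (∃! u : H0 (1 - β), IsWeakSolution β θ K (fun v => ∫ x, f x * v.fn x ∂unitMeasure) u) ∧
        ∀ u : H0 (1 - β), IsWeakSolution β θ K (fun v => ∫ x, f x * v.fn x ∂unitMeasure) u →
          MemH (m + 2) (fracInt β θ u.fn) ∧
          normH (m + 2) (fracInt β θ u.fn) ≤ C * (normC (m + 1) K + normH m f)) := by
  refine ⟨fun K hK => ⟨exists_isWl_existsUnique_isUl hβ hβ' hθ hKm hK,
    nondegenerate hβ hβ' hθ hKm hK⟩, fun K hK f => ?_, ?_, fun m R => ?_⟩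
  · have huniq := existsUnique_isWeakSolution hβ hβ' hθ hKm hK f
    exact ⟨huniq.exists, iff_of_true huniq (nondegenerate hβ hβ' hθ hKm hK)⟩
  · obtain ⟨κ, hκ, hbelow⟩ := exists_mul_norm_le_norm_formBilin hβ hβ' hθ hKm KM
    refine ⟨KM, κ, hκ, fun K hK => ⟨memH_one_fracInt hβ hβ' hθ,
      ⟨formBilin hβ hβ' hθ hKm hK, formBilin_apply hβ hβ' hθ hKm hK,
        norm_formBilin_le hβ hβ' hθ hKm hK⟩, ?_, fun v hv => ?_,
      existsUnique_isWeakSolution hβ hβ' hθ hKm hK, fun f u hu => ?_⟩⟩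
    · simpa only [formBilin_apply] using le_iInf_iSup_div hκ (hbelow K hK)
    · obtain ⟨w, hw⟩ := exists_formA_pos hβ hβ' hθ hKm hK hv
      exact (EReal.coe_pos.2 hw).trans_le (le_iSup (fun w => (formA β θ K w v : EReal)) w)
    · rw [← (isWeakSolution_iff hβ hβ' hθ hKm hK).1 hu, one_div, ← div_eq_inv_mul,
        le_div_iff₀' hκ]
      exact hbelow K hK u
  · obtain ⟨C, hC, hreg⟩ := exists_regularity_bound hβ hβ' hθ hKm KM m R
    refine ⟨C, hC, fun K hK hKc hR f hf =>
      ⟨existsUnique_isWeakSolution_integral hβ hβ' hθ hKm hK hf.1, fun u hu => ?_⟩⟩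
    refine (hreg K hK hKc hR f hf u hu).imp_right fun h => h.trans ?_
    exact mul_le_mul_of_nonneg_left (le_add_of_nonneg_left (normC_nonneg _ _)) hC.le
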